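/- **Setting.** A network is a finite undirected (multi)graph $G=(V,E)$ with $n=|V|$ nodes and $m=|E|$ links. Exactly one link fails; link $e$ is the failed one with probability $P_f(e)\ge 0$, where $\sum_{e\in E}P_f(e)=1$. For a set $S$ of links, $P_f(S)=\sum_{e\in S}P_f(e)$. A path visits no node twice and is identified with its set of links. **Problem 2CP-1.** Given are nodes $s_1,t_1,s_2,t_2$ and two link-disjoint paths $p_1,b_1$ from $s_1$ to $t_1$ (primary and backup path of the first connection). A pair $(p_2,b_2)$ of paths from $s_2$ to $t_2$ is *feasible* if $p_1\cap p_2=\emptyset$. When link $e$ fails, the first connection, which has priority, occupies $b_1$ if $e\in p_1$ and $p_1$ otherwise; the second connection fails if each of $p_2$ and $b_2$ contains $e$ or meets the occupied path. The probability $P_f(c_2)$ of this event is * $P_f(p_2\cap b_2)$ if $b_1\cap p_2=\emptyset$ and $p_1\cap b_2=\emptyset$ (shared backup); * $P_f(p_2\cap b_2)+P_f(p_1\setminus b_1)$ if $b_1\cap p_2\ne\emptyset$, $b_1\cap b_2\neq\emptyset$, $p_1\cap b_2=\emptyset$ (unavoidable first backup); * $P_f(p_2)+P_f(p_1\cap b_2)$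 if $b_1\cap p_2\neq\emptyset$, $b_1\cap b_2=\emptyset$, $p_1\cap b_2\ne\emptyset$ (overlapped connection). The problem is to find a feasible pair with the least failure probability $P_f(c_2)$. **Algorithm SCA.** A *tunable pair* in a graph $H$ is a pair of paths from $s_2$ to $t_2$ in $H$ whose common links are exactly the bridge links of $H$ that separate $s_2$ from $t_2$. Let $G_1=G-p_1$, $G_2=G-p_1-b_1$, $G_1'=G-b_1$ (links removed). 1. If $s_2,t_2$ are not connected in $G_2$, go to 4. Otherwise find the bridge links $e_1,\dots,e_r$ of $G_2$ that separate $s_2$ from $t_2$. 2. Removing them splits the component of $s_2,t_2$ in $G_2$ into $C_1\ni s_2,\dots,C_{r+1}\ni t_2$, where $e_l$ joins $v_l\in C_l$ to $u_{l+1}\in C_{l+1}$; put $u_1=s_2$, $v_{r+1}=t_2$. Let $C_i$ and $C_j$ be the first and the last component with a node on $b_1$, if any, and choose nodes $x_i\in C_i$, $x_j\in C_j$ of $b_1$. 3. Take a tunable pair in $G_2$. If no component has a node on $b_1$, or $i=j$, return it. Otherwise add a fictitious link $x_ix_j$ to $G_2$ and take two link-disjoint paths $p_a,p_b$ from $u_i$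 to $v_j$, where $p_b$ uses the fictitious link. In the primary path of the tunable pair replace the part from $u_i$ to $v_j$ by $p_a$. In the backup path replace that part by $p_b$, with the fictitious link replaced by the part of $b_1$ between $x_i$ and $x_j$ (cycles of the resulting walk, if any, are removed). Return the two paths. 4. If $s_2,t_2$ are not connected in $G_1$, report that there is no feasible pair. Otherwise take a tunable pair in $G_1$ and let $q_1$ be its failure probability $P_f(c_2)$. 5. Let $p_2$ be a shortest path from $s_2$ to $t_2$ in $G_1$ with weights $P_f$, and $b_2$ a shortest path from $s_2$ to $t_2$ in $G_1'$ where links of $p_1$ have weight $P_f$ and other links have weight $0$. Let $q_2$ be the failure probability $P_f(c_2)$ of $(p_2,b_2)$ ($q_2=\infty$ if there is no such $b_2$). 6. If $q_2<q_1$, return $(p_2,b_2)$; otherwise return the tunable pair of step 4. **Theorem.** Algorithm SCA solves Problem 2CP-1 optimally in $O(n\cdot m)$ steps. That is: (a) Whatever choices are made where the algorithm leaves them open: if it reports that there is no feasible pair, then there is none; if it returns $(p_2,b_2)$, then this pair is feasible, it is in one of the three cases above, and no feasible pair has a smaller failure probability of the second connection. (b) There are a constant $C$ and one program of a unit-cost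 random access machine (whose integers can only be copied, compared, incremented and decremented, and whose real weights can only be copied, compared and added) that, on every instance with $n$ nodes and $m$ links, halts after at most $C\cdot n\cdot m$ steps with a result of Algorithm SCA. -/

import Mathlib

namespace Survivable

/-! ### Walks and paths in undirected multigraphs

Graphs are Mathlib's multigraphs `Graph α β` (`α`: nodes, `β`: links). -/

section Paths

variable {α β : Type*}

/-- `IsWalk G u es v vs`: following the links `es` in order leads from `u` to `v` in `G`, and `vs`
is the list of the nodes that are visited (both ends included). -/
inductive IsWalk (G : Graph α β) : α → List β → α → List α → Prop
  | nil {u : α} : u ∈ G.vertexSet → IsWalk G u [] u [u]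
  | cons {u w v : α} {e : β} {es : List β} {vs : List α} :
      G.IsLink e u w → IsWalk G w es v vs → IsWalk G u (e :: es) v (u :: vs)

/-- The list of links `es` is a walk from `u` to `v`. -/
def WalkFromTo (G : Graph α β) (u : α) (es : List β) (v : α) : Prop :=
  ∃ vs, IsWalk G u es v vs

/-- The list of links `es` is a (simple) path from `u` to `v`: no node is visited twice. -/
def IsPath (G : Graph α β) (u : α) (es : List β) (v : α) : Prop :=
  ∃ vs, IsWalk G u es v vs ∧ vs.Nodup

/-- The node `x` lies on the walk `es` that starts at `u`. -/
def OnWalk (G : Graph α β) (u : α) (es : List β) (x : α) : Prop :=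
  ∃ v vs, IsWalk G u es v vs ∧ x ∈ vs

/-- `u` and `v` are in the same connected component of `G`. -/
def Connected (G : Graph α β) (u v : α) : Prop :=
  ∃ es, WalkFromTo G u es v

/-- `e` is a bridge link that separates `s` from `t`, two nodes of the same component of `G`. -/
def SepBridge (G : Graph α β) (s t : α) (e : β) : Prop :=
  e ∈ G.edgeSet ∧ Connected G s t ∧ ¬ Connected (G.deleteEdges {e}) s t

/-- A path of least total weight `w` from `u` to `v`. -/
def IsShortestPath (G : Graph α β) (w : β → ℝ) (u : α) (es : List β) (v : α) : Prop :=
  IsPath G u es v ∧ ∀ es', IsPath G u es' v → (es.map w).sum ≤ (es'.map w).sum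

/-- A result of the tunable survivability algorithm for one connection from `s` to `t` in `G`:
two paths from `s` to `t` whose common links are exactly the bridge links that separate `s`
from `t`. -/
def TunablePair (G : Graph α β) (s t : α) (p b : List β) : Prop :=
  IsPath G s p t ∧ IsPath G s b t ∧ ∀ e, (e ∈ p ∧ e ∈ b) ↔ SepBridge G s t e

/-- The graph `G` with one additional (fictitious) link `none` between `x` and `y`. -/
def addFictitious (G : Graph α β) (x y : α) : Graph α (Option β) where
  vertexSet := G.vertexSet ∪ {x, y}
  IsLink := fun o a b => match o with
    | none => (a = x ∧ b = y) ∨ (a = y ∧ b = x)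
    | some e => G.IsLink e a b
  isLink_symm := by
    rintro (_ | e) _
    · exact ⟨fun a b h => h.elim (fun h => Or.inr ⟨h.2, h.1⟩) (fun h => Or.inl ⟨h.2, h.1⟩)⟩
    · exact ⟨fun a b h => h.symm⟩
  eq_or_eq_of_isLink_of_isLink := by
    rintro (_ | e) a b c d h h'
    · grind
    · exact G.eq_or_eq_of_isLink_of_isLink h h'
  left_mem_of_isLink := by
    rintro (_ | e) a b h
    · grind
    · exact Or.inl h.left_mem

/-- The decomposition of the joint component of `s` and `t` in `G` into the successive components
`C 0, …, C r`, interlinked by the bridge links that separate `s` from `t`: the bridge link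
`bridge l` joins the node `v l` of `C l` to the node `u (l + 1)` of `C (l + 1)`. -/
structure DecompositionD1 (G : Graph α β) (s t : α) where
  r : ℕ
  bridge : Fin r → β
  u : Fin (r + 1) → α
  v : Fin (r + 1) → α
  bridge_injective : Function.Injective bridge
  range_bridge : ∀ e, e ∈ Set.range bridge ↔ SepBridge G s t e
  u_first : u 0 = s
  v_last : v (Fin.last r) = t
  isLink_bridge : ∀ l : Fin r, G.IsLink (bridge l) (v l.castSucc) (u l.succ)
  connected : ∀ l, Connected (G.deleteEdges (Set.range bridge)) (u l) (v l)

/-- The set of nodes of the component `C l`. -/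
def DecompositionD1.C {G : Graph α β} {s t : α} (D : DecompositionD1 G s t)
    (l : Fin (D.r + 1)) : Set α :=
  {x | Connected (G.deleteEdges (Set.range D.bridge)) (D.u l) x}

end Paths

/-! ### The problem -/

/-- The undirected multigraph on `Fin n` in which the link `e` has the two ends `ends e`. -/
def graphOf {n m : ℕ} (ends : Fin m → Fin n × Fin n) : Graph (Fin n) (Fin m) where
  vertexSet := Set.univ
  IsLink := fun e x y => ends e = (x, y) ∨ ends e = (y, x)
  isLink_symm := fun _ _ => ⟨fun _ _ h => h.symm⟩
  eq_or_eq_of_isLink_of_isLink := by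
    intro e x y v w h h'
    grind
  left_mem_of_isLink := fun _ _ _ _ => Set.mem_univ _

/-- An instance of Problem 2CP-1 with `n` nodes and `m` links: a network with the conditional
failure probabilities of its links (exactly one link fails), the terminals of the two connections,
and the link-disjoint primary and backup paths `p₁`, `b₁` of the first one. -/
structure Instance (n m : ℕ) where
  ends : Fin m → Fin n × Fin n
  prob : Fin m → ℝ
  prob_nonneg : ∀ e, 0 ≤ prob e
  sum_prob : ∑ e, prob e = 1
  s₁ : Fin n
  t₁ : Fin n
  s₂ : Fin n
  t₂ : Fin n
  p₁ : List (Fin m)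
  b₁ : List (Fin m)
  isPath_p₁ : IsPath (graphOf ends) s₁ p₁ t₁
  isPath_b₁ : IsPath (graphOf ends) s₁ b₁ t₁
  disjoint₁ : p₁.Disjoint b₁

namespace Instance

variable {n m : ℕ} (I : Instance n m)

/-- The network of the instance. -/
def G : Graph (Fin n) (Fin m) := graphOf I.ends

/-- The links in use by the first connection when `e` is the failed link. -/
def occupied (e : Fin m) : List (Fin m) := if e ∈ I.p₁ then I.b₁ else I.p₁

/-- When `e` is the failed link, the second connection can use its path `q`: `q` has not failed,
and none of its links is taken by the first connection, which has priority. -/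
def Usable (e : Fin m) (q : List (Fin m)) : Prop := e ∉ q ∧ q.Disjoint (I.occupied e)

open Classical in
/-- The failure probability of the second connection with primary path `p₂` and backup path `b₂`:
the probability that the failed link `e` is such that neither path can be used. -/
noncomputable def failureProb (p₂ b₂ : List (Fin m)) : ℝ :=
  ∑ e, if I.Usable e p₂ ∨ I.Usable e b₂ then 0 else I.prob e

/-- The failure probability of a set of links. -/
def linkProb (S : Finset (Fin m)) : ℝ := ∑ e ∈ S, I.prob e

/-- `p₂` and `b₂` are paths for the second connection, and `p₂` avoids `p₁`. -/
def Feasible (p₂ b₂ : List (Fin m)) : Prop :=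
  IsPath I.G I.s₂ p₂ I.t₂ ∧ IsPath I.G I.s₂ b₂ I.t₂ ∧ I.p₁.Disjoint p₂

/-- Only the two backup paths may intersect. -/
def SharedBackup (p₂ b₂ : List (Fin m)) : Prop :=
  I.b₁.Disjoint p₂ ∧ I.p₁.Disjoint b₂

/-- Both paths of the second connection intersect `b₁`, and none of them intersects `p₁`. -/
def UnavoidableFirstBackup (p₂ b₂ : List (Fin m)) : Prop :=
  ¬ I.b₁.Disjoint p₂ ∧ ¬ I.b₁.Disjoint b₂ ∧ I.p₁.Disjoint b₂

/-- `b₂` intersects `p₁` but not `b₁`, and `p₂` intersects `b₁`. -/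
def OverlappedConnection (p₂ b₂ : List (Fin m)) : Prop :=
  ¬ I.b₁.Disjoint p₂ ∧ I.b₁.Disjoint b₂ ∧ ¬ I.p₁.Disjoint b₂

/-- `x` is the value of the three-case objective at `(p₂, b₂)`. -/
inductive ThreeCaseValue (p₂ b₂ : List (Fin m)) : ℝ → Prop
  | shared : I.SharedBackup p₂ b₂ →
      ThreeCaseValue p₂ b₂ (I.linkProb (p₂.toFinset ∩ b₂.toFinset))
  | unavoidable : I.UnavoidableFirstBackup p₂ b₂ →
      ThreeCaseValue p₂ b₂ (I.linkProb (p₂.toFinset ∩ b₂.toFinset) +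
        I.linkProb (I.p₁.toFinset \ I.b₁.toFinset))
  | overlapped : I.OverlappedConnection p₂ b₂ →
      ThreeCaseValue p₂ b₂ (I.linkProb p₂.toFinset +
        I.linkProb (I.p₁.toFinset ∩ b₂.toFinset))

/-- In the three cases, the objective is the failure probability of the second connection. -/
theorem ThreeCaseValue.eq_failureProb {I : Instance n m} {p₂ b₂ : List (Fin m)} {x : ℝ}
    (hf : I.p₁.Disjoint p₂) (h : I.ThreeCaseValue p₂ b₂ x) : I.failureProb p₂ b₂ = x := by
  classical
  have h1 := I.disjoint₁
  have key : ∀ S : Finset (Fin m), I.linkProb S = ∑ e, if e ∈ S then I.prob e else 0 := by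
    intro S
    rw [linkProb, Finset.sum_ite_mem, Finset.univ_inter]
  unfold failureProb
  cases h with
  | shared h =>
    obtain ⟨ha, hb⟩ := h
    rw [key]
    refine Finset.sum_congr rfl fun e _ => ?_
    have hA : p₂.Disjoint (I.occupied e) := by
      unfold occupied; split_ifs
      · exact ha.symm
      · exact hf.symm
    have hB : e ∉ I.p₁ → b₂.Disjoint (I.occupied e) := by
      intro he; simp only [occupied, he, if_false]; exact hb.symm
    by_cases he : e ∈ I.p₁
    · have : e ∉ p₂ := fun h => hf he h
      simp [Usable, this, hA]
    · simp only [Usable, hA, hB he, and_true, Finset.mem_inter, List.mem_toFinset]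
      by_cases e ∈ p₂ <;> by_cases e ∈ b₂ <;> simp [*]
  | unavoidable h =>
    obtain ⟨ha, hb, hc⟩ := h
    rw [key, key, ← Finset.sum_add_distrib]
    refine Finset.sum_congr rfl fun e _ => ?_
    by_cases he : e ∈ I.p₁
    · have h2 : e ∉ p₂ := fun h => hf he h
      have h3 : e ∉ I.b₁ := fun h => h1 he h
      have hA : ¬ p₂.Disjoint I.b₁ := fun h => ha h.symm
      have hB : ¬ b₂.Disjoint I.b₁ := fun h => hb h.symm
      simp [Usable, occupied, he, h2, h3, hA, hB]
    · have hA := hf.symm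
      have hB := hc.symm
      simp only [Usable, occupied, he, if_false, hA, hB, and_true, Finset.mem_inter,
        List.mem_toFinset, Finset.mem_sdiff, false_and, add_zero]
      by_cases e ∈ p₂ <;> by_cases e ∈ b₂ <;> simp [*]
  | overlapped h =>
    obtain ⟨ha, hb, hc⟩ := h
    rw [key, key, ← Finset.sum_add_distrib]
    refine Finset.sum_congr rfl fun e _ => ?_
    by_cases he : e ∈ I.p₁
    · have h2 : e ∉ p₂ := fun h => hf he h
      have hA : ¬ p₂.Disjoint I.b₁ := fun h => ha h.symm
      have hB := hb.symm
      by_cases e ∈ b₂ <;> simp [Usable, occupied, *]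
    · have hA := hf.symm
      have hB : ¬ b₂.Disjoint I.p₁ := fun h => hc h.symm
      by_cases e ∈ p₂ <;> simp [Usable, occupied, *]

/-- The answer `o` solves Problem 2CP-1 optimally: `none` says that there is no feasible pair of
paths, and `some (p₂, b₂)` is a feasible pair in one of the three cases, whose value is least
among all feasible pairs. -/
def Solves : Option (List (Fin m) × List (Fin m)) → Prop
  | none => ∀ p₂ b₂, ¬ I.Feasible p₂ b₂
  | some (p₂, b₂) => I.Feasible p₂ b₂ ∧ ∃ x, I.ThreeCaseValue p₂ b₂ x ∧
      I.failureProb p₂ b₂ = x ∧ ∀ p b, I.Feasible p b → x ≤ I.failureProb p b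

/-! ### Algorithm SCA -/

/-- The network without the links of `p₁`. -/
def G₁ : Graph (Fin n) (Fin m) := I.G.deleteEdges {e | e ∈ I.p₁}

/-- The network without the links of `p₁` and `b₁`. -/
def G₂ : Graph (Fin n) (Fin m) := I.G.deleteEdges {e | e ∈ I.p₁ ∨ e ∈ I.b₁}

/-- The network without the links of `b₁`. -/
def G₁' : Graph (Fin n) (Fin m) := I.G.deleteEdges {e | e ∈ I.b₁}

/-- The weights of the links of `G₁'`: only the links of `p₁` keep their weight. -/
def weight' (e : Fin m) : ℝ := if e ∈ I.p₁ then I.prob e else 0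

/-- The part `g` of `b₁` between its nodes `x` and `y`, traversed from `x` to `y`. -/
def SegmentOfB₁ (x y : Fin n) (g : List (Fin m)) : Prop :=
  (∃ f h, I.b₁ = f ++ g ++ h ∧
    WalkFromTo I.G I.s₁ f x ∧ WalkFromTo I.G x g y ∧ WalkFromTo I.G y h I.t₁) ∨
  (∃ f h, I.b₁ = f ++ g.reverse ++ h ∧
    WalkFromTo I.G I.s₁ f y ∧ WalkFromTo I.G y g.reverse x ∧ WalkFromTo I.G x h I.t₁)

/-- The component `C l` of the decomposition has a common node with `b₁`. -/
def Touches (D : DecompositionD1 I.G₂ I.s₂ I.t₂) (l : Fin (D.r + 1)) : Prop :=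
  ∃ x ∈ D.C l, OnWalk I.G I.s₁ I.b₁ x

/-- `C i` and `C j` are the components with a common node with `b₁` that are closest to the first
and to the last component, and `x`, `y` are nodes of `b₁` in `C i` and in `C j`. -/
def Extremal (D : DecompositionD1 I.G₂ I.s₂ I.t₂) (i j : Fin (D.r + 1)) (x y : Fin n) : Prop :=
  (∀ l, I.Touches D l → i ≤ l ∧ l ≤ j) ∧
    x ∈ D.C i ∧ OnWalk I.G I.s₁ I.b₁ x ∧ y ∈ D.C j ∧ OnWalk I.G I.s₁ I.b₁ y

/-- `p = a ++ c ++ d` with `a`, `c`, `d` the parts of the walk `p` from `s₂` to `x`, from `x` to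
`y`, and from `y` to `t₂`. -/
def SplitAt (x y : Fin n) (p a c d : List (Fin m)) : Prop :=
  p = a ++ c ++ d ∧
    WalkFromTo I.G I.s₂ a x ∧ WalkFromTo I.G x c y ∧ WalkFromTo I.G y d I.t₂

/-- `SCA I o`: some run of Algorithm SCA on the instance `I` returns `o`. The runs differ by the
choices that the algorithm leaves open (the shortest paths, the nodes of `b₁` in a component, …);
`none` means that no feasible solution has been found. -/
inductive SCA : Option (List (Fin m) × List (Fin m)) → Prop
  /-- `s₂`, `t₂` are connected in `G₂`, and no component has a common node with `b₁`. -/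
  | untouched (D : DecompositionD1 I.G₂ I.s₂ I.t₂) {p b : List (Fin m)} :
      Connected I.G₂ I.s₂ I.t₂ → (∀ l, ¬ I.Touches D l) →
      TunablePair I.G₂ I.s₂ I.t₂ p b → SCA (some (p, b))
  /-- `s₂`, `t₂` are connected in `G₂`, and the nodes `x`, `y` are in the same component. -/
  | sameComponent (D : DecompositionD1 I.G₂ I.s₂ I.t₂) {i j : Fin (D.r + 1)} {x y : Fin n}
      {p b : List (Fin m)} :
      Connected I.G₂ I.s₂ I.t₂ → I.Extremal D i j x y → i = j →
      TunablePair I.G₂ I.s₂ I.t₂ p b → SCA (some (p, b))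
  /-- `s₂`, `t₂` are connected in `G₂`, and `x`, `y` are in different components. With a fictitious
  link between `x` and `y` there are two link-disjoint paths from `u i` to `v j`: `pa`, and the one
  made of `d₁`, the fictitious link and `d₂`. They replace the parts from `u i` to `v j` of the two
  paths of a tunable pair, where the segment `g` of `b₁` stands for the fictitious link. The backup
  path is the resulting walk, freed of its cycles if it has some. -/
  | detour (D : DecompositionD1 I.G₂ I.s₂ I.t₂) {i j : Fin (D.r + 1)} {x y : Fin n}
      {p a c d b a' c' d' pa d₁ d₂ g b₂ : List (Fin m)} :
      Connected I.G₂ I.s₂ I.t₂ → I.Extremal D i j x y → i ≠ j →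
      TunablePair I.G₂ I.s₂ I.t₂ p b →
      IsPath (addFictitious I.G₂ x y) (D.u i) (pa.map some) (D.v j) →
      IsPath (addFictitious I.G₂ x y) (D.u i) (d₁.map some ++ none :: d₂.map some) (D.v j) →
      WalkFromTo I.G₂ (D.u i) d₁ x → WalkFromTo I.G₂ y d₂ (D.v j) →
      pa.Disjoint (d₁ ++ d₂) →
      I.SplitAt (D.u i) (D.v j) p a c d → I.SplitAt (D.u i) (D.v j) b a' c' d' →
      I.SegmentOfB₁ x y g →
      IsPath I.G I.s₂ b₂ I.t₂ → b₂ ⊆ a' ++ d₁ ++ g ++ d₂ ++ d' →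
      SCA (some (a ++ pa ++ d, b₂))
  /-- `s₂`, `t₂` are not connected in `G₁`. -/
  | infeasible : ¬ Connected I.G₂ I.s₂ I.t₂ → ¬ Connected I.G₁ I.s₂ I.t₂ → SCA none
  /-- The pair `(p, b)` of the fourth step is returned, because the fifth step finds no backup
  path. -/
  | tunableOnly {p b : List (Fin m)} :
      ¬ Connected I.G₂ I.s₂ I.t₂ → TunablePair I.G₁ I.s₂ I.t₂ p b →
      ¬ Connected I.G₁' I.s₂ I.t₂ → SCA (some (p, b))
  /-- The pair `(p, b)` of the fourth step is returned, because the pair `(p₂, b₂)` of the fifth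
  step is not better. -/
  | tunable {p b p₂ b₂ : List (Fin m)} :
      ¬ Connected I.G₂ I.s₂ I.t₂ → TunablePair I.G₁ I.s₂ I.t₂ p b →
      IsShortestPath I.G₁ I.prob I.s₂ p₂ I.t₂ → IsShortestPath I.G₁' I.weight' I.s₂ b₂ I.t₂ →
      ¬ I.failureProb p₂ b₂ < I.failureProb p b → SCA (some (p, b))
  /-- The pair `(p₂, b₂)` of the fifth step is better and is returned. -/
  | overlapped {p b p₂ b₂ : List (Fin m)} :
      ¬ Connected I.G₂ I.s₂ I.t₂ → TunablePair I.G₁ I.s₂ I.t₂ p b →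
      IsShortestPath I.G₁ I.prob I.s₂ p₂ I.t₂ → IsShortestPath I.G₁' I.weight' I.s₂ b₂ I.t₂ →
      I.failureProb p₂ b₂ < I.failureProb p b → SCA (some (p₂, b₂))

end Instance

/-! ### The machine model

A random access machine with structured control. It has registers and arrays for natural numbers,
which can only be copied, compared, incremented and decremented, and registers and arrays for
weights (real numbers), which can only be copied, compared and added. Every operation and every
test is one step. A program is a fixed finite object, independent of the input. -/

/-- Memory contents: registers are named by numbers; arrays are named by numbers too, and are
indexed by natural numbers. -/
structure State where
  reg : ℕ → ℕ
  arr : ℕ → ℕ → ℕ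
  wreg : ℕ → ℝ
  warr : ℕ → ℕ → ℝ

/-- The elementary operations; `x y z i` are names of registers, `a` is the name of an array. -/
inductive Instr
  | skip
  | const (x k : ℕ)
  | copy (x y : ℕ)
  | inc (x : ℕ)
  | dec (x : ℕ)
  | load (x a i : ℕ)
  | store (a i x : ℕ)
  | wzero (x : ℕ)
  | wcopy (x y : ℕ)
  | wadd (x y z : ℕ)
  | wload (x a i : ℕ)
  | wstore (a i x : ℕ)

/-- The effect of an elementary operation. -/
noncomputable def Instr.exec : Instr → State → State
  | skip, σ => σ
  | const x k, σ => { σ with reg := Function.update σ.reg x k }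
  | copy x y, σ => { σ with reg := Function.update σ.reg x (σ.reg y) }
  | inc x, σ => { σ with reg := Function.update σ.reg x (σ.reg x + 1) }
  | dec x, σ => { σ with reg := Function.update σ.reg x (σ.reg x - 1) }
  | load x a i, σ => { σ with reg := Function.update σ.reg x (σ.arr a (σ.reg i)) }
  | store a i x, σ =>
      { σ with arr := Function.update σ.arr a
                        (Function.update (σ.arr a) (σ.reg i) (σ.reg x)) }
  | wzero x, σ => { σ with wreg := Function.update σ.wreg x 0 }
  | wcopy x y, σ => { σ with wreg := Function.update σ.wreg x (σ.wreg y) }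
  | wadd x y z, σ => { σ with wreg := Function.update σ.wreg x (σ.wreg y + σ.wreg z) }
  | wload x a i, σ => { σ with wreg := Function.update σ.wreg x (σ.warr a (σ.reg i)) }
  | wstore a i x, σ =>
      { σ with warr := Function.update σ.warr a
                         (Function.update (σ.warr a) (σ.reg i) (σ.wreg x)) }

/-- The tests: comparisons of two registers. -/
inductive Test
  | eq (x y : ℕ)
  | lt (x y : ℕ)
  | wlt (x y : ℕ)

/-- The outcome of a test. -/
def Test.Holds : Test → State → Prop
  | eq x y, σ => σ.reg x = σ.reg y
  | lt x y, σ => σ.reg x < σ.reg y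
  | wlt x y, σ => σ.wreg x < σ.wreg y

/-- Programs. -/
inductive Program
  | instr (c : Instr)
  | seq (P Q : Program)
  | ite (b : Test) (P Q : Program)
  | while (b : Test) (P : Program)

/-- `Exec P σ k τ`: started in `σ`, the program `P` halts after exactly `k` steps in `τ`. -/
inductive Exec : Program → State → ℕ → State → Prop
  | instr (c : Instr) (σ : State) : Exec (.instr c) σ 1 (c.exec σ)
  | seq {P Q : Program} {σ τ υ : State} {k l : ℕ} :
      Exec P σ k τ → Exec Q τ l υ → Exec (.seq P Q) σ (k + l) υ
  | iteTrue {b : Test} {P Q : Program} {σ τ : State} {k : ℕ} :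
      b.Holds σ → Exec P σ k τ → Exec (.ite b P Q) σ (k + 1) τ
  | iteFalse {b : Test} {P Q : Program} {σ τ : State} {k : ℕ} :
      ¬ b.Holds σ → Exec Q σ k τ → Exec (.ite b P Q) σ (k + 1) τ
  | whileFalse {b : Test} {P : Program} {σ : State} :
      ¬ b.Holds σ → Exec (.while b P) σ 1 σ
  | whileTrue {b : Test} {P : Program} {σ τ υ : State} {k l : ℕ} :
      b.Holds σ → Exec P σ k τ → Exec (.while b P) τ l υ → Exec (.while b P) σ (k + l + 1) υ

/-- The array that holds the values of `f`, followed by zeros. -/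
def arrayOf {A : Type*} [Zero A] {m : ℕ} (f : Fin m → A) (i : ℕ) : A :=
  if h : i < m then f ⟨i, h⟩ else 0

/-- The input memory: registers `0, …, 7` hold `n`, `m`, `s₁`, `t₁`, `s₂`, `t₂` and the lengths of
`p₁` and `b₁`, arrays `0, …, 3` hold the two ends of the links and the links of `p₁` and of `b₁`,
weight array `0` holds the failure probabilities; everything else is zero. -/
def Instance.encode {n m : ℕ} (I : Instance n m) : State where
  reg x := [n, m, I.s₁.val, I.t₁.val, I.s₂.val, I.t₂.val, I.p₁.length, I.b₁.length].getD x 0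
  arr a := match a with
    | 0 => arrayOf fun e => (I.ends e).1.val
    | 1 => arrayOf fun e => (I.ends e).2.val
    | 2 => arrayOf fun i => (I.p₁.get i).val
    | 3 => arrayOf fun i => (I.b₁.get i).val
    | _ => fun _ => 0
  wreg _ := 0
  warr a := match a with
    | 0 => arrayOf I.prob
    | _ => fun _ => 0

/-- Register `x` holds the length of `l`, and array `a` starts with the entries of `l`. -/
def State.HoldsList {m : ℕ} (σ : State) (x a : ℕ) (l : List (Fin m)) : Prop :=
  σ.reg x = l.length ∧ ∀ i : Fin l.length, σ.arr a i = (l.get i).val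

/-- The answer `o` is read off the memory `σ`: register `0` is `0` for `none` and `1` for a pair
of paths, which are then in registers `1`, `2` (lengths) and arrays `0`, `1` (links). -/
def State.Outputs {m : ℕ} (σ : State) : Option (List (Fin m) × List (Fin m)) → Prop
  | none => σ.reg 0 = 0
  | some (p, b) => σ.reg 0 = 1 ∧ σ.HoldsList 1 0 p ∧ σ.HoldsList 2 1 b

end Survivable

namespace Survivable

/-! ### Walks -/

section Walks

variable {α β β' : Type*} {G : Graph α β} {u v w x y z : α} {e : β} {es fs : List β}
  {vs ws : List α}

/-! Optimality rests on one kind of lower bound: a set of links, each of whose failures defeats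
every feasible pair (`linkProb_le_failureProb`). A link outside `p₁` that lies on all paths from
`s₂` to `t₂` in `G₁` is of this kind. The primary path is a path in `G₁`, and when such a link fails
the first connection occupies `p₁`, so that a usable backup path would have to be a path in `G₁` as
well.

Suppose that `G₂` connects `s₂` and `t₂`. The returned pair then has the value `P_f(p ∩ b)`, and it
suffices that its common links lie on all paths in `G₁` (`solves_of_shared`). The links of `G₁` that
are missing in `G₂` belong to `b₁` and join nodes of `b₁`. Hence a bridge of `G₂` still separates in
`G₁` if one of its sides has no node of `b₁` (`bridge_mem_of_isPath_G₁`). These are the bridges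
before `C i` and from `C j` on; the bridges between are bypassed by the segment of `b₁`. The cuts
given by the bridges keep the outer and the inner parts of the two spliced paths apart, so the only
common links are bridges of the harmless kind (`solves_detour`).

Suppose that `G₂` does not connect them. Every path in `G₁` then meets `b₁`. If `b₂` meets `b₁` too,
the pair fails with every link of `p₁` and with every separating bridge of `G₁`, and a tunable pair
fails with nothing else (`TunablePair.le_of_not_disjoint`). If `b₂` avoids `b₁`, the value is a
weight of `p₂` plus a weight of `b₂`, and two shortest paths minimize the terms separately
(`shortest_le`).

For the running time, the whole computation is reduced to a bounded number of linear passes and of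
searches. A search is Dijkstra's algorithm with a scan of all arcs in each of `n` rounds, which
costs `O(n m)`. Two paths with few common links arise from a path `P` whose directed arcs get weight
`1`, all others `0`, and a shortest path `Q` for these weights. An arc along which the distance to
`t` drops is on `P` and on all walks from `s` to `t` (`Arcs.mem_of_dist_lt`), so an arc that `P` and
`Q` share separates. Cancelling the arcs used in opposite directions leaves a flow of value two,
from which two paths are extracted by further searches (`Arcs.exists_enter_union`,
`Arcs.exists_enter_remainder`).

The same distances are constant on each component `C l` and drop at every bridge (`dist_lt_iff`).
The extreme components are therefore found by comparing the distances of the nodes of `b₁`, and the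
decomposition is never computed. In the detour case the program also computes the final pair in one
go; `sca_detour` shows that it is the outcome of the prescribed replacements in a suitable tunable
pair. -/

theorem IsWalk.eq_cons (h : IsWalk G u es v vs) : ∃ ws, vs = u :: ws := by
  cases h <;> exact ⟨_, rfl⟩

theorem IsWalk.start_mem (h : IsWalk G u es v vs) : u ∈ vs := by
  obtain ⟨ws, rfl⟩ := h.eq_cons
  exact List.mem_cons_self

theorem IsWalk.end_mem (h : IsWalk G u es v vs) : v ∈ vs := by
  induction h with
  | nil => simp
  | cons _ _ ih => exact List.mem_cons_of_mem _ ih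

theorem IsWalk.start_mem_vertexSet (h : IsWalk G u es v vs) : u ∈ G.vertexSet := by
  cases h with
  | nil h => exact h
  | cons h _ => exact h.left_mem

theorem IsWalk.end_mem_vertexSet (h : IsWalk G u es v vs) : v ∈ G.vertexSet := by
  induction h with
  | nil h => exact h
  | cons _ _ ih => exact ih

theorem IsWalk.append (h : IsWalk G u es v vs) (h' : IsWalk G v fs w ws) :
    IsWalk G u (es ++ fs) w (vs ++ ws.tail) := by
  induction h with
  | nil _ =>
    obtain ⟨ws, rfl⟩ := h'.eq_cons
    exact h'
  | cons hl _ ih => exact .cons hl (ih h')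

theorem IsWalk.single (h : G.IsLink e u v) : IsWalk G u [e] v [u, v] :=
  .cons h (.nil h.right_mem)

theorem IsWalk.reverse (h : IsWalk G u es v vs) : IsWalk G v es.reverse u vs.reverse := by
  induction h with
  | nil h => exact .nil h
  | @cons u w v e es vs hl h ih =>
    obtain ⟨ws, rfl⟩ := h.eq_cons
    simpa using ih.append (IsWalk.single hl.symm)

theorem IsWalk.exists_of_append (h : IsWalk G u (es ++ fs) w vs) :
    ∃ v vs₁ vs₂, IsWalk G u es v vs₁ ∧ IsWalk G v fs w vs₂ ∧ vs = vs₁ ++ vs₂.tail := by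
  induction es generalizing u vs with
  | nil =>
    obtain ⟨ws, rfl⟩ := h.eq_cons
    exact ⟨u, [u], u :: ws, .nil h.start_mem_vertexSet, h, rfl⟩
  | cons e es ih =>
    cases h with
    | cons hl h =>
      obtain ⟨v, vs₁, vs₂, h₁, h₂, rfl⟩ := ih h
      exact ⟨v, _ :: vs₁, vs₂, .cons hl h₁, h₂, rfl⟩

theorem IsWalk.exists_of_mem (h : IsWalk G u es v vs) (hx : x ∈ vs) :
    ∃ es₁ es₂ vs₁ vs₂, es = es₁ ++ es₂ ∧ IsWalk G u es₁ x vs₁ ∧ IsWalk G x es₂ v vs₂ ∧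
      vs = vs₁ ++ vs₂.tail := by
  induction h with
  | nil h =>
    obtain rfl := List.mem_singleton.1 hx
    exact ⟨[], [], [x], [x], rfl, .nil h, .nil h, rfl⟩
  | @cons u w v e es vs hl h ih =>
    by_cases hxu : x = u
    · subst hxu
      exact ⟨[], e :: es, [x], x :: vs, rfl, .nil hl.left_mem, .cons hl h, rfl⟩
    · obtain ⟨es₁, es₂, vs₁, vs₂, rfl, h₁, h₂, rfl⟩ := ih (by simpa [hxu] using hx)
      exact ⟨e :: es₁, es₂, u :: vs₁, vs₂, rfl, .cons hl h₁, h₂, rfl⟩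

theorem IsWalk.map {G' : Graph α β'} {f : β → β'} (h : IsWalk G u es v vs)
    (hV : ∀ x ∈ G.vertexSet, x ∈ G'.vertexSet)
    (hL : ∀ e ∈ es, ∀ x y, G.IsLink e x y → G'.IsLink (f e) x y) :
    IsWalk G' u (es.map f) v vs := by
  induction h with
  | nil h => exact .nil (hV _ h)
  | cons hl _ ih =>
    exact .cons (hL _ List.mem_cons_self _ _ hl) (ih fun e he => hL e (List.mem_cons_of_mem _ he))

theorem IsWalk.mono {G' : Graph α β} (h : IsWalk G u es v vs)
    (hV : ∀ x ∈ G.vertexSet, x ∈ G'.vertexSet)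
    (hL : ∀ e ∈ es, ∀ x y, G.IsLink e x y → G'.IsLink e x y) : IsWalk G' u es v vs := by
  simpa using h.map (f := id) hV hL

theorem IsWalk.unique (h : IsWalk G u es v vs) (h' : IsWalk G u es w ws) : v = w ∧ vs = ws := by
  induction h generalizing ws with
  | nil _ => cases h'; exact ⟨rfl, rfl⟩
  | cons hl _ ih =>
    cases h' with
    | cons hl' h' =>
      obtain rfl := hl.right_unique hl'
      obtain ⟨rfl, rfl⟩ := ih h'
      exact ⟨rfl, rfl⟩

theorem IsWalk.exists_isLink (h : IsWalk G u es v vs) (he : e ∈ es) :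
    ∃ x y, G.IsLink e x y ∧ x ∈ vs ∧ y ∈ vs := by
  induction h with
  | nil => simp at he
  | cons hl h ih =>
    rcases List.mem_cons.1 he with rfl | he
    · exact ⟨_, _, hl, List.mem_cons_self, List.mem_cons_of_mem _ h.start_mem⟩
    · obtain ⟨x, y, hl, hx, hy⟩ := ih he
      exact ⟨x, y, hl, List.mem_cons_of_mem _ hx, List.mem_cons_of_mem _ hy⟩

theorem IsWalk.mem_of_isLink (h : IsWalk G u es v vs) (he : e ∈ es) (hl : G.IsLink e x y) :
    x ∈ vs ∧ y ∈ vs := by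
  obtain ⟨a, b, hl', ha, hb⟩ := h.exists_isLink he
  rcases hl.eq_and_eq_or_eq_and_eq hl' with ⟨rfl, rfl⟩ | ⟨rfl, rfl⟩
  exacts [⟨ha, hb⟩, ⟨hb, ha⟩]

theorem IsWalk.nodup_links (h : IsWalk G u es v vs) (hn : vs.Nodup) : es.Nodup := by
  induction h with
  | nil => simp
  | cons hl h ih =>
    rw [List.nodup_cons] at hn ⊢
    exact ⟨fun he => hn.1 (h.mem_of_isLink he hl).1, ih hn.2⟩

/-- Cycles are removed from the rear: if the new first node recurs on the path already found for the
rest, only the part from its recurrence on is kept. -/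
theorem IsWalk.exists_isPath (h : IsWalk G u es v vs) : ∃ fs ⊆ es, IsPath G u fs v := by
  induction h with
  | nil h => exact ⟨[], by simp, _, .nil h, by simp⟩
  | @cons u w v e es vs hl h ih =>
    obtain ⟨fs, hfs, ws, hw, hn⟩ := ih
    by_cases hu : u ∈ ws
    · obtain ⟨es₁, es₂, vs₁, vs₂, rfl, h₁, h₂, rfl⟩ := hw.exists_of_mem hu
      refine ⟨es₂, fun e he => List.mem_cons_of_mem _ (hfs (List.mem_append_right _ he)), vs₂, h₂, ?_⟩
      obtain ⟨ws, rfl⟩ := h₂.eq_cons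
      rw [List.nodup_append] at hn
      exact List.nodup_cons.2 ⟨fun h => hn.2.2 u h₁.end_mem u h rfl, hn.2.1⟩
    · exact ⟨e :: fs, List.cons_subset_cons _ hfs, u :: ws, .cons hl hw,
        List.nodup_cons.2 ⟨hu, hn⟩⟩

theorem IsPath.nodup_links (h : IsPath G u es v) : es.Nodup :=
  let ⟨_, h, hn⟩ := h; h.nodup_links hn

theorem IsPath.walkFromTo (h : IsPath G u es v) : WalkFromTo G u es v :=
  let ⟨vs, h, _⟩ := h; ⟨vs, h⟩

theorem IsPath.connected (h : IsPath G u es v) : Connected G u v := ⟨es, h.walkFromTo⟩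

theorem IsPath.eq_nil (h : IsPath G u es u) : es = [] := by
  obtain ⟨vs, h, hn⟩ := h
  cases h with
  | nil => rfl
  | cons hl h => exact absurd h.end_mem (List.nodup_cons.1 hn).1

theorem Connected.exists_isPath (h : Connected G u v) : ∃ es, IsPath G u es v :=
  let ⟨_, _, h⟩ := h; let ⟨fs, _, h⟩ := h.exists_isPath; ⟨fs, h⟩

theorem Connected.refl (h : u ∈ G.vertexSet) : Connected G u u := ⟨[], _, .nil h⟩

theorem Connected.symm (h : Connected G u v) : Connected G v u :=
  let ⟨_, _, h⟩ := h; ⟨_, _, h.reverse⟩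

theorem Connected.trans (h : Connected G u v) (h' : Connected G v w) : Connected G u w :=
  let ⟨_, _, h⟩ := h; let ⟨_, _, h'⟩ := h'; ⟨_, _, h.append h'⟩

theorem Connected.of_isLink (h : G.IsLink e u v) : Connected G u v := ⟨_, _, IsWalk.single h⟩

theorem Connected.mono {G' : Graph α β} (h : Connected G u v)
    (hV : ∀ x ∈ G.vertexSet, x ∈ G'.vertexSet)
    (hL : ∀ e x y, G.IsLink e x y → G'.IsLink e x y) : Connected G' u v :=
  let ⟨_, _, h⟩ := h; ⟨_, _, h.mono hV fun e _ => hL e⟩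

theorem Connected.left_mem (h : Connected G u v) : u ∈ G.vertexSet :=
  let ⟨_, _, h⟩ := h; h.start_mem_vertexSet

theorem Connected.deleteEdges_mono {F F' : Set β} (h : Connected (G.deleteEdges F) u v)
    (hF : F' ⊆ F) : Connected (G.deleteEdges F') u v :=
  h.mono (fun _ h => h) fun e x y hl => by
    rw [Graph.deleteEdges_isLink] at hl ⊢
    exact ⟨hl.1, fun h => hl.2 (hF h)⟩

theorem IsWalk.deleteEdges {F : Set β} (h : IsWalk G u es v vs) (hF : ∀ e ∈ es, e ∉ F) :
    IsWalk (G.deleteEdges F) u es v vs :=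
  h.mono (fun _ h => h) fun e he x y hl => by
    rw [Graph.deleteEdges_isLink]
    exact ⟨hl, hF e he⟩

theorem IsWalk.of_deleteEdges {F : Set β} (h : IsWalk (G.deleteEdges F) u es v vs) :
    IsWalk G u es v vs ∧ ∀ e ∈ es, e ∉ F := by
  refine ⟨h.mono (fun _ h => h) fun e _ x y hl => ?_, fun e he => ?_⟩
  · exact ((Graph.deleteEdges_isLink ..).mp hl).1
  · obtain ⟨x, y, hl, -⟩ := h.exists_isLink he
    exact ((Graph.deleteEdges_isLink ..).mp hl).2

theorem IsPath.deleteEdges_iff {F : Set β} :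
    IsPath (G.deleteEdges F) u es v ↔ IsPath G u es v ∧ ∀ e ∈ es, e ∉ F :=
  ⟨fun ⟨_, h, hn⟩ => ⟨⟨_, h.of_deleteEdges.1, hn⟩, h.of_deleteEdges.2⟩,
    fun ⟨⟨_, h, hn⟩, hF⟩ => ⟨_, h.deleteEdges hF, hn⟩⟩

theorem IsWalk.mem_of_not_connected (h : IsWalk G u es v vs)
    (hc : ¬ Connected (G.deleteEdges {e}) u v) : e ∈ es := by
  by_contra he
  exact hc ⟨es, vs, h.deleteEdges fun f hf hfe => he (hfe ▸ hf)⟩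

theorem SepBridge.mem (hb : SepBridge G u v e) (h : WalkFromTo G u es v) : e ∈ es :=
  let ⟨_, h⟩ := h; h.mem_of_not_connected hb.2.2

/-! ### Cuts -/

/-- No link except possibly `e` joins a node of `S` to a node outside of `S`. -/
def CutBy (G : Graph α β) (S : Set α) (e : β) : Prop :=
  ∀ f x y, G.IsLink f x y → x ∈ S → y ∉ S → f = e

/-- A link other than `e` that left this set would extend a connection from `u` beyond it. -/
theorem cutBy_connected (G : Graph α β) (u : α) (e : β) :
    CutBy G {z | Connected (G.deleteEdges {e}) u z} e := by
  intro f x y hl hx hy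
  by_contra hf
  refine hy (Connected.trans hx (Connected.of_isLink (e := f) ?_))
  rw [Graph.deleteEdges_isLink]
  exact ⟨hl, hf⟩

variable {S : Set α}

theorem CutBy.compl (h : CutBy G S e) : CutBy G Sᶜ e :=
  fun f x y hl hx hy => h f y x hl.symm (not_not.1 hy) hx

theorem IsWalk.mem_iff_of_cutBy (h : IsWalk G u es v vs) (hS : CutBy G S e) (he : e ∉ es) :
    ∀ z ∈ vs, (z ∈ S ↔ u ∈ S) := by
  induction h with
  | nil => simp
  | @cons u w v f es vs hl h ih =>
    rw [List.mem_cons, not_or] at he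
    have hw : w ∈ S ↔ u ∈ S := by
      constructor
      · intro hw; by_contra hu; exact he.1 (hS _ _ _ hl.symm hw hu).symm
      · intro hu; by_contra hw; exact he.1 (hS _ _ _ hl hu hw).symm
    intro z hz
    rcases List.mem_cons.1 hz with rfl | hz
    · exact Iff.rfl
    · rw [ih he.2 z hz, hw]

theorem IsWalk.mem_of_cutBy (h : IsWalk G u es v vs) (hS : CutBy G S e) (hu : u ∉ S)
    (hv : v ∈ S) : e ∈ es := by
  by_contra he
  exact hu ((h.mem_iff_of_cutBy hS he v h.end_mem).1 hv)

/-- Since no link is repeated, the walk crosses the cut at most once, and a single crossing through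
`e` would put its ends on different sides. -/
theorem IsWalk.notMem_of_cutBy (h : IsWalk G u es v vs) (hn : es.Nodup) (hS : CutBy G S e)
    (hl : G.IsLink e x y) (hx : x ∉ S) (hy : y ∈ S) (huv : u ∈ S ↔ v ∈ S) : e ∉ es := by
  intro he
  obtain ⟨es₁, es₂, rfl⟩ := List.append_of_mem he
  have hn₁ : e ∉ es₁ := fun h => (List.nodup_append.1 hn).2.2 e h e List.mem_cons_self rfl
  have hn₂ : e ∉ es₂ := (List.nodup_cons.1 (List.nodup_append.1 hn).2.1).1
  obtain ⟨a, vs₁, vs₂, h₁, h₂, -⟩ := h.exists_of_append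
  cases h₂ with
  | cons hl' h₂ =>
    have e₁ := h₁.mem_iff_of_cutBy hS hn₁ _ h₁.end_mem
    have e₂ := h₂.mem_iff_of_cutBy hS hn₂ _ h₂.end_mem
    rcases hl.eq_and_eq_or_eq_and_eq hl' with ⟨rfl, rfl⟩ | ⟨rfl, rfl⟩ <;> tauto

/-- A walk without repeated links crosses a cut that consists of one link exactly once. -/
theorem IsWalk.exists_crossing (h : IsWalk G u es v vs) (hn : es.Nodup) (hS : CutBy G S e)
    (hl : G.IsLink e x y) (hx : x ∉ S) (_hy : y ∈ S) (hu : u ∉ S) (hv : v ∈ S) :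
    ∃ es₁ es₂ vs₁ vs₂, es = es₁ ++ e :: es₂ ∧ vs = vs₁ ++ vs₂ ∧ IsWalk G u es₁ x vs₁ ∧
      IsWalk G y es₂ v vs₂ ∧ (∀ z ∈ vs₁, z ∉ S) ∧ ∀ z ∈ vs₂, z ∈ S := by
  obtain ⟨es₁, es₂, rfl⟩ := List.append_of_mem (h.mem_of_cutBy hS hu hv)
  have hn₁ : e ∉ es₁ := fun h => (List.nodup_append.1 hn).2.2 e h e List.mem_cons_self rfl
  have hn₂ : e ∉ es₂ := (List.nodup_cons.1 (List.nodup_append.1 hn).2.1).1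
  obtain ⟨a, vs₁, vs₂, h₁, h₂, rfl⟩ := h.exists_of_append
  cases h₂ with
  | @cons _ b _ _ _ vs₂ hl' h₂ =>
    have e₁ := h₁.mem_iff_of_cutBy hS hn₁
    have e₂ := h₂.mem_iff_of_cutBy hS hn₂
    have ha := (e₁ a h₁.end_mem).not.2 hu
    have hb := (e₂ v h₂.end_mem).1 hv
    rcases hl.eq_and_eq_or_eq_and_eq hl' with ⟨rfl, rfl⟩ | ⟨rfl, rfl⟩
    · exact ⟨es₁, es₂, vs₁, vs₂, rfl, rfl, h₁, h₂, fun z hz => (e₁ z hz).not.2 hu,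
        fun z hz => (e₂ z hz).2 hb⟩
    · exact absurd hb hx

end Walks


/-! ### The components between the separating bridge links -/

section Decomposition

variable {α β : Type*} {G : Graph α β} {s t x y z : α} {e : β} {es c d a : List β}
  {vs va vc vd vc' : List α}

theorem IsWalk.ne_of_isLink {u v : α} (h : IsWalk G u es v vs) (hn : vs.Nodup) (he : e ∈ es)
    (hl : G.IsLink e x y) : x ≠ y := by
  induction h with
  | nil => simp at he
  | @cons u w v f es vs hl' h ih =>
    rw [List.nodup_cons] at hn
    rcases List.mem_cons.1 he with rfl | he
    · rintro rfl
      rcases hl.eq_and_eq_or_eq_and_eq hl' with ⟨rfl, rfl⟩ | ⟨rfl, rfl⟩ <;> exact hn.1 h.start_mem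
    · exact ih hn.2 he

namespace DecompositionD1

variable (D : DecompositionD1 G s t)

theorem sepBridge (k : Fin D.r) : SepBridge G s t (D.bridge k) := (D.range_bridge _).1 ⟨k, rfl⟩

theorem u_mem_C (l : Fin (D.r + 1)) : D.u l ∈ D.C l := Connected.refl (D.connected l).left_mem

theorem v_mem_C (l : Fin (D.r + 1)) : D.v l ∈ D.C l := D.connected l

theorem s_mem_C : s ∈ D.C 0 := by
  have := D.u_mem_C 0
  rwa [D.u_first] at this

theorem t_mem_C : t ∈ D.C (Fin.last D.r) := by
  have := D.v_mem_C (Fin.last D.r)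
  rwa [D.v_last] at this

/-- The nodes that are still joined to the last component when bridge link `k` is removed. -/
def after (k : Fin D.r) : Set α := {z | Connected (G.deleteEdges {D.bridge k}) (D.u k.succ) z}

theorem connected_of_mem_C {k : Fin D.r} {l : Fin (D.r + 1)} (hx : x ∈ D.C l) (hy : y ∈ D.C l) :
    Connected (G.deleteEdges {D.bridge k}) x y :=
  (Connected.trans (Connected.symm hx) hy).deleteEdges_mono (by simp)

/-- One passes through `C j` from `u j` to `v j` and then over bridge `j`; the condition on the
sides says that bridge `k` is not among the bridges crossed. -/
theorem connected_u {k : Fin D.r} {l l' : Fin (D.r + 1)} (hl : l ≤ l')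
    (h : k.castSucc < l ↔ k.castSucc < l') :
    Connected (G.deleteEdges {D.bridge k}) (D.u l) (D.u l') := by
  induction l' using Fin.induction with
  | zero =>
    obtain rfl : l = 0 := Fin.le_zero_iff.1 hl
    exact D.connected_of_mem_C (D.u_mem_C _) (D.u_mem_C _)
  | succ j ih =>
    rcases hl.eq_or_lt with rfl | hl
    · exact D.connected_of_mem_C (D.u_mem_C _) (D.u_mem_C _)
    · have hj : j ≠ k := by
        rintro rfl
        have := h.2 Fin.castSucc_lt_succ
        simp only [Fin.lt_def, Fin.val_castSucc, Fin.val_succ] at this hl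
        omega
      have hjk : (j : ℕ) ≠ k := fun h => hj (Fin.ext h)
      refine (ih ?_ ?_).trans ((D.connected_of_mem_C (D.u_mem_C _) (D.v_mem_C _)).trans
        (Connected.of_isLink (e := D.bridge j) ?_))
      · simp only [Fin.lt_def, Fin.le_def, Fin.val_castSucc, Fin.val_succ] at *
        omega
      · simp only [Fin.lt_def, Fin.val_castSucc, Fin.val_succ] at *
        omega
      · rw [Graph.deleteEdges_isLink]
        exact ⟨D.isLink_bridge j, fun h => hj (D.bridge_injective h)⟩

theorem connected_of_same_side {k : Fin D.r} {l l' : Fin (D.r + 1)} (hx : x ∈ D.C l)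
    (hy : y ∈ D.C l') (h : k.castSucc < l ↔ k.castSucc < l') :
    Connected (G.deleteEdges {D.bridge k}) x y := by
  refine (D.connected_of_mem_C hx (D.u_mem_C l)).trans
    (.trans ?_ (D.connected_of_mem_C (D.u_mem_C l') hy))
  rcases le_total l l' with hl | hl
  · exact D.connected_u hl h
  · exact (D.connected_u hl h.symm).symm

/-- If a node of a component up to `C k` could reach `u (k + 1)` without bridge `k`, then `s` could
reach `t` without it. All later facts about the order of the components come from these cuts; the
structure itself does not even say that the components are disjoint. -/
theorem mem_after_iff {k : Fin D.r} {l : Fin (D.r + 1)} (hx : x ∈ D.C l) :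
    x ∈ D.after k ↔ k.castSucc < l := by
  constructor
  · intro h
    by_contra hl
    refine (D.sepBridge k).2.2 ?_
    refine (D.connected_of_same_side D.s_mem_C hx (by simp [hl])).trans
      ((Connected.symm h).trans ?_)
    exact D.connected_of_same_side (D.u_mem_C _) D.t_mem_C (by simp [Fin.castSucc_lt_last])
  · intro h
    exact D.connected_of_same_side (D.u_mem_C _) hx (by simp [h])

theorem cutBy_after (k : Fin D.r) : CutBy G (D.after k) (D.bridge k) :=
  cutBy_connected _ _ _

/-- Along a walk from `s`, a link that is no separating bridge stays in its component, and a
separating bridge leads from some `v k` to `u (k + 1)` or back. -/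
theorem exists_mem_C (h : Connected G s z) : ∃ l, z ∈ D.C l := by
  obtain ⟨es, vs, h⟩ := h
  suffices ∀ u, IsWalk G u es z vs → (∃ l, u ∈ D.C l) → ∃ l, z ∈ D.C l from
    this s h ⟨0, D.s_mem_C⟩
  clear h
  intro u h
  induction h with
  | nil => exact id
  | @cons u w v e es vs hl _ ih =>
    rintro ⟨l, hu⟩
    apply ih
    by_cases he : e ∈ Set.range D.bridge
    · obtain ⟨k, rfl⟩ := he
      rcases hl.eq_and_eq_or_eq_and_eq (D.isLink_bridge k) with ⟨rfl, rfl⟩ | ⟨rfl, rfl⟩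
      · exact ⟨_, D.u_mem_C _⟩
      · exact ⟨_, D.v_mem_C _⟩
    · refine ⟨l, Connected.trans hu (Connected.of_isLink (e := e) ?_)⟩
      rw [Graph.deleteEdges_isLink]
      exact ⟨hl, he⟩

theorem connected_s {l : Fin (D.r + 1)} (hz : z ∈ D.C l) (h : Connected G s t) :
    Connected G s z := by
  rcases Fin.eq_zero_or_eq_succ l with rfl | ⟨k, rfl⟩
  · have : Connected G (D.u 0) z :=
      hz.mono (fun _ h => h) fun e x y h => ((Graph.deleteEdges_isLink ..).mp h).1
    rwa [D.u_first] at this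
  · refine h.trans (Connected.mono (D.connected_of_same_side (k := k) D.t_mem_C hz ?_)
      (fun _ h => h) fun e x y h => ((Graph.deleteEdges_isLink ..).mp h).1)
    simp [Fin.castSucc_lt_last]

/-- A walk without repeated links, whose ends are on the same side of a bridge link, does not
use this link. -/
theorem bridge_notMem {k : Fin D.r} {l l' : Fin (D.r + 1)} (h : IsWalk G x es y vs)
    (hn : es.Nodup) (hx : x ∈ D.C l) (hy : y ∈ D.C l')
    (hl : k.castSucc < l ↔ k.castSucc < l') : D.bridge k ∉ es := by
  refine h.notMem_of_cutBy hn (D.cutBy_after k) (D.isLink_bridge k) ?_ ?_ ?_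
  · rw [D.mem_after_iff (D.v_mem_C _)]; simp
  · rw [D.mem_after_iff (D.u_mem_C _)]; exact Fin.castSucc_lt_succ
  · rw [D.mem_after_iff hx, D.mem_after_iff hy, hl]

theorem mem_after_of_walk {k : Fin D.r} {l l' : Fin (D.r + 1)} (h : IsWalk G x es y vs)
    (hn : es.Nodup) (hx : x ∈ D.C l) (hy : y ∈ D.C l')
    (hl : k.castSucc < l ↔ k.castSucc < l') (hz : z ∈ vs) :
    z ∈ D.after k ↔ k.castSucc < l := by
  rw [h.mem_iff_of_cutBy (D.cutBy_after k) (D.bridge_notMem h hn hx hy hl) z hz,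
    D.mem_after_iff hx]

variable {D} {i j l : Fin (D.r + 1)}

/-- A simple path from `s` to `u i` reaches `C i` only at its end. -/
theorem eq_or_notMem_after_of_prefix (ha : IsWalk G s a (D.u i) va) (hn : va.Nodup)
    (hz : z ∈ va) : z = D.u i ∨ ∃ k : Fin D.r, i = k.succ ∧ z ∉ D.after k := by
  rcases Fin.eq_zero_or_eq_succ i with rfl | ⟨k, rfl⟩
  · rw [D.u_first] at ha ⊢
    obtain rfl := IsPath.eq_nil ⟨_, ha, hn⟩
    cases ha
    exact Or.inl (List.mem_singleton.1 hz)
  · obtain ⟨es₁, es₂, vs₁, vs₂, -, rfl, h₁, h₂, hv₁, hv₂⟩ :=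
      ha.exists_crossing (ha.nodup_links hn) (D.cutBy_after k) (D.isLink_bridge k)
        (by rw [D.mem_after_iff (D.v_mem_C _)]; simp)
        (by rw [D.mem_after_iff (D.u_mem_C _)]; exact Fin.castSucc_lt_succ)
        (by rw [D.mem_after_iff D.s_mem_C]; simp)
        (by rw [D.mem_after_iff (D.u_mem_C _)]; exact Fin.castSucc_lt_succ)
    obtain rfl := IsPath.eq_nil ⟨_, h₂, (List.nodup_append.1 hn).2.1⟩
    cases h₂
    rcases List.mem_append.1 hz with hz | hz
    · exact Or.inr ⟨k, rfl, hv₁ z hz⟩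
    · exact Or.inl (List.mem_singleton.1 hz)

/-- A simple path from `v j` to `t` leaves `C j` immediately. -/
theorem eq_or_mem_after_of_suffix (hd : IsWalk G (D.v j) d t vd) (hn : vd.Nodup)
    (hz : z ∈ vd) : z = D.v j ∨ ∃ k : Fin D.r, j = k.castSucc ∧ z ∈ D.after k := by
  rcases Fin.eq_castSucc_or_eq_last j with ⟨k, rfl⟩ | rfl
  · obtain ⟨es₁, es₂, vs₁, vs₂, -, rfl, h₁, h₂, hv₁, hv₂⟩ :=
      hd.exists_crossing (hd.nodup_links hn) (D.cutBy_after k) (D.isLink_bridge k)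
        (by rw [D.mem_after_iff (D.v_mem_C _)]; simp)
        (by rw [D.mem_after_iff (D.u_mem_C _)]; exact Fin.castSucc_lt_succ)
        (by rw [D.mem_after_iff (D.v_mem_C _)]; simp)
        (by rw [D.mem_after_iff D.t_mem_C]; exact Fin.castSucc_lt_last k)
    obtain rfl := IsPath.eq_nil ⟨_, h₁, (List.nodup_append.1 hn).1⟩
    cases h₁
    rcases List.mem_append.1 hz with hz | hz
    · exact Or.inl (List.mem_singleton.1 hz)
    · exact Or.inr ⟨k, rfl, hv₂ z hz⟩
  · rw [D.v_last] at hd ⊢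
    obtain rfl := IsPath.eq_nil ⟨_, hd, hn⟩
    cases hd
    exact Or.inl (List.mem_singleton.1 hz)

/-- Apart from its last node, the prefix lies before the bridge into `C i`, whereas a walk without
repeated links from `u i` to `C i` or a later component never passes back over this bridge. -/
theorem eq_u_of_mem_prefix (ha : IsWalk G s a (D.u i) va) (hn : va.Nodup)
    (hc : IsWalk G (D.u i) c y vc) (hcn : c.Nodup) (hy : y ∈ D.C l) (hil : i ≤ l)
    (hz : z ∈ va) (hz' : z ∈ vc) : z = D.u i := by
  rcases eq_or_notMem_after_of_prefix ha hn hz with h | ⟨k, rfl, h⟩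
  · exact h
  · have hl := Fin.castSucc_lt_succ (i := k)
    exact absurd ((D.mem_after_of_walk hc hcn (D.u_mem_C _) hy
      (by simp [hl, hl.trans_le hil]) hz').2 hl) h

theorem eq_v_of_mem_suffix (hd : IsWalk G (D.v j) d t vd) (hn : vd.Nodup)
    (hc : IsWalk G x c (D.v j) vc) (hcn : c.Nodup) (hx : x ∈ D.C l) (hlj : l ≤ j)
    (hz : z ∈ vd) (hz' : z ∈ vc) : z = D.v j := by
  rcases eq_or_mem_after_of_suffix hd hn hz with h | ⟨k, rfl, h⟩
  · exact h
  · refine absurd ((D.mem_after_of_walk hc hcn hx (D.v_mem_C _) ?_ hz').1 h) (not_lt.2 hlj)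
    simp [not_lt.2 hlj]

/-- By `eq_u_of_mem_prefix` both ends of a common link would be `u i`, but a simple path contains no
loop. -/
theorem prefix_disjoint (ha : IsWalk G s a (D.u i) va) (hn : va.Nodup)
    (hc : IsWalk G (D.u i) c y vc) (hcn : c.Nodup) (hy : y ∈ D.C l) (hil : i ≤ l) :
    a.Disjoint c := by
  intro e hea hec
  obtain ⟨p, q, hl, hp, hq⟩ := ha.exists_isLink hea
  obtain ⟨hp', hq'⟩ := hc.mem_of_isLink hec hl
  exact ha.ne_of_isLink hn hea hl ((eq_u_of_mem_prefix ha hn hc hcn hy hil hp hp').trans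
    (eq_u_of_mem_prefix ha hn hc hcn hy hil hq hq').symm)

theorem suffix_disjoint (hd : IsWalk G (D.v j) d t vd) (hn : vd.Nodup)
    (hc : IsWalk G x c (D.v j) vc) (hcn : c.Nodup) (hx : x ∈ D.C l) (hlj : l ≤ j) :
    d.Disjoint c := by
  intro e hed hec
  obtain ⟨p, q, hl, hp, hq⟩ := hd.exists_isLink hed
  obtain ⟨hp', hq'⟩ := hc.mem_of_isLink hec hl
  exact hd.ne_of_isLink hn hed hl ((eq_v_of_mem_suffix hd hn hc hcn hx hlj hp hp').trans
    (eq_v_of_mem_suffix hd hn hc hcn hx hlj hq hq').symm)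

theorem lt_of_mem_prefix {k : Fin D.r} (ha : IsWalk G s a (D.u i) va) (hn : a.Nodup)
    (hk : D.bridge k ∈ a) : k.castSucc < i := by
  by_contra h
  exact D.bridge_notMem ha hn D.s_mem_C (D.u_mem_C i) (by simp [h]) hk

theorem le_of_mem_suffix {k : Fin D.r} (hd : IsWalk G (D.v j) d t vd) (hn : d.Nodup)
    (hk : D.bridge k ∈ d) : j ≤ k.castSucc := by
  by_contra h
  exact D.bridge_notMem hd hn (D.v_mem_C j) D.t_mem_C
    (by simp [not_le.1 h, Fin.castSucc_lt_last]) hk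

/-- The part from `u i` to `v j` of a simple path from `s` to `t` may be replaced by any simple
path with these ends. -/
theorem isPath_splice (hij : i ≤ j) (ha : IsWalk G s a (D.u i) va) (hna : va.Nodup)
    (hd : IsWalk G (D.v j) d t vd) (hnd : vd.Nodup) (hdis : va.Disjoint vd.tail)
    (hc : IsWalk G (D.u i) c (D.v j) vc) (hnc : vc.Nodup) : IsPath G s (a ++ c ++ d) t := by
  refine ⟨_, (ha.append hc).append hd, ?_⟩
  have hcl := hc.nodup_links hnc
  have h₁ : ∀ z ∈ va, z ∈ vc → z = D.u i := fun z =>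
    eq_u_of_mem_prefix ha hna hc hcl (D.v_mem_C j) hij
  have h₂ : ∀ z ∈ vd, z ∈ vc → z = D.v j := fun z =>
    eq_v_of_mem_suffix hd hnd hc hcl (D.u_mem_C i) hij
  obtain ⟨wc, rfl⟩ := hc.eq_cons
  obtain ⟨wd, rfl⟩ := hd.eq_cons
  rw [List.nodup_cons] at hnc hnd
  simp only [List.tail_cons, List.nodup_append, List.mem_append] at hdis ⊢
  refine ⟨⟨hna, hnc.2, ?_⟩, hnd.2, ?_⟩
  · rintro x hx y hy rfl
    exact hnc.1 (h₁ x hx (List.mem_cons_of_mem _ hy) ▸ hy)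
  · rintro x (hx | hx) y hy rfl
    · exact hdis hx hy
    · exact hnd.1 (h₂ x (List.mem_cons_of_mem _ hy) (List.mem_cons_of_mem _ hx) ▸ hy)

end DecompositionD1

end Decomposition


namespace Instance

variable {n m : ℕ} {I : Instance n m} {p b q : List (Fin m)}

/-! ### Optimality -/

theorem isPath_G₁_iff : IsPath I.G₁ I.s₂ p I.t₂ ↔ IsPath I.G I.s₂ p I.t₂ ∧ I.p₁.Disjoint p := by
  rw [G₁, IsPath.deleteEdges_iff, and_congr_right_iff]
  exact fun _ => ⟨fun h e h₁ h₂ => h e h₂ h₁, fun h e h₁ h₂ => h h₂ h₁⟩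

theorem isPath_G₁'_iff :
    IsPath I.G₁' I.s₂ p I.t₂ ↔ IsPath I.G I.s₂ p I.t₂ ∧ I.b₁.Disjoint p := by
  rw [G₁', IsPath.deleteEdges_iff, and_congr_right_iff]
  exact fun _ => ⟨fun h e h₁ h₂ => h e h₂ h₁, fun h e h₁ h₂ => h h₂ h₁⟩

theorem isPath_G₂_iff : IsPath I.G₂ I.s₂ p I.t₂ ↔
    IsPath I.G I.s₂ p I.t₂ ∧ I.p₁.Disjoint p ∧ I.b₁.Disjoint p := by
  rw [G₂, IsPath.deleteEdges_iff, and_congr_right_iff]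
  exact fun _ => ⟨fun h => ⟨fun e h₁ h₂ => h e h₂ (Or.inl h₁), fun e h₁ h₂ => h e h₂ (Or.inr h₁)⟩,
    fun h e h₁ h₂ => h₂.elim (fun h₂ => h.1 h₂ h₁) fun h₂ => h.2 h₂ h₁⟩

theorem Feasible.isPath_G₁ (h : I.Feasible p b) : IsPath I.G₁ I.s₂ p I.t₂ :=
  isPath_G₁_iff.2 ⟨h.1, h.2.2⟩

/-- The source of all lower bounds: the links of `Z` contribute their full probability, and the
other links contribute nonnegative amounts. -/
theorem linkProb_le_failureProb {Z : Finset (Fin m)}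
    (h : ∀ e ∈ Z, ¬ I.Usable e p ∧ ¬ I.Usable e b) : I.linkProb Z ≤ I.failureProb p b := by
  classical
  unfold linkProb failureProb
  rw [← Finset.sum_filter_add_sum_filter_not Finset.univ (· ∈ Z)]
  have h₁ : ∑ e ∈ Z, I.prob e = ∑ e ∈ Finset.univ.filter (· ∈ Z),
      if I.Usable e p ∨ I.Usable e b then 0 else I.prob e := by
    rw [Finset.filter_mem_eq_inter, Finset.univ_inter]
    refine Finset.sum_congr rfl fun e he => ?_
    rw [if_neg (not_or.2 (h e he))]
  rw [h₁]
  refine le_add_of_nonneg_right (Finset.sum_nonneg fun e _ => ?_)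
  split_ifs
  exacts [le_rfl, I.prob_nonneg e]

/-- A link on every path for the second connection that avoids `p₁` makes any solution fail. -/
theorem Feasible.not_usable {e : Fin m} (h : I.Feasible p b) (he : e ∉ I.p₁)
    (hq : ∀ q, IsPath I.G₁ I.s₂ q I.t₂ → e ∈ q) : ¬ I.Usable e p ∧ ¬ I.Usable e b := by
  refine ⟨fun hu => hu.1 (hq p h.isPath_G₁), fun hu => hu.1 (hq b (isPath_G₁_iff.2 ⟨h.2.1, ?_⟩))⟩
  have := hu.2
  rw [occupied, if_neg he] at this
  exact this.symm

/-- In the shared case the value is the probability of the common links. Each of them is outside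
`p₁`, because `p` is, and lies on all paths in `G₁`, so its failure defeats every competitor. -/
theorem solves_of_shared (hp : IsPath I.G₂ I.s₂ p I.t₂) (hb : IsPath I.G I.s₂ b I.t₂)
    (hd : I.p₁.Disjoint b) (h : ∀ e ∈ p, e ∈ b → ∀ q, IsPath I.G₁ I.s₂ q I.t₂ → e ∈ q) :
    I.Solves (some (p, b)) := by
  obtain ⟨hp, hp₁, hb₁⟩ := isPath_G₂_iff.1 hp
  have hv := ThreeCaseValue.shared (I := I) (p₂ := p) (b₂ := b) ⟨hb₁, hd⟩
  refine ⟨⟨hp, hb, hp₁⟩, _, hv, hv.eq_failureProb hp₁, fun p' b' hf => ?_⟩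
  refine linkProb_le_failureProb fun e he => ?_
  simp only [Finset.mem_inter, List.mem_toFinset] at he
  exact hf.not_usable (fun h => hp₁ h he.1) (h e he.1 he.2)

theorem onWalk_b₁_of_isLink {e : Fin m} {x y : Fin n} (he : e ∈ I.b₁) (hl : I.G.IsLink e x y) :
    OnWalk I.G I.s₁ I.b₁ x := by
  obtain ⟨vs, h, -⟩ := I.isPath_b₁
  exact ⟨_, vs, h, (h.mem_of_isLink he hl).1⟩

/-- Restoring `b₁` can join the two sides of a bridge of `G₂` only if both sides contain nodes of
`b₁`. The hypothesis `hk` leaves one side without such nodes. -/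
theorem bridge_mem_of_isPath_G₁ (hc : Connected I.G₂ I.s₂ I.t₂)
    (D : DecompositionD1 I.G₂ I.s₂ I.t₂) (k : Fin D.r)
    (hk : (∀ l, I.Touches D l → l ≤ k.castSucc) ∨ ∀ l, I.Touches D l → k.castSucc < l)
    (hq : IsPath I.G₁ I.s₂ q I.t₂) : D.bridge k ∈ q := by
  obtain ⟨vs, hq, -⟩ := hq
  -- A link of `G₁` that is not in `G₂` belongs to `b₁`, so both its ends are on `b₁` and it cannot
  -- leave a set that is free of nodes of `b₁`.
  have main : ∀ S : Set (Fin n), CutBy I.G₂ S (D.bridge k) →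
      (∀ x ∈ S, ¬ OnWalk I.G I.s₁ I.b₁ x) → CutBy I.G₁ S (D.bridge k) := by
    intro S hS hx e x y hl hxS hyS
    obtain ⟨hl, he⟩ := (Graph.deleteEdges_isLink ..).mp hl
    refine hS e x y ?_ hxS hyS
    rw [G₂, Graph.deleteEdges_isLink]
    exact ⟨hl, fun h => h.elim he fun h => hx x hxS (onWalk_b₁_of_isLink h hl)⟩
  rcases hk with hk | hk
  · refine hq.mem_of_cutBy (main (D.after k) (D.cutBy_after k) fun x hx hw => ?_) ?_ ?_
    · have hsx : Connected I.G₂ I.s₂ x :=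
        (D.connected_s (D.u_mem_C k.succ) hc).trans (Connected.mono hx (fun _ h => h)
          fun e x y h => ((Graph.deleteEdges_isLink ..).mp h).1)
      obtain ⟨l, hl⟩ := D.exists_mem_C hsx
      exact absurd ((D.mem_after_iff hl).1 hx) (not_lt.2 (hk l ⟨x, hl, hw⟩))
    · rw [D.mem_after_iff D.s_mem_C]; simp
    · rw [D.mem_after_iff D.t_mem_C]; exact Fin.castSucc_lt_last k
  -- Now the side of `s₂` is free of nodes of `b₁`; the complement is taken because the path has to
  -- end inside the set.
  · refine hq.mem_of_cutBy (S := {z | Connected (I.G₂.deleteEdges {D.bridge k}) I.s₂ z}ᶜ)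
      (CutBy.compl (main _ (cutBy_connected _ _ _) fun x hx hw => ?_)) ?_ ?_
    · have hsx : Connected I.G₂ I.s₂ x :=
        Connected.mono hx (fun _ h => h) fun e x y h => ((Graph.deleteEdges_isLink ..).mp h).1
      obtain ⟨l, hl⟩ := D.exists_mem_C hsx
      have := (D.mem_after_iff hl).2 (hk l ⟨x, hl, hw⟩)
      have := (D.mem_after_iff D.s_mem_C).1 (Connected.trans this (Connected.symm hx))
      simp at this
    · exact not_not.2 (Connected.refl (Set.mem_univ _))
    · exact (D.sepBridge k).2.2

/-- No bridge has components with nodes of `b₁` on both of its sides. This covers the case that `b₁`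
touches nothing and the case `i = j`. -/
theorem TunablePair.solves_G₂ (hc : Connected I.G₂ I.s₂ I.t₂)
    (D : DecompositionD1 I.G₂ I.s₂ I.t₂)
    (hk : ∀ k : Fin D.r,
      (∀ l, I.Touches D l → l ≤ k.castSucc) ∨ ∀ l, I.Touches D l → k.castSucc < l)
    (h : TunablePair I.G₂ I.s₂ I.t₂ p b) : I.Solves (some (p, b)) := by
  obtain ⟨hp, hb, h⟩ := h
  obtain ⟨hb₀, hb₁, -⟩ := isPath_G₂_iff.1 hb
  refine solves_of_shared hp hb₀ hb₁ fun e hep heb q hq => ?_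
  obtain ⟨k, rfl⟩ := (D.range_bridge e).2 ((h e).1 ⟨hep, heb⟩)
  exact bridge_mem_of_isPath_G₁ hc D k (hk k) hq

theorem Extremal.touches {D : DecompositionD1 I.G₂ I.s₂ I.t₂} {i j : Fin (D.r + 1)} {x y : Fin n}
    (h : I.Extremal D i j x y) : I.Touches D i ∧ I.Touches D j :=
  ⟨⟨x, h.2.1, h.2.2.1⟩, y, h.2.2.2⟩

theorem Extremal.bridge_mem (hc : Connected I.G₂ I.s₂ I.t₂)
    {D : DecompositionD1 I.G₂ I.s₂ I.t₂} {i j : Fin (D.r + 1)} {x y : Fin n}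
    (h : I.Extremal D i j x y) {k : Fin D.r} (hk : k.castSucc < i ∨ j ≤ k.castSucc)
    (hq : IsPath I.G₁ I.s₂ q I.t₂) : D.bridge k ∈ q :=
  bridge_mem_of_isPath_G₁ hc D k (hk.symm.imp (fun hk l hl => (h.1 l hl).2.trans hk)
    fun hk l hl => hk.trans_le (h.1 l hl).1) hq

/-- The parts into which a path in a subgraph is split are walks in this subgraph. -/
theorem SplitAt.isWalk {H : Graph (Fin n) (Fin m)} {F : Set (Fin m)} (hH : H = I.G.deleteEdges F)
    {x y : Fin n} {a c d : List (Fin m)} (h : I.SplitAt x y p a c d)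
    (hp : IsPath H I.s₂ p I.t₂) : ∃ va vc vd, IsWalk H I.s₂ a x va ∧ IsWalk H x c y vc ∧
      IsWalk H y d I.t₂ vd ∧ (va ++ vc.tail ++ vd.tail).Nodup := by
  subst hH
  obtain ⟨rfl, ⟨va, ha⟩, ⟨vc, hc⟩, vd, hd⟩ := h
  obtain ⟨vs, hp, hn⟩ := hp
  obtain ⟨hp, hF⟩ := hp.of_deleteEdges
  obtain ⟨-, rfl⟩ := hp.unique ((ha.append hc).append hd)
  simp only [List.mem_append] at hF
  exact ⟨va, vc, vd, ha.deleteEdges fun e he => hF e (by simp [he]),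
    hc.deleteEdges fun e he => hF e (by simp [he]),
    hd.deleteEdges fun e he => hF e (by simp [he]), hn⟩

theorem _root_.Survivable.IsWalk.nodup_of_append {α β : Type*} {G : Graph α β}
    {x y z w : α} {a c d : List β} {va vc vd : List α} (ha : IsWalk G x a y va)
    (hc : IsWalk G y c z vc) (hd : IsWalk G z d w vd) (hn : (va ++ vc.tail ++ vd.tail).Nodup) :
    va.Nodup ∧ vc.Nodup ∧ vd.Nodup ∧ va.Disjoint vd.tail := by
  obtain ⟨wc, rfl⟩ := hc.eq_cons
  obtain ⟨wd, rfl⟩ := hd.eq_cons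
  have hy := ha.end_mem
  have hz := hc.end_mem
  simp only [List.tail_cons, List.nodup_append, List.nodup_cons, List.mem_append,
    List.mem_cons] at *
  refine ⟨hn.1.1, ⟨fun h => hn.1.2.2 y hy y h rfl, hn.1.2.1⟩, ⟨fun h => ?_, hn.2.1⟩,
    fun v h₁ h₂ => hn.2.2 v (Or.inl h₁) v h₂ rfl⟩
  rcases hz with rfl | hz
  · exact hn.2.2 z (Or.inl hy) z h rfl
  · exact hn.2.2 z (Or.inr hz) z h rfl

/-- The extension also adds `x` and `y` to the node set, and for the empty walk this is the only
possible difference; hence `hx` and `hy`. -/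
theorem isWalk_of_addFictitious {α β : Type*} {G : Graph α β} {x y u v : α} {c : List β}
    {vs : List α} (hx : x ∈ G.vertexSet) (hy : y ∈ G.vertexSet)
    (h : IsWalk (addFictitious G x y) u (c.map some) v vs) : IsWalk G u c v vs := by
  induction c generalizing u vs with
  | nil =>
    cases h with
    | nil h => rcases h with h | rfl | rfl <;> exact .nil (by assumption)
  | cons e c ih =>
    cases h with
    | cons hl h => exact .cons hl (ih h)

/-- The primary path consists of `a`, `pa`, `d`, and the links of the backup path come from `a'`,
`d₁`, `g`, `d₂`, `d'`; removing cycles only loses links. The segment `g` is part of `b₁`, which the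
primary path avoids. The inner parts `pa` and `d₁`, `d₂` are disjoint by choice. An outer part
shares no link with an inner part, since the cuts allow them to meet only at `u i` or `v j`. What
remains are common links of outer parts, and these are bridges that separate in `G₁` as well. -/
theorem solves_detour (hc : Connected I.G₂ I.s₂ I.t₂) {D : DecompositionD1 I.G₂ I.s₂ I.t₂}
    {i j : Fin (D.r + 1)} {x y : Fin n} {p a c d b a' c' d' pa d₁ d₂ g b₂ : List (Fin m)}
    (hE : I.Extremal D i j x y) (hT : TunablePair I.G₂ I.s₂ I.t₂ p b)
    (hpa : IsPath (addFictitious I.G₂ x y) (D.u i) (pa.map some) (D.v j))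
    (hpb : IsPath (addFictitious I.G₂ x y) (D.u i) (d₁.map some ++ none :: d₂.map some) (D.v j))
    (hd₁ : WalkFromTo I.G₂ (D.u i) d₁ x) (hd₂ : WalkFromTo I.G₂ y d₂ (D.v j))
    (hdis : pa.Disjoint (d₁ ++ d₂)) (hsp : I.SplitAt (D.u i) (D.v j) p a c d)
    (hsb : I.SplitAt (D.u i) (D.v j) b a' c' d') (hg : I.SegmentOfB₁ x y g)
    (hb₂ : IsPath I.G I.s₂ b₂ I.t₂) (hsub : b₂ ⊆ a' ++ d₁ ++ g ++ d₂ ++ d') :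
    I.Solves (some (a ++ pa ++ d, b₂)) := by
  obtain ⟨hp, hb, hcom⟩ := hT
  have hij : i ≤ j := (hE.1 j hE.touches.2).1
  obtain ⟨va, vc, vd, ha, hcw, hd, hn⟩ := hsp.isWalk rfl hp
  obtain ⟨va', vc', vd', ha', hcw', hd', hn'⟩ := hsb.isWalk rfl hb
  obtain ⟨hna, -, hnd, had⟩ := ha.nodup_of_append hcw hd hn
  obtain ⟨hna', -, hnd', -⟩ := ha'.nodup_of_append hcw' hd' hn'
  obtain ⟨vpa, hpa, hnpa⟩ := hpa
  replace hpa := isWalk_of_addFictitious (Set.mem_univ x) (Set.mem_univ y) hpa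
  obtain ⟨v₁, hd₁⟩ := hd₁
  obtain ⟨v₂, hd₂⟩ := hd₂
  have hnpb := hpb.nodup_links
  rw [List.nodup_append, List.nodup_cons] at hnpb
  have hn₁ : d₁.Nodup := hnpb.1.of_map _
  have hn₂ : d₂.Nodup := hnpb.2.1.2.of_map _
  have hpp := DecompositionD1.isPath_splice hij ha hna hd hnd had hpa hnpa
  have hg₁ : g ⊆ I.b₁ := by
    rcases hg with ⟨f, h, hfg, -⟩ | ⟨f, h, hfg, -⟩ <;> intro e he <;> simp [hfg, he]
  obtain ⟨-, hpp₁, hpb₁⟩ := isPath_G₂_iff.1 hpp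
  obtain ⟨-, hb₁, -⟩ := isPath_G₂_iff.1 hb
  have hab : ∀ e, e ∈ a' ∨ e ∈ d' → e ∈ b := by
    intro e he
    rw [hsb.1]
    simp only [List.mem_append]
    tauto
  have hap : ∀ e, e ∈ a ∨ e ∈ d → e ∈ p := by
    intro e he
    rw [hsp.1]
    simp only [List.mem_append]
    tauto
  have hda := hpa.nodup_links hnpa
  have haa := ha.nodup_links hna
  have hdd := hd.nodup_links hnd
  -- Such a link is common to both paths of the tunable pair, hence a bridge. Its position in the
  -- prefix `a` or the suffix `d` of the primary path puts it before `C i` or from `C j` on.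
  have sep : ∀ e, (e ∈ a ∨ e ∈ d) → (e ∈ a' ∨ e ∈ d') →
      ∀ q, IsPath I.G₁ I.s₂ q I.t₂ → e ∈ q := by
    intro e h₁ h₂ q hq
    obtain ⟨k, rfl⟩ := (D.range_bridge e).2 ((hcom e).1 ⟨hap e h₁, hab e h₂⟩)
    exact hE.bridge_mem hc (h₁.imp (DecompositionD1.lt_of_mem_prefix ha haa)
      (DecompositionD1.le_of_mem_suffix hd hdd)) hq
  refine solves_of_shared hpp hb₂ ?_ fun e he heb => ?_
  · intro e he heb
    have := hsub heb
    simp only [List.mem_append] at this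
    rcases this with (((h | h) | h) | h) | h
    · exact hb₁ he (hab e (Or.inl h))
    · exact (hd₁.of_deleteEdges.2 e h) (Or.inl he)
    · exact I.disjoint₁ he (hg₁ h)
    · exact (hd₂.of_deleteEdges.2 e h) (Or.inl he)
    · exact hb₁ he (hab e (Or.inr h))
  · have h₂ := hsub heb
    simp only [List.mem_append] at h₂
    have h₃ := he
    simp only [List.mem_append] at h₃
    have hxC := hE.2.1
    have hyC := hE.2.2.2.1
    rcases h₂ with (((h₂ | h₂) | h₂) | h₂) | h₂
    · rcases h₃ with (h₃ | h₃) | h₃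
      · exact sep e (Or.inl h₃) (Or.inl h₂)
      · exact absurd h₃ (DecompositionD1.prefix_disjoint ha' hna' hpa hda (D.v_mem_C j) hij h₂)
      · exact sep e (Or.inr h₃) (Or.inl h₂)
    · exfalso
      rcases h₃ with (h₃ | h₃) | h₃
      · exact DecompositionD1.prefix_disjoint ha hna hd₁ hn₁ hxC le_rfl h₃ h₂
      · exact hdis h₃ (List.mem_append_left _ h₂)
      · -- the walk `d₁` stays before the components that `d` visits
        obtain ⟨p', q', hl, hp', hq'⟩ := hd.exists_isLink h₃
        obtain ⟨hp₁, hq₁⟩ := hd₁.mem_of_isLink h₂ hl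
        have key : ∀ z ∈ vd, z ∈ v₁ → z = D.v j := by
          intro z hz hz'
          rcases DecompositionD1.eq_or_mem_after_of_suffix hd hnd hz with h | ⟨k, rfl, h⟩
          · exact h
          · exact absurd ((D.mem_after_of_walk hd₁ hn₁ (D.u_mem_C i) hxC Iff.rfl hz').1 h)
              (not_lt.2 hij)
        exact hd.ne_of_isLink hnd h₃ hl ((key _ hp' hp₁).trans (key _ hq' hq₁).symm)
    · exact absurd he (hpb₁ (hg₁ h₂))
    · exfalso
      rcases h₃ with (h₃ | h₃) | h₃
      -- The mirror image: `d₂` starts and ends in `C j` and so stays behind the bridge into `C i`,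
      -- which the prefix `a` crosses only to reach its last node `u i`.
      · obtain ⟨p', q', hl, hp', hq'⟩ := ha.exists_isLink h₃
        obtain ⟨hp₂, hq₂⟩ := hd₂.mem_of_isLink h₂ hl
        have key : ∀ z ∈ va, z ∈ v₂ → z = D.u i := by
          intro z hz hz'
          rcases DecompositionD1.eq_or_notMem_after_of_prefix ha hna hz with h | ⟨k, rfl, h⟩
          · exact h
          · exact absurd ((D.mem_after_of_walk hd₂ hn₂ hyC (D.v_mem_C j) Iff.rfl hz').2
              (Fin.castSucc_lt_succ.trans_le hij)) h
        exact ha.ne_of_isLink hna h₃ hl ((key _ hp' hp₂).trans (key _ hq' hq₂).symm)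
      · exact hdis h₃ (List.mem_append_right _ h₂)
      · exact DecompositionD1.suffix_disjoint hd hnd hd₂ hn₂ hyC le_rfl h₃ h₂
    · rcases h₃ with (h₃ | h₃) | h₃
      · exact sep e (Or.inl h₃) (Or.inr h₂)
      · exact absurd h₃ (DecompositionD1.suffix_disjoint hd' hnd' hpa hda (D.u_mem_C i) hij h₂)
      · exact sep e (Or.inr h₃) (Or.inr h₂)

/-! #### The case that every primary path intersects `b₁` -/

theorem not_disjoint_b₁ (hc : ¬ Connected I.G₂ I.s₂ I.t₂) (hp : IsPath I.G₁ I.s₂ p I.t₂) :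
    ¬ I.b₁.Disjoint p := fun h =>
  hc (isPath_G₂_iff.2 ⟨(isPath_G₁_iff.1 hp).1, (isPath_G₁_iff.1 hp).2, h⟩).connected

theorem TunablePair.value_G₁ (hc : ¬ Connected I.G₂ I.s₂ I.t₂)
    (h : TunablePair I.G₁ I.s₂ I.t₂ p b) : I.Feasible p b ∧
      I.ThreeCaseValue p b (I.linkProb (p.toFinset ∩ b.toFinset) +
        I.linkProb (I.p₁.toFinset \ I.b₁.toFinset)) := by
  have h₁ := isPath_G₁_iff.1 h.1
  have h₂ := isPath_G₁_iff.1 h.2.1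
  exact ⟨⟨h₁.1, h₂.1, h₁.2⟩,
    .unavoidable ⟨not_disjoint_b₁ hc h.1, not_disjoint_b₁ hc h.2.1, h₂.2⟩⟩

/-- If a link of `p₁` fails, the first connection moves to `b₁`, which both paths of the competitor
meet. The failure of a separating bridge of `G₁` also defeats the competitor. These two disjoint
sets make up the whole value of the tunable pair. -/
theorem TunablePair.le_of_not_disjoint (hc : ¬ Connected I.G₂ I.s₂ I.t₂)
    (h : TunablePair I.G₁ I.s₂ I.t₂ p b) {p' b' : List (Fin m)} (hf : I.Feasible p' b')
    (hb' : ¬ I.b₁.Disjoint b') : I.failureProb p b ≤ I.failureProb p' b' := by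
  obtain ⟨hf₀, hv⟩ := TunablePair.value_G₁ hc h
  rw [hv.eq_failureProb hf₀.2.2, linkProb, linkProb, ← Finset.sum_union]
  · refine linkProb_le_failureProb fun e he => ?_
    simp only [Finset.mem_union, Finset.mem_inter, Finset.mem_sdiff, List.mem_toFinset] at he
    rcases he with he | he
    · exact hf.not_usable (fun h => hf₀.2.2 h he.1) fun q hq =>
        ((h.2.2 e).1 he).mem hq.walkFromTo
    · simp only [Usable, occupied, he.1, if_true]
      exact ⟨fun h => not_disjoint_b₁ hc hf.isPath_G₁ h.2.symm, fun h => hb' h.2.symm⟩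
  · rw [Finset.disjoint_left]
    intro e he he'
    simp only [Finset.mem_inter, Finset.mem_sdiff, List.mem_toFinset] at he he'
    exact hf₀.2.2 he'.1 he.1

theorem value_overlapped (hc : ¬ Connected I.G₂ I.s₂ I.t₂) (hp : IsPath I.G₁ I.s₂ p I.t₂)
    (hb : IsPath I.G₁' I.s₂ b I.t₂) : I.Feasible p b ∧
      I.ThreeCaseValue p b (I.linkProb p.toFinset + I.linkProb (I.p₁.toFinset ∩ b.toFinset)) := by
  have h₁ := isPath_G₁_iff.1 hp
  have h₂ := isPath_G₁'_iff.1 hb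
  refine ⟨⟨h₁.1, h₂.1, h₁.2⟩, .overlapped ⟨not_disjoint_b₁ hc hp, h₂.2, fun h => ?_⟩⟩
  exact hc (isPath_G₂_iff.2 ⟨h₂.1, h, h₂.2⟩).connected

theorem linkProb_toFinset (hp : p.Nodup) : I.linkProb p.toFinset = (p.map I.prob).sum :=
  List.sum_toFinset _ hp

theorem linkProb_inter_toFinset (hb : b.Nodup) :
    I.linkProb (I.p₁.toFinset ∩ b.toFinset) = (b.map I.weight').sum := by
  rw [← List.sum_toFinset _ hb, linkProb, Finset.inter_comm, ← Finset.sum_ite_mem]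
  simp only [List.mem_toFinset]
  rfl

theorem failureProb_overlapped (hc : ¬ Connected I.G₂ I.s₂ I.t₂)
    (hp : IsPath I.G₁ I.s₂ p I.t₂) (hb : IsPath I.G₁' I.s₂ b I.t₂) :
    I.failureProb p b = (p.map I.prob).sum + (b.map I.weight').sum := by
  obtain ⟨hf, hv⟩ := value_overlapped hc hp hb
  rw [hv.eq_failureProb hf.2.2, linkProb_toFinset hp.nodup_links,
    linkProb_inter_toFinset hb.nodup_links]

/-- By `failureProb_overlapped` the value is a term of the primary path plus a term of the backup
path, over independent ranges, so the two shortest paths minimize the sum. -/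
theorem shortest_le (hc : ¬ Connected I.G₂ I.s₂ I.t₂)
    (hp : IsShortestPath I.G₁ I.prob I.s₂ p I.t₂)
    (hb : IsShortestPath I.G₁' I.weight' I.s₂ b I.t₂) {p' b' : List (Fin m)}
    (hf : I.Feasible p' b') (hb' : I.b₁.Disjoint b') :
    I.failureProb p b ≤ I.failureProb p' b' := by
  have h₁ := hf.isPath_G₁
  have h₂ : IsPath I.G₁' I.s₂ b' I.t₂ := isPath_G₁'_iff.2 ⟨hf.2.1, hb'⟩
  rw [failureProb_overlapped hc hp.1 hb.1, failureProb_overlapped hc h₁ h₂]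
  exact add_le_add (hp.2 _ h₁) (hb.2 _ h₂)

/-- If `G₂` does not connect the terminals, a competitor whose backup path avoids `b₁` is bounded by
the pair of shortest paths, any other one by the tunable pair, and the better of the two is
returned. When `G₁'` is disconnected, only competitors of the second kind exist. -/
theorem SCA.solves {o : Option (List (Fin m) × List (Fin m))} (h : I.SCA o) : I.Solves o := by
  cases h with
  | untouched D hc hD hT =>
    exact TunablePair.solves_G₂ hc D (fun k => Or.inl fun l hl => absurd hl (hD l)) hT
  | sameComponent D hc hE hij hT =>
    subst hij
    refine TunablePair.solves_G₂ hc D (fun k => ?_) hT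
    refine (le_or_gt _ k.castSucc).imp (fun hk l hl => (hE.1 l hl).2.trans hk)
      fun hk l hl => hk.trans_le (hE.1 l hl).1
  | detour D hc hE _ hT hpa hpb hd₁ hd₂ hdis hsp hsb hg hb₂ hsub =>
    exact solves_detour hc hE hT hpa hpb hd₁ hd₂ hdis hsp hsb hg hb₂ hsub
  | infeasible _ hc => exact fun p b hf => hc hf.isPath_G₁.connected
  | tunableOnly hc hT hc' =>
    obtain ⟨hf, hv⟩ := TunablePair.value_G₁ hc hT
    refine ⟨hf, _, hv, hv.eq_failureProb hf.2.2, fun p' b' hf' => ?_⟩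
    rw [← hv.eq_failureProb hf.2.2]
    exact TunablePair.le_of_not_disjoint hc hT hf' fun h =>
      hc' (isPath_G₁'_iff.2 ⟨hf'.2.1, h⟩).connected
  | tunable hc hT hp hb hlt =>
    obtain ⟨hf, hv⟩ := TunablePair.value_G₁ hc hT
    refine ⟨hf, _, hv, hv.eq_failureProb hf.2.2, fun p' b' hf' => ?_⟩
    rw [← hv.eq_failureProb hf.2.2]
    by_cases h : I.b₁.Disjoint b'
    · exact (not_lt.1 hlt).trans (shortest_le hc hp hb hf' h)
    · exact TunablePair.le_of_not_disjoint hc hT hf' h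
  | overlapped hc hT hp hb hlt =>
    obtain ⟨hf, hv⟩ := value_overlapped hc hp.1 hb.1
    refine ⟨hf, _, hv, hv.eq_failureProb hf.2.2, fun p' b' hf' => ?_⟩
    rw [← hv.eq_failureProb hf.2.2]
    by_cases h : I.b₁.Disjoint b'
    · exact shortest_le hc hp hb hf' h
    · exact hlt.le.trans (TunablePair.le_of_not_disjoint hc hT hf' h)

end Instance


/-! ### Systems of arcs

Directed arcs are natural numbers, as in the memory of the machine. A link is represented by a pair
of opposite arcs. -/

/-- The two ends, the opposite arc and the link of every arc. -/
structure Arcs where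
  tail : ℕ → ℕ
  head : ℕ → ℕ
  rev : ℕ → ℕ
  link : ℕ → ℕ

namespace Arcs

variable (N : Arcs)

/-- The arcs `π`, all of them in `A`, lead from `u` to `v`. -/
def Walk (A : ℕ → Prop) : ℕ → List ℕ → ℕ → Prop
  | u, [], v => u = v
  | u, a :: π, v => A a ∧ N.tail a = u ∧ Walk A (N.head a) π v

/-- The walk `π` from `u` visits no node twice. -/
def Simple (u : ℕ) (π : List ℕ) : Prop := (u :: π.map N.head).Nodup

/-- The arcs in `A` form pairs of opposite arcs that represent the same link. -/
structure IsSymm (A : ℕ → Prop) : Prop where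
  rev_mem : ∀ {a}, A a → A (N.rev a)
  tail_rev : ∀ {a}, A a → N.tail (N.rev a) = N.head a
  head_rev : ∀ {a}, A a → N.head (N.rev a) = N.tail a
  rev_rev : ∀ {a}, A a → N.rev (N.rev a) = a
  eq_or_eq_rev : ∀ {a b}, A a → A b → N.link a = N.link b → b = a ∨ b = N.rev a

variable {N} {A A' : ℕ → Prop} {u v w s t a b : ℕ} {π ρ P Q : List ℕ} {S : ℕ → Prop}

namespace Walk

theorem append (h : N.Walk A u π v) (h' : N.Walk A v ρ w) : N.Walk A u (π ++ ρ) w := by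
  induction π generalizing u with
  | nil => obtain rfl : u = v := h; exact h'
  | cons a π ih => exact ⟨h.1, h.2.1, ih h.2.2⟩

theorem of_append (h : N.Walk A u (π ++ ρ) w) : ∃ v, N.Walk A u π v ∧ N.Walk A v ρ w := by
  induction π generalizing u with
  | nil => exact ⟨u, rfl, h⟩
  | cons a π ih =>
    obtain ⟨v, h₁, h₂⟩ := ih h.2.2
    exact ⟨v, ⟨h.1, h.2.1, h₁⟩, h₂⟩

theorem of_append_cons (h : N.Walk A u (π ++ a :: ρ) w) :
    N.Walk A u π (N.tail a) ∧ A a ∧ N.Walk A (N.head a) ρ w := by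
  obtain ⟨v, h₁, h₂, rfl, h₃⟩ := h.of_append
  exact ⟨h₁, h₂, h₃⟩

theorem mono (h : N.Walk A u π v) (hA : ∀ a ∈ π, A a → A' a) : N.Walk A' u π v := by
  induction π generalizing u with
  | nil => exact h
  | cons a π ih =>
    exact ⟨hA a List.mem_cons_self h.1, h.2.1, ih h.2.2 fun b hb => hA b (.tail _ hb)⟩

theorem mem (h : N.Walk A u π v) (ha : a ∈ π) : A a := by
  obtain ⟨π₁, π₂, rfl⟩ := List.append_of_mem ha
  exact h.of_append_cons.2.1

/-- A walk that never leaves `S` and starts in `S` ends in `S`. -/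
theorem mem_end (h : N.Walk A u π v) (hS : ∀ a ∈ π, S (N.tail a) → S (N.head a)) (hu : S u) :
    S v := by
  induction π generalizing u with
  | nil => obtain rfl : u = v := h; exact hu
  | cons a π ih =>
    obtain ⟨-, rfl, h⟩ := h
    exact ih h (fun b hb => hS b (.tail _ hb)) (hS a List.mem_cons_self hu)

/-- A walk from outside of `S` into `S` has an arc that enters `S`. -/
theorem exists_enter (h : N.Walk A u π v) (hu : ¬ S u) (hv : S v) :
    ∃ π₁ a π₂, π = π₁ ++ a :: π₂ ∧ ¬ S (N.tail a) ∧ S (N.head a) := by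
  induction π generalizing u with
  | nil => obtain rfl : u = v := h; exact absurd hv hu
  | cons a π ih =>
    obtain ⟨-, rfl, h⟩ := h
    by_cases ha : S (N.head a)
    · exact ⟨[], a, π, rfl, hu, ha⟩
    · obtain ⟨π₁, b, π₂, rfl, hb⟩ := ih h ha
      exact ⟨a :: π₁, b, π₂, rfl, hb⟩

/-- The sum telescopes. For the indicator `χ` of a set of nodes it is the number of arcs that enter
the set minus the number of those that leave it. -/
theorem sum_delta (h : N.Walk A u π v) (χ : ℕ → ℤ) :
    (π.map fun a => χ (N.head a) - χ (N.tail a)).sum = χ v - χ u := by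
  induction π generalizing u with
  | nil => obtain rfl : u = v := h; simp
  | cons a π ih =>
    obtain ⟨-, rfl, h⟩ := h
    rw [List.map_cons, List.sum_cons, ih h]
    ring

end Walk

theorem Simple.nodup (h : N.Simple u π) : π.Nodup := (List.nodup_cons.1 h).2.of_map _

theorem Simple.of_cons (h : N.Simple u (a :: π)) : N.Simple (N.head a) π :=
  (List.nodup_cons.1 h).2

/-- The opposite of the first arc would lead back to the start, which a simple walk does not
revisit; the remaining arcs are handled by induction. -/
theorem Simple.rev_notMem (hN : N.IsSymm A) (h : N.Walk A u π v) (hs : N.Simple u π)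
    (ha : a ∈ π) : N.rev a ∉ π := by
  induction π generalizing u with
  | nil => simp at ha
  | cons b π ih =>
    have hb := h.1
    have hu : N.tail b ∉ (b :: π).map N.head := h.2.1 ▸ (List.nodup_cons.1 hs).1
    have key : ∀ c ∈ b :: π, c ≠ N.rev b := by
      rintro c hc rfl
      exact hu (List.mem_map.2 ⟨_, hc, hN.head_rev hb⟩)
    intro hr
    rcases List.mem_cons.1 ha with rfl | ha'
    · exact key _ hr rfl
    · rcases List.mem_cons.1 hr with hr | hr
      · exact key a ha (by rw [← hr, hN.rev_rev (h.mem ha)])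
      · exact ih h.2.2 hs.of_cons ha' hr

/-! ### Trees of shortest walks -/

/-- A tree of shortest walks to the root `t` that spans the nodes `v` with `vis v ≠ 0`. The walk
`π v` has the weight `D v` and starts with the arc `nxt v`. -/
structure Tree (N : Arcs) (A : ℕ → Prop) (W : ℕ → ℝ) (n t : ℕ) (vis : ℕ → ℕ) (D : ℕ → ℝ)
    (nxt : ℕ → ℕ) (π : ℕ → List ℕ) : Prop where
  root_lt : t < n
  vis_root : vis t = 2
  eq_root : ∀ v < n, vis v = 2 → v = t
  vis_le : ∀ v < n, vis v ≤ 2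
  root : π t = []
  step : ∀ v < n, vis v = 1 → π v = nxt v :: π (N.head (nxt v))
  walk : ∀ v < n, vis v ≠ 0 → N.Walk A v (π v) t
  simple : ∀ v < n, vis v ≠ 0 → N.Simple v (π v)
  vis_head : ∀ v < n, vis v ≠ 0 → ∀ a ∈ π v, vis (N.head a) ≠ 0
  weight : ∀ v < n, vis v ≠ 0 → D v = ((π v).map W).sum
  opt : ∀ v < n, vis v ≠ 0 → ∀ ρ, N.Walk A v ρ t → D v ≤ (ρ.map W).sum

section Tree

variable {W : ℕ → ℝ} {n : ℕ} {vis : ℕ → ℕ} {D : ℕ → ℝ} {nxt : ℕ → ℕ} {T : ℕ → List ℕ}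

/-- The start of the search. The mark `2` of the root, in contrast to `1` for the other nodes of the
tree, lets the extraction of a walk recognize its end by a test of the mark alone. -/
theorem Tree.single (ht : t < n) (hW : ∀ a, A a → 0 ≤ W a) (hvis : ∀ v < n, v ≠ t → vis v = 0)
    (hr : vis t = 2) (hD : D t = 0) : N.Tree A W n t vis D nxt fun _ => [] := by
  have key : ∀ v < n, vis v ≠ 0 → v = t := fun v hv h => by_contra fun hne => h (hvis v hv hne)
  refine ⟨ht, hr, fun v hv h => key v hv (by omega), fun v hv => ?_, rfl, fun v hv h => ?_, key,
    fun v _ _ => by simp [Simple], by simp, fun v hv h => ?_, fun v hv h ρ hρ => ?_⟩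
  · by_cases h : v = t
    · rw [h, hr]
    · rw [hvis v hv h]; omega
  · obtain rfl := key v hv (by omega)
    omega
  · obtain rfl := key v hv h
    simpa using hD
  · obtain rfl := key v hv h
    rw [hD]
    refine List.sum_nonneg fun x hx => ?_
    obtain ⟨a, ha, rfl⟩ := List.mem_map.1 hx
    exact hW a (hρ.mem ha)

/-- A node whose connection to the tree is as short as possible can be added to the tree. -/
theorem Tree.insert (h : N.Tree A W n t vis D nxt T) (hA : ∀ a, A a → N.tail a < n ∧ N.head a < n)
    (hW : ∀ a, A a → 0 ≤ W a) (ha : A a) (hta : vis (N.tail a) = 0) (hha : vis (N.head a) ≠ 0)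
    (hmin : ∀ b, A b → vis (N.tail b) = 0 → vis (N.head b) ≠ 0 →
      D (N.head a) + W a ≤ D (N.head b) + W b) :
    N.Tree A W n t (Function.update vis (N.tail a) 1)
      (Function.update D (N.tail a) (D (N.head a) + W a)) (Function.update nxt (N.tail a) a)
      (Function.update T (N.tail a) (a :: T (N.head a))) := by
  have hne : ∀ v, vis v ≠ 0 → v ≠ N.tail a := by rintro v hv rfl; exact hv hta
  have hh := h.walk _ (hA a ha).2 hha
  have ht := hne t (by simp [h.vis_root])
  have new : ∀ {p : ℕ → Prop}, p (N.tail a) → (∀ v < n, vis v ≠ 0 → v ≠ N.tail a → p v) →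
      ∀ v < n, Function.update vis (N.tail a) 1 v ≠ 0 → p v := by
    intro p h₁ h₂ v hv hv'
    by_cases hva : v = N.tail a
    · rwa [hva]
    · rw [Function.update_of_ne hva] at hv'
      exact h₂ v hv hv' hva
  have hvis : ∀ v, vis v ≠ 0 → Function.update vis (N.tail a) 1 v ≠ 0 := fun v hv => by
    rwa [Function.update_of_ne (hne v hv)]
  refine ⟨h.root_lt, ?_, fun v hv hv' => ?_, fun v hv => ?_, ?_, fun v hv hv' => ?_, new ?_ ?_,
    new ?_ ?_, new ?_ ?_, new ?_ ?_, new ?_ ?_⟩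
  · rw [Function.update_of_ne ht, h.vis_root]
  · by_cases hva : v = N.tail a
    · simp [hva] at hv'
    · rw [Function.update_of_ne hva] at hv'
      exact h.eq_root v hv hv'
  · by_cases hva : v = N.tail a
    · simp [hva]
    · rw [Function.update_of_ne hva]
      exact h.vis_le v hv
  · rw [Function.update_of_ne ht, h.root]
  · by_cases hva : v = N.tail a
    · subst hva
      simp [Function.update_of_ne (hne _ hha)]
    · rw [Function.update_of_ne hva] at hv' ⊢
      rw [Function.update_of_ne hva]
      have hs := h.step v hv hv'
      rw [Function.update_of_ne (hne _ (h.vis_head v hv (by omega) (nxt v) (by simp [hs])))]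
      exact hs
  · rw [Function.update_self]
    exact ⟨ha, rfl, hh⟩
  · intro v hv hv' hva
    rw [Function.update_of_ne hva]
    exact h.walk v hv hv'
  · rw [Function.update_self, Simple, List.map_cons, List.nodup_cons]
    refine ⟨fun hm => ?_, h.simple _ (hA a ha).2 hha⟩
    rcases List.mem_cons.1 hm with hm | hm
    · exact hne _ hha hm.symm
    · obtain ⟨b, hb, hb'⟩ := List.mem_map.1 hm
      exact hne _ (h.vis_head _ (hA a ha).2 hha b hb) hb'
  · intro v hv hv' hva
    rw [Function.update_of_ne hva]
    exact h.simple v hv hv'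
  · rw [Function.update_self]
    intro b hb
    rcases List.mem_cons.1 hb with rfl | hb
    · exact hvis _ hha
    · exact hvis _ (h.vis_head _ (hA a ha).2 hha b hb)
  · intro v hv hv' hva b hb
    rw [Function.update_of_ne hva] at hb
    exact hvis _ (h.vis_head v hv hv' b hb)
  · rw [Function.update_self, Function.update_self, h.weight _ (hA a ha).2 hha, List.map_cons,
      List.sum_cons, add_comm]
  · intro v hv hv' hva
    rw [Function.update_of_ne hva, Function.update_of_ne hva]
    exact h.weight v hv hv'
  · intro ρ hρ
    rw [Function.update_self]
    -- Dijkstra's argument: any walk from the new node enters the tree by some candidate arc `b`.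
    -- The part before `b` has nonnegative weight, and the rest weighs at least `D (N.head b) + W
    -- b`, which the chosen arc does not exceed.
    obtain ⟨π₁, b, π₂, rfl, hb₁, hb₂⟩ :=
      hρ.exists_enter (S := fun v => vis v ≠ 0) (not_not.2 hta) (by simp [h.vis_root])
    obtain ⟨h₁, hb, h₂⟩ := hρ.of_append_cons
    refine (hmin b hb (not_not.1 hb₁) hb₂).trans ?_
    have h₃ := h.opt _ (hA b hb).2 hb₂ π₂ h₂
    have h₄ : 0 ≤ (π₁.map W).sum := by
      refine List.sum_nonneg fun x hx => ?_
      obtain ⟨c, hc, rfl⟩ := List.mem_map.1 hx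
      exact hW c (h₁.mem hc)
    simp only [List.map_append, List.map_cons, List.sum_append, List.sum_cons]
    linarith
  · intro v hv hv' hva ρ hρ
    rw [Function.update_of_ne hva]
    exact h.opt v hv hv' ρ hρ

/-- A tree that spans all nodes from which the root can be reached. -/
structure SpanningTree (N : Arcs) (A : ℕ → Prop) (W : ℕ → ℝ) (n t : ℕ) (vis : ℕ → ℕ) (D : ℕ → ℝ)
    (nxt : ℕ → ℕ) (T : ℕ → List ℕ) : Prop extends N.Tree A W n t vis D nxt T where
  arc_lt : ∀ a, A a → N.tail a < n ∧ N.head a < n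
  closed : ∀ a, A a → vis (N.head a) ≠ 0 → vis (N.tail a) ≠ 0

/-- Dijkstra's algorithm as an existence proof, by induction on the number of nodes outside of the
tree. Finiteness of the set of arcs provides a best candidate. It serves
`Represents.exists_tunablePair`, where no program is run. -/
theorem exists_spanningTree (ht : t < n) (hA : ∀ a, A a → N.tail a < n ∧ N.head a < n)
    (hfin : {a | A a}.Finite) (hW : ∀ a, A a → 0 ≤ W a) :
    ∃ vis D nxt T, N.SpanningTree A W n t vis D nxt T := by
  classical
  suffices ∀ k vis D nxt T, N.Tree A W n t vis D nxt T →
      ((Finset.range n).filter fun v => vis v = 0).card = k →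
      ∃ vis D nxt T, N.SpanningTree A W n t vis D nxt T by
    refine this _ (fun v => if v = t then 2 else 0) (fun _ => 0) (fun _ => 0) _
      (Tree.single ht hW ?_ ?_ rfl) rfl
    · intro v _ h; simp [h]
    · simp
  intro k
  induction k using Nat.strong_induction_on with
  | _ k ih =>
    intro vis D nxt T h hk
    have hf : {a | A a ∧ vis (N.tail a) = 0 ∧ vis (N.head a) ≠ 0}.Finite :=
      hfin.subset fun a ha => ha.1
    by_cases hc : ∃ a, A a ∧ vis (N.tail a) = 0 ∧ vis (N.head a) ≠ 0
    · obtain ⟨a, ha, hmin⟩ := hf.toFinset.exists_min_image (fun a => D (N.head a) + W a)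
        (hc.imp fun a ha => by simpa using ha)
      obtain ⟨ha, hta, hha⟩ := hf.mem_toFinset.1 ha
      refine ih _ ?_ _ _ _ _ (h.insert hA hW ha hta hha fun b h₁ h₂ h₃ =>
        hmin b (by simpa using ⟨h₁, h₂, h₃⟩)) rfl
      rw [← hk]
      refine Finset.card_lt_card ⟨fun v hv => ?_, fun hsub => ?_⟩
      · simp only [Finset.mem_filter, Finset.mem_range] at hv ⊢
        refine ⟨hv.1, ?_⟩
        by_cases hva : v = N.tail a
        · rwa [hva]
        · simpa [hva] using hv.2
      · have := hsub (Finset.mem_filter.2 ⟨Finset.mem_range.2 (hA a ha).1, hta⟩)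
        simp at this
    · exact ⟨vis, D, nxt, T, h, hA, fun a ha h₁ h₂ => hc ⟨a, ha, h₂, h₁⟩⟩

namespace SpanningTree

variable (h : N.SpanningTree A W n t vis D nxt T)

include h

theorem vis_of_walk (hw : N.Walk A v π t) : vis v ≠ 0 := by
  by_contra hv
  obtain ⟨π₁, a, π₂, rfl, h₁, h₂⟩ :=
    hw.exists_enter (S := fun v => vis v ≠ 0) (not_not.2 hv) (by simp [h.vis_root])
  exact h₁ (h.closed a hw.of_append_cons.2.1 h₂)

theorem vis_iff (hv : v < n) : vis v ≠ 0 ↔ ∃ π, N.Walk A v π t :=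
  ⟨fun hv' => ⟨_, h.walk v hv hv'⟩, fun ⟨_, hw⟩ => h.vis_of_walk hw⟩

theorem tension (ha : A a) (hv : vis (N.head a) ≠ 0) :
    D (N.tail a) ≤ D (N.head a) + W a := by
  have h₁ := h.opt _ (h.arc_lt a ha).1 (h.closed a ha hv) (a :: T (N.head a))
    ⟨ha, rfl, h.walk _ (h.arc_lt a ha).2 hv⟩
  rwa [List.map_cons, List.sum_cons, ← h.weight _ (h.arc_lt a ha).2 hv, add_comm] at h₁

/-- Parts of a shortest walk are shortest: otherwise, replacing the part of `T v` from the tail of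
`a` on by the shortest walk from there would improve the walk from `v`. -/
theorem tight (hv : v < n) (hv' : vis v ≠ 0) (ha : a ∈ T v) :
    D (N.head a) + W a ≤ D (N.tail a) := by
  have hw := h.walk v hv hv'
  have hh := h.vis_head v hv hv' a ha
  have h₀ := h.weight v hv hv'
  have h₅ := h.opt v hv hv'
  obtain ⟨π₁, π₂, hT⟩ := List.append_of_mem ha
  rw [hT] at hw h₀
  obtain ⟨h₁, h₂, h₃⟩ := hw.of_append_cons
  have hl := h.arc_lt a h₂
  have ht := h.closed a h₂ hh
  have h₄ := h.opt _ hl.2 hh π₂ h₃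
  have h₆ := h₅ _ (h₁.append (h.walk _ hl.1 ht))
  rw [List.map_append, List.sum_append, ← h.weight _ hl.1 ht] at h₆
  simp only [List.map_append, List.map_cons, List.sum_append, List.sum_cons] at h₀
  linarith

end SpanningTree

end Tree

/-! ### Two paths with few common links -/

section Flow

variable (hN : N.IsSymm A) (hP : N.Walk A s P t) (hPs : N.Simple s P)

include hN hP hPs

/-- An arc along which the distance to `t` decreases, where the arcs of the path `P` have weight `1`
and the others have weight `0`, is on `P`, and it is on all walks from `s` to `t`. -/
theorem mem_of_dist_lt {D : ℕ → ℝ} {R : ℕ → Prop}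
    (hR : ∀ a, A a → R (N.head a) → R (N.tail a) ∧
      D (N.tail a) ≤ D (N.head a) + if a ∈ P then 1 else 0)
    (hb : A b) (hbR : R (N.head b)) (hlt : D (N.head b) < D (N.tail b)) :
    b ∈ P ∧ ∀ ρ, N.Walk A s ρ t → b ∈ ρ := by
  -- `S` is the ball of all nodes that are no farther from `t` than the head of `b`. Arcs off `P`
  -- have weight `0`, so they cannot enter it. Hence `P` never leaves `S`: the opposite of a leaving
  -- arc would enter `S` and be on `P` too, which is impossible on a simple path. So `P` enters `S`
  -- exactly once, by `b`.
  set S : ℕ → Prop := fun z => R z ∧ D z ≤ D (N.head b)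
  have henter : ∀ a, A a → ¬ S (N.tail a) → S (N.head a) → a ∈ P := by
    intro a ha h₁ h₂
    by_contra haP
    obtain ⟨h₃, h₄⟩ := hR a ha h₂.1
    rw [if_neg haP, add_zero] at h₄
    exact h₁ ⟨h₃, h₄.trans h₂.2⟩
  have hleave : ∀ a ∈ P, S (N.tail a) → S (N.head a) := by
    intro a ha h₁
    by_contra h₂
    have haA := hP.mem ha
    refine hPs.rev_notMem hN hP ha (henter _ (hN.rev_mem haA) ?_ ?_)
    · rwa [hN.tail_rev haA]
    · rwa [hN.head_rev haA]
  have hbt : ¬ S (N.tail b) := fun h => absurd h.2 (not_le.2 hlt)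
  have hbh : S (N.head b) := ⟨hbR, le_rfl⟩
  have hbP := henter b hb hbt hbh
  refine ⟨hbP, fun ρ hρ => ?_⟩
  obtain ⟨P₁, P₂, rfl⟩ := List.append_of_mem hbP
  obtain ⟨h₁, -, h₂⟩ := hP.of_append_cons
  have hs : ¬ S s := fun hs => hbt (h₁.mem_end (fun a ha => hleave a (by simp [ha])) hs)
  have ht : S t := h₂.mem_end (fun a ha => hleave a (by simp [ha])) hbh
  -- Every walk from `s` to `t` enters `S`, and it does so by an arc of `P`. An arc of `P` before or
  -- after `b` is ruled out, since `P` never leaves `S`.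
  obtain ⟨ρ₁, c, ρ₂, rfl, hc₁, hc₂⟩ := hρ.exists_enter hs ht
  have hc := henter c hρ.of_append_cons.2.1 hc₁ hc₂
  rcases List.mem_append.1 hc with hc | hc
  · obtain ⟨π₁, π₂, rfl⟩ := List.append_of_mem hc
    exact absurd (h₁.of_append_cons.2.2.mem_end (fun a ha => hleave a (by simp [ha])) hc₂) hbt
  · rcases List.mem_cons.1 hc with rfl | hc
    · simp
    · obtain ⟨π₁, π₂, rfl⟩ := List.append_of_mem hc
      exact absurd (h₂.of_append_cons.1.mem_end (fun a ha => hleave a (by simp [ha])) hbh) hc₁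

variable (hQ : N.Walk A s Q t) (hQs : N.Simple s Q)

include hQ hQs

/-- Each path enters `S` once more than it leaves it. An arc of `P` whose opposite is on `Q` cancels
with this opposite arc, so the rest still carries two units across the cut. Arcs that both paths use
in the same direction are counted twice. -/
theorem sum_delta_eq_two (hs : ¬ S s) (ht : S t) (χ : ℕ → ℤ)
    (hχ : ∀ z, (S z → χ z = 1) ∧ (¬ S z → χ z = 0)) :
    ∑ a ∈ P.toFinset with N.rev a ∉ Q, (χ (N.head a) - χ (N.tail a)) +
      ∑ a ∈ Q.toFinset with N.rev a ∉ P, (χ (N.head a) - χ (N.tail a)) = 2 := by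
  have hp := hP.sum_delta χ
  have hq := hQ.sum_delta χ
  rw [← List.sum_toFinset _ hPs.nodup] at hp
  rw [← List.sum_toFinset _ hQs.nodup] at hq
  rw [(hχ t).1 ht, (hχ s).2 hs, ← Finset.sum_filter_add_sum_filter_not _ fun a => N.rev a ∉ Q] at hp
  rw [(hχ t).1 ht, (hχ s).2 hs, ← Finset.sum_filter_add_sum_filter_not _ fun a => N.rev a ∉ P] at hq
  have hpq : ∑ a ∈ P.toFinset with ¬ N.rev a ∉ Q, (χ (N.head a) - χ (N.tail a)) =
      -∑ a ∈ Q.toFinset with ¬ N.rev a ∉ P, (χ (N.head a) - χ (N.tail a)) := by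
    rw [← Finset.sum_neg_distrib]
    refine Finset.sum_bij' (fun a _ => N.rev a) (fun a _ => N.rev a) ?_ ?_ ?_ ?_ ?_ <;>
      intro a ha <;> simp only [Finset.mem_filter, List.mem_toFinset, not_not] at ha ⊢
    · exact ⟨ha.2, by rw [hN.rev_rev (hP.mem ha.1)]; exact ha.1⟩
    · exact ⟨ha.2, by rw [hN.rev_rev (hQ.mem ha.1)]; exact ha.1⟩
    · exact hN.rev_rev (hP.mem ha.1)
    · exact hN.rev_rev (hQ.mem ha.1)
    · rw [hN.head_rev (hP.mem ha.1), hN.tail_rev (hP.mem ha.1)]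
      ring
  linarith

/-- The arcs of the two paths, up to those that are used in both directions; of the second path, only
the real arcs are kept. -/
theorem exists_enter_union {real : ℕ → Prop} (hreal : ∀ a ∈ Q, ∀ b ∈ Q, ¬ real a → ¬ real b →
      N.link a = N.link b) (hs : ¬ S s) (ht : S t) :
    ∃ a, (a ∈ P ∧ N.rev a ∉ Q ∨ a ∈ Q ∧ N.rev a ∉ P ∧ real a) ∧ ¬ S (N.tail a) ∧
      S (N.head a) := by
  classical
  by_contra! hno
  set χ : ℕ → ℤ := fun z => if S z then 1 else 0
  have hχ : ∀ z, (S z → χ z = 1) ∧ (¬ S z → χ z = 0) :=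
    fun z => ⟨fun h => if_pos h, fun h => if_neg h⟩
  have h2 := sum_delta_eq_two hN hP hPs hQ hQs hs ht χ hχ
  have hle : ∀ a, χ (N.head a) - χ (N.tail a) ≤ 1 := by
    intro a; simp only [χ]; split_ifs <;> omega
  have hle0 : ∀ a, (a ∈ P ∧ N.rev a ∉ Q ∨ a ∈ Q ∧ N.rev a ∉ P ∧ real a) →
      χ (N.head a) - χ (N.tail a) ≤ 0 := by
    intro a ha
    have := hno a ha
    simp only [χ]; split_ifs <;> first | omega | tauto
  have hP0 : ∑ a ∈ P.toFinset with N.rev a ∉ Q, (χ (N.head a) - χ (N.tail a)) ≤ 0 := by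
    refine Finset.sum_nonpos fun a ha => hle0 a (Or.inl ?_)
    simpa using ha
  rw [← Finset.sum_filter_add_sum_filter_not (Q.toFinset.filter _) real] at h2
  have hQ0 : ∑ a ∈ (Q.toFinset.filter fun a => N.rev a ∉ P) with real a,
      (χ (N.head a) - χ (N.tail a)) ≤ 0 := by
    refine Finset.sum_nonpos fun a ha => hle0 a (Or.inr ?_)
    simpa [and_assoc] using ha
  -- The simple path `Q` passes the unreal link at most once, so discarding it costs at most one of
  -- the two units.
  have hQ1 : ∑ a ∈ (Q.toFinset.filter fun a => N.rev a ∉ P) with ¬ real a,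
      (χ (N.head a) - χ (N.tail a)) ≤ 1 := by
    have hcard : ((Q.toFinset.filter fun a => N.rev a ∉ P).filter fun a => ¬ real a).card ≤ 1 := by
      refine Finset.card_le_one.2 fun a ha b hb => ?_
      simp only [Finset.mem_filter, List.mem_toFinset] at ha hb
      rcases hN.eq_or_eq_rev (hQ.mem ha.1.1) (hQ.mem hb.1.1)
        (hreal a ha.1.1 b hb.1.1 ha.2 hb.2) with h | h
      · exact h.symm
      · exact absurd (h ▸ hb.1.1) (hQs.rev_notMem hN hQ ha.1.1)
    refine (Finset.sum_le_card_nsmul _ _ 1 fun a _ => hle a).trans ?_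
    simpa using hcard
  linarith

/-- What remains of the two paths when a path `P'` made of their arcs is removed. -/
theorem exists_enter_remainder {P' : List ℕ} (hP' : N.Walk A s P' t) (hPs' : N.Simple s P')
    (hsub : ∀ a ∈ P', a ∈ P ∧ N.rev a ∉ Q ∨ a ∈ Q ∧ N.rev a ∉ P) (hs : ¬ S s) (ht : S t) :
    ∃ a, (a ∈ P ∧ N.rev a ∉ Q ∨ a ∈ Q ∧ N.rev a ∉ P) ∧ (a ∈ P' → a ∈ P ∧ a ∈ Q) ∧
      ¬ S (N.tail a) ∧ S (N.head a) := by
  classical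
  by_contra! hno
  set χ : ℕ → ℤ := fun z => if S z then 1 else 0
  have hχ : ∀ z, (S z → χ z = 1) ∧ (¬ S z → χ z = 0) :=
    fun z => ⟨fun h => if_pos h, fun h => if_neg h⟩
  have h2 := sum_delta_eq_two hN hP hPs hQ hQs hs ht χ hχ
  have h1 := hP'.sum_delta χ
  rw [← List.sum_toFinset _ hPs'.nodup, (hχ t).1 ht, (hχ s).2 hs] at h1
  set δ : ℕ → ℤ := fun a => χ (N.head a) - χ (N.tail a) with hδ
  set X := P.toFinset.filter fun a => N.rev a ∉ Q
  set Y := Q.toFinset.filter fun a => N.rev a ∉ P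
  have hsubU : P'.toFinset ⊆ X ∪ Y := by
    intro a ha
    have := hsub a (by simpa using ha)
    simpa [X, Y] using this
  have hX : ∑ a ∈ X, δ a = ∑ a ∈ X ∪ Y, if a ∈ X then δ a else 0 := by
    rw [Finset.sum_ite_mem, Finset.union_inter_cancel_left]
  have hY : ∑ a ∈ Y, δ a = ∑ a ∈ X ∪ Y, if a ∈ Y then δ a else 0 := by
    rw [Finset.sum_ite_mem, Finset.union_inter_cancel_right]
  have hZ : ∑ a ∈ P'.toFinset, δ a = ∑ a ∈ X ∪ Y, if a ∈ P'.toFinset then δ a else 0 := by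
    rw [Finset.sum_ite_mem, Finset.inter_eq_right.2 hsubU]
  -- Counted with multiplicity in `X` and `Y`, the arcs carry two units across the cut; removing the
  -- path `P'` leaves one.
  have hsum : ∑ a ∈ X ∪ Y, ((if a ∈ X then δ a else 0) + (if a ∈ Y then δ a else 0) -
      if a ∈ P'.toFinset then δ a else 0) = 1 := by
    rw [Finset.sum_sub_distrib, Finset.sum_add_distrib, ← hX, ← hY, ← hZ]
    linarith
  have hnonpos : ∑ a ∈ X ∪ Y, ((if a ∈ X then δ a else 0) + (if a ∈ Y then δ a else 0) -
      if a ∈ P'.toFinset then δ a else 0) ≤ 0 := by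
    refine Finset.sum_nonpos fun a ha => ?_
    have hXY : a ∈ X ∨ a ∈ Y := Finset.mem_union.1 ha
    have hδa : (a ∈ P' → a ∈ P ∧ a ∈ Q) → δ a ≤ 0 := by
      intro h
      have := hno a (by simpa [X, Y] using hXY) h
      simp only [hδ, χ]; split_ifs <;> first | omega | tauto
    by_cases haP' : a ∈ P'
    · by_cases hPQ : a ∈ P ∧ a ∈ Q
      -- An arc of both paths has multiplicity two, and one copy survives the removal of `P'`. This
      -- is why the remainder may reuse common arcs.
      · have := hδa fun _ => hPQ
        have hx : a ∈ X := by simp [X, hPQ, hQs.rev_notMem hN hQ hPQ.2]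
        have hy : a ∈ Y := by simp [Y, hPQ, hPs.rev_notMem hN hP hPQ.1]
        simp only [hx, hy, if_true, List.mem_toFinset, haP']
        omega
      · have hx : ¬ (a ∈ X ∧ a ∈ Y) := by
          simp only [X, Y, Finset.mem_filter, List.mem_toFinset]
          tauto
        simp only [List.mem_toFinset, haP', if_true]
        split_ifs <;> first | omega | tauto
    · have := hδa fun h => absurd h haP'
      simp only [List.mem_toFinset, haP', if_false]
      split_ifs <;> omega
  linarith

omit hP hPs hQ hQs in
-- After the cancellation no link is present in both directions: opposite arcs would lie on
-- different paths, where they cancel, or on the same simple path. So a common link of two paths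
-- made of these arcs is a common arc.
theorem mem_of_link_eq (hP : N.Walk A s P t) (hPs : N.Simple s P) (hQ : N.Walk A s Q t)
    (hQs : N.Simple s Q) (ha : a ∈ P ∧ N.rev a ∉ Q ∨ a ∈ Q ∧ N.rev a ∉ P)
    (hb : b ∈ P ∧ N.rev b ∉ Q ∨ b ∈ Q ∧ N.rev b ∉ P) (hl : N.link a = N.link b) : b = a := by
  have hA : A a := ha.elim (fun h => hP.mem h.1) fun h => hQ.mem h.1
  have hB : A b := hb.elim (fun h => hP.mem h.1) fun h => hQ.mem h.1
  rcases hN.eq_or_eq_rev hA hB hl with h | rfl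
  · exact h
  · rw [hN.rev_rev hA] at hb
    have h₁ := fun h => hPs.rev_notMem hN hP (a := a) h
    have h₂ := fun h => hQs.rev_notMem hN hQ (a := a) h
    tauto

end Flow

end Arcs


/-! ### Existence of the decomposition -/

section Decomposition

variable {α β : Type*} {G : Graph α β} {s t x y z u v : α} {e : β} {es : List β} {vs : List α}

/-- The walk is cut at its links in `B`. A first link outside of `B` only prolongs the first piece,
so it changes nothing but `u 0`. -/
theorem IsWalk.exists_pieces (B : β → Prop) [DecidablePred B] {F : Set β} (hF : ∀ e, e ∈ F ↔ B e)
    (h : IsWalk G s es t vs) : ∃ (r : ℕ) (bridge : Fin r → β) (u v : Fin (r + 1) → α), u 0 = s ∧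
      v (Fin.last r) = t ∧ (∀ l : Fin r, G.IsLink (bridge l) (v l.castSucc) (u l.succ)) ∧
      (∀ l, Connected (G.deleteEdges F) (u l) (v l)) ∧ List.ofFn bridge = es.filter B := by
  induction h with
  | @nil u hu =>
    exact ⟨0, Fin.elim0, fun _ => u, fun _ => u, rfl, rfl, fun l => l.elim0,
      fun _ => Connected.refl hu, by simp⟩
  | @cons a w t e es vs hl h ih =>
    obtain ⟨r, bridge, u, v, rfl, hv, hlink, hconn, hof⟩ := ih
    by_cases he : B e
    · refine ⟨r + 1, Fin.cons e bridge, Fin.cons a u, Fin.cons a v, rfl, ?_, ?_, ?_, ?_⟩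
      · rw [← Fin.succ_last, Fin.cons_succ, hv]
      · intro l
        refine Fin.cases ?_ (fun l => ?_) l
        · exact hl
        · rw [← Fin.succ_castSucc, Fin.cons_succ, Fin.cons_succ, Fin.cons_succ]
          exact hlink l
      · intro l
        refine Fin.cases ?_ (fun l => ?_) l
        · exact Connected.refl hl.left_mem
        · exact hconn l
      · rw [List.ofFn_succ, List.filter_cons_of_pos (by simpa using he)]
        simpa using hof
    · refine ⟨r, bridge, Function.update u 0 a, v, Function.update_self .., hv, fun l => ?_,
        fun l => ?_, by rw [List.filter_cons_of_neg (by simpa using he), hof]⟩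
      · rw [Function.update_of_ne (Fin.succ_ne_zero l)]
        exact hlink l
      · by_cases hl0 : l = 0
        · subst hl0
          rw [Function.update_self]
          refine Connected.trans (Connected.of_isLink (e := e) ?_) (hconn 0)
          rw [Graph.deleteEdges_isLink]
          exact ⟨hl, fun h => he ((hF e).1 h)⟩
        · rw [Function.update_of_ne hl0]
          exact hconn l

/-- A simple path from `s` to `t` contains each separating bridge exactly once; cutting the path at
them lists them in order. -/
theorem nonempty_decomposition (h : Connected G s t) : Nonempty (DecompositionD1 G s t) := by
  classical
  obtain ⟨es, vs, hw, hn⟩ := h.exists_isPath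
  obtain ⟨r, bridge, u, v, hu, hv, hlink, hconn, hof⟩ :=
    hw.exists_pieces (SepBridge G s t) (F := {e | SepBridge G s t e}) fun e => Iff.rfl
  have hrange : ∀ e, e ∈ Set.range bridge ↔ SepBridge G s t e := fun e => by
    rw [← List.mem_ofFn', hof, List.mem_filter]
    simpa using fun hb => SepBridge.mem hb ⟨vs, hw⟩
  have hset : Set.range bridge = {e | SepBridge G s t e} := Set.ext hrange
  exact ⟨⟨r, bridge, u, v, List.nodup_ofFn.1 (hof ▸ (hw.nodup_links hn).filter _), hrange, hu, hv,
    hlink, hset ▸ hconn⟩⟩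

/-- For `i ≠ 0`, a walk from `s` to `C i` or beyond has to use the bridge into `C i`, and `u i` is
an end of it. -/
theorem DecompositionD1.u_mem_of_walk (D : DecompositionD1 G s t) {i l : Fin (D.r + 1)}
    (h : IsWalk G s es z vs) (hz : z ∈ D.C l) (hil : i ≤ l) : D.u i ∈ vs := by
  rcases Fin.eq_zero_or_eq_succ i with rfl | ⟨k, rfl⟩
  · rw [D.u_first]; exact h.start_mem
  · refine (h.mem_of_isLink (h.mem_of_cutBy (D.cutBy_after k) ?_ ?_) (D.isLink_bridge k)).2
    · rw [D.mem_after_iff D.s_mem_C]; simp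
    · rw [D.mem_after_iff hz]; exact Fin.castSucc_lt_succ.trans_le hil

theorem DecompositionD1.v_mem_of_walk (D : DecompositionD1 G s t) {j l : Fin (D.r + 1)}
    (h : IsWalk G z es t vs) (hz : z ∈ D.C l) (hlj : l ≤ j) : D.v j ∈ vs := by
  rcases Fin.eq_castSucc_or_eq_last j with ⟨k, rfl⟩ | rfl
  · refine (h.mem_of_isLink (h.mem_of_cutBy (D.cutBy_after k) ?_ ?_) (D.isLink_bridge k)).1
    · rw [D.mem_after_iff hz]; exact not_lt.2 hlj
    · rw [D.mem_after_iff D.t_mem_C]; exact Fin.castSucc_lt_last k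
  · rw [D.v_last]; exact h.end_mem

end Decomposition

/-! ### Graphs represented by arcs -/

/-- The arcs in `A` represent the links of `G`; the link `e` has the number `code e`. -/
structure Represents {n : ℕ} {β : Type*} (N : Arcs) (A : ℕ → Prop) (G : Graph (Fin n) β)
    (code : β → ℕ) : Prop where
  symm : N.IsSymm A
  injective : Function.Injective code
  mem_vertexSet : ∀ x, x ∈ G.vertexSet
  exists_link : ∀ a, A a → ∃ e u v, N.link a = code e ∧ N.tail a = Fin.val u ∧
    N.head a = Fin.val v ∧ G.IsLink e u v
  exists_arc : ∀ e u v, G.IsLink e u v → ∃ a, A a ∧ N.link a = code e ∧ N.tail a = u ∧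
    N.head a = v

namespace Represents

variable {n : ℕ} {β : Type*} {N : Arcs} {A : ℕ → Prop} {G : Graph (Fin n) β} {code : β → ℕ}
  {u v s t x y : Fin n} {w : ℕ} {π ρ P Q P' B' : List ℕ} {es p b : List β} {vs : List (Fin n)}
  {e : β}

section

variable (h : Represents N A G code)

include h

theorem arc_lt (a : ℕ) (ha : A a) : N.tail a < n ∧ N.head a < n := by
  obtain ⟨e, u, v, -, hu, hv, -⟩ := h.exists_link a ha
  exact ⟨hu ▸ u.2, hv ▸ v.2⟩

theorem isWalk_of_walk (hw : N.Walk A u π w) : ∃ es v vs, w = Fin.val v ∧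
    π.map N.link = es.map code ∧ IsWalk G u es v vs ∧ vs.map Fin.val = u.val :: π.map N.head := by
  induction π generalizing u with
  | nil => exact ⟨[], u, [u], Eq.symm hw, rfl, .nil (h.mem_vertexSet u), rfl⟩
  | cons a π ih =>
    obtain ⟨ha, hta, hw⟩ := hw
    obtain ⟨e, x, y, he, hx, hy, hl⟩ := h.exists_link a ha
    obtain rfl : x = u := Fin.ext (hx.symm.trans hta)
    rw [hy] at hw
    obtain ⟨es, v, vs, rfl, hes, hw, hvs⟩ := ih hw
    exact ⟨e :: es, v, x :: vs, rfl, by simp [he, hes], .cons hl hw, by simp [hvs, hy]⟩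

theorem walk_of_isWalk (hw : IsWalk G u es v vs) : ∃ π, N.Walk A u π v ∧
    π.map N.link = es.map code ∧ vs.map Fin.val = u.val :: π.map N.head := by
  induction hw with
  | nil _ => exact ⟨[], rfl, rfl, rfl⟩
  | cons hl _ ih =>
    obtain ⟨π, hπ, hes, hvs⟩ := ih
    obtain ⟨a, ha, hla, hta, hha⟩ := h.exists_arc _ _ _ hl
    exact ⟨a :: π, ⟨ha, hta, hha ▸ hπ⟩, by simp [hla, hes], by simp [hvs, hha]⟩

theorem isPath_of_walk (hw : N.Walk A u π v) (hs : N.Simple u π) :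
    ∃ es, π.map N.link = es.map code ∧ IsPath G u es v := by
  obtain ⟨es, v', vs, hv, hes, hw, hvs⟩ := h.isWalk_of_walk hw
  obtain rfl : v = v' := Fin.ext hv
  refine ⟨es, hes, vs, hw, List.Nodup.of_map Fin.val ?_⟩
  rw [hvs]
  exact hs

theorem walk_of_isPath (hp : IsPath G u es v) :
    ∃ π, N.Walk A u π v ∧ N.Simple u π ∧ π.map N.link = es.map code := by
  obtain ⟨vs, hw, hn⟩ := hp
  obtain ⟨π, hπ, hes, hvs⟩ := h.walk_of_isWalk hw
  refine ⟨π, hπ, ?_, hes⟩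
  rw [Arcs.Simple, ← hvs]
  exact hn.map Fin.val_injective

theorem connected_iff : Connected G u v ↔ ∃ π, N.Walk A u π v := by
  constructor
  · rintro ⟨es, vs, hw⟩
    exact (h.walk_of_isWalk hw).imp fun π h => h.1
  · rintro ⟨π, hw⟩
    obtain ⟨es, v', vs, hv, -, hw, -⟩ := h.isWalk_of_walk hw
    obtain rfl : v = v' := Fin.ext hv
    exact ⟨es, vs, hw⟩

theorem not_connected_of_mem (hsep : ∀ ρ, N.Walk A s ρ t → ∃ c ∈ ρ, N.link c = code e) :
    ¬ Connected (G.deleteEdges {e}) s t := by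
  rintro ⟨es, vs, hw⟩
  obtain ⟨hw, he⟩ := hw.of_deleteEdges
  obtain ⟨ρ, hρ, hes, -⟩ := h.walk_of_isWalk hw
  obtain ⟨c, hc, hce⟩ := hsep ρ hρ
  have : code e ∈ es.map code := by
    rw [← hes, ← hce]
    exact List.mem_map_of_mem hc
  exact he e ((List.mem_map_of_injective h.injective).1 this) rfl

theorem sepBridge_of_mem {a : ℕ} (ha : A a) (hae : N.link a = code e) (hc : Connected G s t)
    (hsep : ∀ ρ, N.Walk A s ρ t → a ∈ ρ) : SepBridge G s t e := by
  refine ⟨?_, hc, h.not_connected_of_mem fun ρ hρ => ⟨a, hsep ρ hρ, hae⟩⟩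
  obtain ⟨e', u, v, he, -, -, hl⟩ := h.exists_link a ha
  obtain rfl := h.injective (hae.symm.trans he)
  exact hl.edge_mem

/-- Two paths of arcs whose common links are on all walks form a tunable pair. -/
theorem tunablePair (hp : IsPath G s p t) (hb : IsPath G s b t)
    (hpP : P'.map N.link = p.map code) (hbB : ∀ e ∈ b, ∃ c ∈ B', N.link c = code e)
    (hP : ∀ a ∈ P', A a)
    (hsep : ∀ a ∈ P', ∀ c ∈ B', N.link a = N.link c → ∀ ρ, N.Walk A s ρ t → a ∈ ρ) :
    TunablePair G s t p b := by
  refine ⟨hp, hb, fun e => ⟨fun ⟨he, he'⟩ => ?_, fun he => ⟨he.mem hp.walkFromTo,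
    he.mem hb.walkFromTo⟩⟩⟩
  have : code e ∈ P'.map N.link := hpP ▸ List.mem_map_of_mem he
  obtain ⟨a, ha, hae⟩ := List.mem_map.1 this
  obtain ⟨c, hc, hce⟩ := hbB e he'
  exact h.sepBridge_of_mem (hP a ha) hae hp.connected (hsep a ha c hc (hae.trans hce.symm))

end

/-! #### Distances and components -/

section Dist

variable {D : ℕ → ℝ} {vis nxt : ℕ → ℕ} {T : ℕ → List ℕ}

theorem _root_.Survivable.Arcs.SpanningTree.mem_of_dist_lt {s t a : ℕ} (hN : N.IsSymm A)
    (hP : N.Walk A s P t) (hPs : N.Simple s P)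
    (hT : N.SpanningTree A (fun a => if a ∈ P then 1 else 0) n t vis D nxt T) (ha : A a)
    (hv : vis (N.head a) ≠ 0) (hlt : D (N.head a) < D (N.tail a)) :
    a ∈ P ∧ ∀ ρ, N.Walk A s ρ t → a ∈ ρ :=
  Arcs.mem_of_dist_lt hN hP hPs (R := fun z => vis z ≠ 0)
    (fun b hb hbv => ⟨hT.closed b hb hbv, hT.tension hb hbv⟩) ha hv hlt

variable (h : Represents N A G code) (hP : N.Walk A s P t) (hPs : N.Simple s P)
  (hT : N.SpanningTree A (fun a => if a ∈ P then 1 else 0) n t vis D nxt T)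
  (𝒟 : DecompositionD1 G s t)

include h hP hPs hT

/-- If the distance dropped across a link in either direction, the corresponding arc would be on all
walks from `s` to `t`, so the link would be a separating bridge; but the links inside a component
are none. -/
theorem dist_eq_of_mem_C {l : Fin (𝒟.r + 1)} (hx : x ∈ 𝒟.C l) (hy : y ∈ 𝒟.C l) :
    D x = D y := by
  have hc : Connected G s t := h.connected_iff.2 ⟨P, hP⟩
  suffices ∀ a ∈ 𝒟.C l, ∀ es vs b,
      IsWalk (G.deleteEdges (Set.range 𝒟.bridge)) a es b vs → D a = D b by
    obtain ⟨es, vs, hw⟩ := Connected.trans (Connected.symm hx) hy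
    exact this x hx es vs y hw
  intro a ha es vs b hw
  induction hw with
  | nil => rfl
  | @cons a w b e es vs hl hw ih =>
    have hw' : w ∈ 𝒟.C l := Connected.trans ha (Connected.of_isLink hl)
    rw [← ih hw']
    obtain ⟨hl, he⟩ := (Graph.deleteEdges_isLink ..).mp hl
    obtain ⟨c, hcA, hce, hct, hch⟩ := h.exists_arc _ _ _ hl
    have hvis : ∀ z ∈ 𝒟.C l, vis z.val ≠ 0 := fun z hz =>
      (hT.vis_iff z.2).2 (h.connected_iff.1 ((𝒟.connected_s hz hc).symm.trans hc))
    have key : ∀ c, A c → N.link c = code e → vis (N.head c) ≠ 0 →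
        D (N.tail c) ≤ D (N.head c) := by
      intro c hcA hce hv
      by_contra hlt
      have := hT.mem_of_dist_lt h.symm hP hPs hcA hv (not_le.1 hlt)
      exact he ((𝒟.range_bridge e).2 (h.sepBridge_of_mem hcA hce hc this.2))
    have h₁ := key c hcA hce (by rw [hch]; exact hvis w hw')
    obtain ⟨c', hcA', hce', hct', hch'⟩ := h.exists_arc _ _ _ hl.symm
    have h₂ := key c' hcA' hce' (by rw [hch']; exact hvis a ha)
    rw [hct, hch] at h₁
    rw [hct', hch'] at h₂
    exact le_antisymm h₁ h₂

/-- The only arc that leads behind bridge `k` is the forward arc of this bridge. It is on `P`, so it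
has weight `1`, and every shortest walk from `v k` to `t` has to use it. -/
theorem dist_bridge (k : Fin 𝒟.r) : D (𝒟.u k.succ) < D (𝒟.v k.castSucc) := by
  have hc : Connected G s t := h.connected_iff.2 ⟨P, hP⟩
  set S : ℕ → Prop := fun z => ∃ z' : Fin n, z'.val = z ∧ z' ∈ 𝒟.after k
  have hS : ∀ z : Fin n, S z ↔ z ∈ 𝒟.after k := fun z =>
    ⟨fun ⟨z', h₁, h₂⟩ => Fin.ext h₁ ▸ h₂, fun h => ⟨z, rfl, h⟩⟩
  have hv : ¬ S (𝒟.v k.castSucc) := by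
    rw [hS, 𝒟.mem_after_iff (𝒟.v_mem_C _)]; simp
  have hs : ¬ S s := by rw [hS, 𝒟.mem_after_iff 𝒟.s_mem_C]; simp
  have ht : S t := by rw [hS, 𝒟.mem_after_iff 𝒟.t_mem_C]; exact Fin.castSucc_lt_last k
  have enter : ∀ b, A b → ¬ S (N.tail b) → S (N.head b) →
      N.link b = code (𝒟.bridge k) ∧ N.head b = 𝒟.u k.succ := by
    intro b hb h₁ h₂
    obtain ⟨e, p, q, he, hp, hq, hl⟩ := h.exists_link b hb
    rw [hp, hS] at h₁
    rw [hq, hS] at h₂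
    obtain rfl := 𝒟.cutBy_after k e q p hl.symm h₂ h₁
    refine ⟨he, ?_⟩
    rcases hl.eq_and_eq_or_eq_and_eq (𝒟.isLink_bridge k) with ⟨-, rfl⟩ | ⟨rfl, -⟩
    · exact hq
    · exact absurd ((𝒟.mem_after_iff (𝒟.u_mem_C _)).2 Fin.castSucc_lt_succ) h₁
  have hvis : vis (𝒟.v k.castSucc) ≠ 0 := (hT.vis_iff (Fin.is_lt _)).2
    (h.connected_iff.1 ((𝒟.connected_s (𝒟.v_mem_C _) hc).symm.trans hc))
  have hw := hT.walk _ (Fin.is_lt _) hvis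
  have hD := hT.weight _ (Fin.is_lt _) hvis
  obtain ⟨π₁, b, π₂, hπ, hb₁, hb₂⟩ := hw.exists_enter hv ht
  rw [hπ] at hw hD
  obtain ⟨h₁, hb, h₂⟩ := hw.of_append_cons
  obtain ⟨hbl, hbu⟩ := enter b hb hb₁ hb₂
  obtain ⟨P₁, c, P₂, rfl, hc₁, hc₂⟩ := hP.exists_enter hs ht
  have hcA := hP.of_append_cons.2.1
  obtain ⟨hcl, hcu⟩ := enter c hcA hc₁ hc₂
  have hbc : b = c := by
    rcases h.symm.eq_or_eq_rev hcA hb (hcl.trans hbl.symm) with hbc | rfl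
    · exact hbc
    · rw [h.symm.tail_rev hcA] at hb₁
      exact absurd hc₂ hb₁
  subst hbc
  have hle := hT.opt _ (h.arc_lt b hb).2 (hT.vis_of_walk h₂) π₂ h₂
  have h₀ : 0 ≤ (π₁.map fun a => if a ∈ P₁ ++ b :: P₂ then (1 : ℝ) else 0).sum := by
    refine List.sum_nonneg fun x hx => ?_
    obtain ⟨a, -, rfl⟩ := List.mem_map.1 hx
    split_ifs <;> norm_num
  rw [List.map_append, List.map_cons, List.sum_append, List.sum_cons,
    if_pos (by simp)] at hD
  rw [hbu] at hle
  linarith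

/-- The distances order the components. This allows the program to find the extreme components from
the distances of single nodes, without computing bridges or components. -/
theorem dist_lt_iff {i j : Fin (𝒟.r + 1)} (hx : x ∈ 𝒟.C i) (hy : y ∈ 𝒟.C j) :
    D y < D x ↔ i < j := by
  have hanti : StrictAnti fun l => D (𝒟.u l) := by
    refine Fin.strictAnti_iff_succ_lt.2 fun k => ?_
    rw [h.dist_eq_of_mem_C hP hPs hT 𝒟 (𝒟.u_mem_C k.castSucc) (𝒟.v_mem_C k.castSucc)]
    exact h.dist_bridge hP hPs hT 𝒟 k
  rw [h.dist_eq_of_mem_C hP hPs hT 𝒟 hx (𝒟.u_mem_C i),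
    h.dist_eq_of_mem_C hP hPs hT 𝒟 hy (𝒟.u_mem_C j)]
  exact hanti.lt_iff_gt

end Dist

/-- The common links of two paths that are made of the arcs of a path `P` and of a shortest path
`Q`, where only the arcs of `P` have a positive weight. -/
theorem _root_.Survivable.Arcs.SpanningTree.mem_of_common {D : ℕ → ℝ} {vis nxt : ℕ → ℕ}
    {T : ℕ → List ℕ} {s t a c : ℕ} (hN : N.IsSymm A) (hP : N.Walk A s P t)
    (hPs : N.Simple s P)
    (hT : N.SpanningTree A (fun a => if a ∈ P then 1 else 0) n t vis D nxt T) (hs : s < n)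
    (hv : vis s ≠ 0)
    (ha : a ∈ P ∧ N.rev a ∉ T s ∨ a ∈ T s ∧ N.rev a ∉ P)
    (hc : c ∈ P ∧ N.rev c ∉ T s ∨ c ∈ T s ∧ N.rev c ∉ P) (hca : c = a → a ∈ P ∧ a ∈ T s)
    (hl : N.link a = N.link c) : ∀ ρ, N.Walk A s ρ t → a ∈ ρ := by
  obtain ⟨haP, haQ⟩ := hca (Arcs.mem_of_link_eq hN hP hPs (hT.walk s hs hv) (hT.simple s hs hv)
    ha hc hl)
  refine (hT.mem_of_dist_lt hN hP hPs (hP.mem haP) (hT.vis_head s hs hv a haQ) ?_).2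
  have := hT.tight hs hv haQ
  rw [if_pos haP] at this
  linarith

/-- The detour case of the algorithm refers to some tunable pair of `G₂`, while the program computes
only the final pair; existence supplies the missing one. The construction by `P`, a shortest `Q`, a
path in their union and a path in the remainder is the one that the program follows. -/
theorem exists_tunablePair (h : Represents N A G code) (hfin : {a | A a}.Finite)
    (hc : Connected G s t) : ∃ p b, TunablePair G s t p b := by
  classical
  obtain ⟨es, hes⟩ := hc.exists_isPath
  obtain ⟨P, hP, hPs, -⟩ := h.walk_of_isPath hes
  have reach : ∀ A' : ℕ → Prop, (∀ a, A' a → A a) →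
      (∀ S : ℕ → Prop, ¬ S s → S t → ∃ a, A' a ∧ ¬ S (N.tail a) ∧ S (N.head a)) →
      ∃ π, N.Walk A' s π t ∧ N.Simple s π := by
    intro A' hA' hS
    obtain ⟨vis, D, nxt, T, hT⟩ := Arcs.exists_spanningTree (W := fun _ => 0) t.2
      (fun a ha => h.arc_lt a (hA' a ha)) (hfin.subset hA') fun _ _ => le_rfl
    have hs : vis s ≠ 0 := by
      by_contra hs
      obtain ⟨a, ha, h₁, h₂⟩ := hS (fun v => vis v ≠ 0) (not_not.2 hs) (by simp [hT.vis_root])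
      exact h₁ (hT.closed a ha h₂)
    exact ⟨T s, hT.walk s s.2 hs, hT.simple s s.2 hs⟩
  obtain ⟨vis, D, nxt, T, hT⟩ := Arcs.exists_spanningTree
    (W := fun a => if a ∈ P then 1 else 0) t.2 h.arc_lt hfin
    (fun a _ => by split_ifs <;> norm_num)
  have hs := hT.vis_of_walk hP
  have hQ := hT.walk s s.2 hs
  have hQs := hT.simple s s.2 hs
  -- There is no fictitious link here, so all arcs count as real, whence `True`.
  set A₃ : ℕ → Prop := fun a => a ∈ P ∧ N.rev a ∉ T s ∨ a ∈ T s ∧ N.rev a ∉ P ∧ True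
  have hA₃ : ∀ a, A₃ a → A a := fun a ha => ha.elim (fun h => hP.mem h.1) fun h => hQ.mem h.1
  obtain ⟨P', hP', hPs'⟩ := reach A₃ hA₃ fun S h₁ h₂ =>
    Arcs.exists_enter_union h.symm hP hPs hQ hQs (by simp) h₁ h₂
  have hsub : ∀ a ∈ P', a ∈ P ∧ N.rev a ∉ T s ∨ a ∈ T s ∧ N.rev a ∉ P := fun a ha => by
    simpa only [A₃, and_true] using hP'.mem ha
  have hP'A := hP'.mono fun a _ => hA₃ a
  obtain ⟨B', hB', hBs'⟩ := reach
    (fun a => (a ∈ P ∧ N.rev a ∉ T s ∨ a ∈ T s ∧ N.rev a ∉ P) ∧ (a ∈ P' → a ∈ P ∧ a ∈ T s))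
    (fun a ha => hA₃ a (by simpa only [A₃, and_true] using ha.1)) fun S h₁ h₂ => by
      simpa only [and_assoc] using Arcs.exists_enter_remainder h.symm hP hPs hQ hQs hP'A hPs' hsub
        h₁ h₂
  obtain ⟨p, hp, hpp⟩ := h.isPath_of_walk hP'A hPs'
  obtain ⟨b, hb, hbp⟩ := h.isPath_of_walk (hB'.mono fun a _ ha =>
    hA₃ a (by simpa only [A₃, and_true] using ha.1)) hBs'
  refine ⟨p, b, h.tunablePair (B' := B') hpp hbp hp (fun e he => ?_) (fun a ha => hP'A.mem ha)
    fun a ha c hc hac => ?_⟩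
  · exact List.mem_map.1 (hb ▸ List.mem_map_of_mem he)
  · exact hT.mem_of_common h.symm hP hPs s.2 hs (hsub a ha) (hB'.mem hc).1
      (fun hca => (hB'.mem hc).2 (hca ▸ ha) |> fun h => hca ▸ h) hac

end Represents


/-! ### Paths through the fictitious link as outcomes of the detour step -/

section Detour

variable {α β : Type*} {G : Graph α β} {s t x y z u v w : α} {e : β} {es p b : List β}
  {vs : List α}

theorem exists_map_some_of_notMem : ∀ {l : List (Option β)}, none ∉ l → ∃ l' : List β, l = l'.map some
  | [], _ => ⟨[], rfl⟩
  | none :: l, h => absurd List.mem_cons_self h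
  | some e :: l, h =>
    let ⟨l', h'⟩ := exists_map_some_of_notMem fun hl => h (List.mem_cons_of_mem _ hl)
    ⟨e :: l', by rw [h', List.map_cons]⟩

theorem IsWalk.addFictitious (h : IsWalk G u es v vs) (x y : α) :
    IsWalk (Survivable.addFictitious G x y) u (es.map some) v vs :=
  h.map (fun _ h => Or.inl h) fun _ _ _ _ h => h

theorem Connected.addFictitious (h : Connected (G.deleteEdges {e}) u v) (x y : α) :
    Connected ((Survivable.addFictitious G x y).deleteEdges {some e}) u v := by
  obtain ⟨es, vs, h⟩ := h
  obtain ⟨h, he⟩ := h.of_deleteEdges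
  refine ⟨_, vs, (h.addFictitious x y).deleteEdges fun f hf hfe => ?_⟩
  obtain ⟨f', hf', rfl⟩ := List.mem_map.1 hf
  exact he f' hf' (Option.some_injective _ hfe)

theorem IsWalk.nodup_of_append₂ {a c : List β} {va vc : List α} (ha : IsWalk G x a y va)
    (hc : IsWalk G y c z vc) (hn : (va ++ vc.tail).Nodup) : va.Nodup ∧ vc.Nodup := by
  have := ha.nodup_of_append hc (.nil hc.end_mem_vertexSet) (by simpa using hn)
  exact ⟨this.1, this.2.1⟩

theorem IsWalk.mem_of_mem_right {a c : List β} {va vc : List α} (ha : IsWalk G x a y va)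
    (hc : IsWalk G y c z vc) (h : w ∈ vc) : w ∈ va ++ vc.tail := by
  obtain ⟨ws, rfl⟩ := hc.eq_cons
  rcases List.mem_cons.1 h with rfl | h
  · exact List.mem_append_left _ ha.end_mem
  · exact List.mem_append_right _ h

end Detour

namespace Instance

variable {n m : ℕ} {I : Instance n m}

theorem walkFromTo_of_isWalk_G₂ {x y : Fin n} {es : List (Fin m)} {vs : List (Fin n)}
    (h : IsWalk I.G₂ x es y vs) : WalkFromTo I.G x es y := ⟨vs, h.of_deleteEdges.1⟩

/-- A pair of paths in `G₂` with the fictitious link whose common links separate the terminals gives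
a result of the algorithm. -/
theorem sca_detour (hc : Connected I.G₂ I.s₂ I.t₂) (D : DecompositionD1 I.G₂ I.s₂ I.t₂)
    {i j : Fin (D.r + 1)} {x y : Fin n} (hE : I.Extremal D i j x y) (hij : i ≠ j)
    {P g b₂ p₀ b₀ : List (Fin m)} {B : List (Option (Fin m))} (hP : IsPath I.G₂ I.s₂ P I.t₂)
    (hB : IsPath (addFictitious I.G₂ x y) I.s₂ B I.t₂)
    (hcom : ∀ e ∈ P, some e ∈ B →
      ¬ Connected ((addFictitious I.G₂ x y).deleteEdges {some e}) I.s₂ I.t₂)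
    (hg : I.SegmentOfB₁ x y g) (hb₂ : IsPath I.G I.s₂ b₂ I.t₂)
    (hsub : ∀ e ∈ b₂, some e ∈ B ∨ e ∈ g) (hT : TunablePair I.G₂ I.s₂ I.t₂ p₀ b₀) :
    I.SCA (some (P, b₂)) := by
  have hle : i ≤ j := (hE.1 j hE.touches.2).1
  have hlt : i < j := lt_of_le_of_ne hle hij
  have hxC := hE.2.1
  have hyC := hE.2.2.2.1
  set H := addFictitious I.G₂ x y with hH
  -- bridge links between the two components do not separate the terminals any more
  have hjoin : ∀ k : Fin D.r, i ≤ k.castSucc → k.castSucc < j →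
      Connected (H.deleteEdges {some (D.bridge k)}) I.s₂ I.t₂ := by
    intro k hk hk'
    have h₁ : Connected (I.G₂.deleteEdges {D.bridge k}) I.s₂ x :=
      D.connected_of_same_side D.s_mem_C hxC (by simp [hk])
    have h₂ : Connected (I.G₂.deleteEdges {D.bridge k}) y I.t₂ :=
      D.connected_of_same_side hyC D.t_mem_C (by simp [hk', Fin.castSucc_lt_last])
    refine (h₁.addFictitious x y).trans (Connected.trans (Connected.of_isLink (e := none) ?_)
      (h₂.addFictitious x y))
    rw [Graph.deleteEdges_isLink]
    exact ⟨Or.inl ⟨rfl, rfl⟩, by simp⟩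
  have hsep : ∀ e ∈ P, some e ∈ B → SepBridge I.G₂ I.s₂ I.t₂ e := by
    intro e he heB
    obtain ⟨vs, hw, -⟩ := hP
    obtain ⟨p, q, hl, -⟩ := hw.exists_isLink he
    exact ⟨hl.edge_mem, hc, fun h => hcom e he heB (h.addFictitious x y)⟩
  have hside : ∀ k : Fin D.r, D.bridge k ∈ P → some (D.bridge k) ∈ B →
      (k.castSucc < i ↔ k.castSucc < j) := by
    intro k hk hkB
    have := fun h₁ h₂ => hcom _ hk hkB (hjoin k h₁ h₂)
    constructor
    · exact fun h => h.trans hlt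
    · intro h; by_contra h'; exact this (not_lt.1 h') h
  -- As `i < j`, the component `C i` is not the last one, and some bridge `k₀` leaves it.
  obtain ⟨k₀, rfl⟩ : ∃ k₀ : Fin D.r, i = k₀.castSucc :=
    (Fin.eq_castSucc_or_eq_last i).resolve_right (hlt.trans_le (Fin.le_last j)).ne
  have hk₀P : D.bridge k₀ ∈ P := (D.sepBridge k₀).mem hP.walkFromTo
  -- Without the fictitious link `B` would be a path in `G₂` and share the bridge `k₀` with `P`,
  -- although this bridge does not separate once the fictitious link is present.
  have hnone : none ∈ B := by
    by_contra hnone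
    obtain ⟨B', rfl⟩ := exists_map_some_of_notMem hnone
    obtain ⟨vs, hw, -⟩ := hB
    have := (D.sepBridge k₀).mem
      ⟨vs, isWalk_of_addFictitious (Set.mem_univ x) (Set.mem_univ y) hw⟩
    have := hside k₀ hk₀P (List.mem_map_of_mem this)
    simp [hlt] at this
  obtain ⟨B₁, B₂, rfl⟩ := List.append_of_mem hnone
  have hBn := hB.nodup_links
  have hB₁ : none ∉ B₁ := fun h => (List.nodup_append.1 hBn).2.2 _ h _ List.mem_cons_self rfl
  have hB₂ : none ∉ B₂ := (List.nodup_cons.1 (List.nodup_append.1 hBn).2.1).1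
  obtain ⟨b₁, rfl⟩ := exists_map_some_of_notMem hB₁
  obtain ⟨b₂', rfl⟩ := exists_map_some_of_notMem hB₂
  obtain ⟨vs, hw, hvs⟩ := hB
  obtain ⟨z, vs₁, vs₂, hw₁, hw₂, rfl⟩ := hw.exists_of_append
  replace hw₁ := isWalk_of_addFictitious (Set.mem_univ x) (Set.mem_univ y) hw₁
  cases hw₂ with
  | @cons _ z' _ _ _ vs₂ hl hw₂ =>
  replace hw₂ := isWalk_of_addFictitious (Set.mem_univ x) (Set.mem_univ y) hw₂
  have hb₁n : b₁.Nodup := (List.nodup_append.1 hBn).1.of_map _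
  have hb₂n : b₂'.Nodup := (List.nodup_cons.1 (List.nodup_append.1 hBn).2.1).2.of_map _
  -- the fictitious link is traversed from `x` to `y`
  have hxy : z = x ∧ z' = y := by
    rcases hl with h | ⟨rfl, rfl⟩
    · exact h
    · exfalso
      have h₁ := hw₁.mem_of_cutBy (D.cutBy_after k₀)
        (by rw [D.mem_after_iff D.s_mem_C]; simp) (by rw [D.mem_after_iff hyC]; exact hlt)
      have h₂ := hw₂.mem_of_cutBy (D.cutBy_after k₀)
        (by rw [D.mem_after_iff hxC]; simp)
        (by rw [D.mem_after_iff D.t_mem_C]; exact Fin.castSucc_lt_last k₀)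
      exact (List.nodup_append.1 hBn).2.2 _ (List.mem_map_of_mem h₁) _
        (List.mem_cons_of_mem _ (List.mem_map_of_mem h₂)) rfl
  obtain ⟨rfl, rfl⟩ := hxy
  rw [List.tail_cons] at hvs
  obtain ⟨hvs₁, hvs₂, hvd⟩ := List.nodup_append.1 hvs
  -- the parts of the two paths
  obtain ⟨a', d₁, va', v₁, rfl, ha', hd₁, rfl⟩ :=
    hw₁.exists_of_mem (D.u_mem_of_walk hw₁ hxC le_rfl)
  obtain ⟨d₂, d', v₂, vd', rfl, hd₂, hd', rfl⟩ :=
    hw₂.exists_of_mem (D.v_mem_of_walk hw₂ hyC le_rfl)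
  obtain ⟨hva', hv₁⟩ := ha'.nodup_of_append₂ hd₁ hvs₁
  obtain ⟨hv₂, hvd'⟩ := hd₂.nodup_of_append₂ hd' hvs₂
  have hvad : va'.Disjoint vd'.tail := fun c h₁ h₂ =>
    hvd c (List.mem_append_left _ h₁) c (List.mem_append_right _ h₂) rfl
  obtain ⟨vP, hPw, hPn⟩ := id hP
  obtain ⟨a, ρ, va, vρ, rfl, ha, hρ, rfl⟩ :=
    hPw.exists_of_mem (D.u_mem_of_walk hPw D.t_mem_C (Fin.le_last k₀.castSucc))
  obtain ⟨pa, d, vpa, vd, rfl, hpa, hd, rfl⟩ :=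
    hρ.exists_of_mem (D.v_mem_of_walk hρ (D.u_mem_C _) hle)
  rw [List.tail_append_of_ne_nil (List.ne_nil_of_mem hpa.start_mem), ← List.append_assoc] at hPn
  obtain ⟨hva, hvpa, hvd₀, hvad₀⟩ := ha.nodup_of_append hpa hd hPn
  have hpan := hpa.nodup_links hvpa
  -- a tunable pair that starts and ends like the two paths
  obtain ⟨hp₀, hb₀, hcom₀⟩ := hT
  obtain ⟨vp₀, hp₀w, hp₀n⟩ := hp₀
  obtain ⟨a₀, ρ₀, va₀, vρ₀, rfl, ha₀, hρ₀, rfl⟩ :=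
    hp₀w.exists_of_mem (D.u_mem_of_walk hp₀w D.t_mem_C (Fin.le_last k₀.castSucc))
  obtain ⟨c₀, d₀, vc₀, vd₀, rfl, hc₀, hd₀, rfl⟩ :=
    hρ₀.exists_of_mem (D.v_mem_of_walk hρ₀ (D.u_mem_C _) hle)
  rw [List.tail_append_of_ne_nil (List.ne_nil_of_mem hc₀.start_mem), ← List.append_assoc] at hp₀n
  have hvc₀ := (ha₀.nodup_of_append hc₀ hd₀ hp₀n).2.1
  obtain ⟨vb₀, hb₀w, hb₀n⟩ := hb₀
  obtain ⟨a₀', ρ₀', va₀', vρ₀', rfl, ha₀', hρ₀', rfl⟩ :=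
    hb₀w.exists_of_mem (D.u_mem_of_walk hb₀w D.t_mem_C (Fin.le_last k₀.castSucc))
  obtain ⟨c₀', d₀', vc₀', vd₀', rfl, hc₀', hd₀', rfl⟩ :=
    hρ₀'.exists_of_mem (D.v_mem_of_walk hρ₀' (D.u_mem_C _) hle)
  rw [List.tail_append_of_ne_nil (List.ne_nil_of_mem hc₀'.start_mem), ← List.append_assoc]
    at hb₀n
  have hvc₀' := (ha₀'.nodup_of_append hc₀' hd₀' hb₀n).2.1
  have hp := DecompositionD1.isPath_splice hle ha hva hd hvd₀ hvad₀ hc₀ hvc₀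
  have hb := DecompositionD1.isPath_splice hle ha' hva' hd' hvd' hvad hc₀' hvc₀'
  -- The outer parts of `P` and of `B` are completed by the middle parts of the given tunable pair.
  -- Common links of two outer parts separate by `hsep`, those of two middle parts because the given
  -- pair is tunable, and mixed ones do not exist by the cuts.
  have hT : TunablePair I.G₂ I.s₂ I.t₂ (a ++ c₀ ++ d) (a' ++ c₀' ++ d') := by
    refine ⟨hp, hb, fun e => ⟨fun ⟨h₁, h₂⟩ => ?_,
      fun h => ⟨h.mem hp.walkFromTo, h.mem hb.walkFromTo⟩⟩⟩
    have hn₀ := hc₀.nodup_links hvc₀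
    have hn₀' := hc₀'.nodup_links hvc₀'
    have outer : (e ∈ a ∨ e ∈ d) → (e ∈ a' ∨ e ∈ d') → SepBridge I.G₂ I.s₂ I.t₂ e := by
      intro h₁ h₂
      refine hsep e ?_ ?_
      · rcases h₁ with h | h <;> simp [h]
      · rcases h₂ with h | h <;> simp [h]
    have no₁ : ∀ {f}, f ∈ a → f ∉ c₀' := fun h => DecompositionD1.prefix_disjoint ha hva hc₀' hn₀' (D.v_mem_C j) hle h
    have no₂ : ∀ {f}, f ∈ d → f ∉ c₀' := fun h => DecompositionD1.suffix_disjoint hd hvd₀ hc₀' hn₀' (D.u_mem_C _) hle h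
    have no₃ : ∀ {f}, f ∈ a' → f ∉ c₀ := fun h => DecompositionD1.prefix_disjoint ha' hva' hc₀ hn₀ (D.v_mem_C j) hle h
    have no₄ : ∀ {f}, f ∈ d' → f ∉ c₀ := fun h => DecompositionD1.suffix_disjoint hd' hvd' hc₀ hn₀ (D.u_mem_C _) hle h
    have inner : e ∈ c₀ → e ∈ c₀' → SepBridge I.G₂ I.s₂ I.t₂ e := fun h₁ h₂ =>
      (hcom₀ e).1 ⟨by simp [h₁], by simp [h₂]⟩
    rcases List.mem_append.1 h₁ with h₁ | h₁
    · rcases List.mem_append.1 h₁ with h₁ | h₁ <;> rcases List.mem_append.1 h₂ with h₂ | h₂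
      · rcases List.mem_append.1 h₂ with h₂ | h₂
        exacts [outer (.inl h₁) (.inl h₂), absurd h₂ (no₁ h₁)]
      · exact outer (.inl h₁) (.inr h₂)
      · rcases List.mem_append.1 h₂ with h₂ | h₂
        exacts [absurd h₁ (no₃ h₂), inner h₁ h₂]
      · exact absurd h₁ (no₄ h₂)
    · rcases List.mem_append.1 h₂ with h₂ | h₂
      · rcases List.mem_append.1 h₂ with h₂ | h₂
        exacts [outer (.inr h₁) (.inl h₂), absurd h₂ (no₂ h₁)]
      · exact outer (.inr h₁) (.inr h₂)
  have main := SCA.detour (pa := pa) (d₁ := d₁) (d₂ := d₂) (b₂ := b₂) D hc hE hij hT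
    ⟨_, hpa.addFictitious z z', hvpa⟩ ?_ ⟨_, hd₁⟩ ⟨_, hd₂⟩ ?_
    ⟨rfl, walkFromTo_of_isWalk_G₂ ha, walkFromTo_of_isWalk_G₂ hc₀, walkFromTo_of_isWalk_G₂ hd⟩
    ⟨rfl, walkFromTo_of_isWalk_G₂ ha', walkFromTo_of_isWalk_G₂ hc₀', walkFromTo_of_isWalk_G₂ hd'⟩
    hg hb₂ ?_
  · rwa [List.append_assoc] at main
  · refine ⟨_, (hd₁.addFictitious z z').append (.cons hl (hd₂.addFictitious z z')), ?_⟩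
    rw [List.tail_cons, List.nodup_append]
    exact ⟨hv₁, hv₂, fun c h₁ c' h₂ => hvd c (ha'.mem_of_mem_right hd₁ h₁) c'
      (List.mem_append_left _ h₂)⟩
  -- A common link of `pa` and the detour would be a separating bridge with `C i` and `C j` on the
  -- same side, and a path from `u i` to `v j` does not use such a bridge.
  · intro e he he'
    have heP : e ∈ a ++ (pa ++ d) := by simp [he]
    have heB : some e ∈ (a' ++ d₁).map some ++ none :: (d₂ ++ d').map some := by
      rcases List.mem_append.1 he' with h | h <;> simp [h]
    obtain ⟨k, rfl⟩ := (D.range_bridge e).2 (hsep e heP heB)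
    exact D.bridge_notMem hpa hpan (D.u_mem_C _) (D.v_mem_C j) (hside k heP heB) he
  · intro e he
    rcases hsub e he with h | h
    · have h' : e ∈ (a' ++ d₁) ++ (d₂ ++ d') := by
        rcases List.mem_append.1 h with h | h
        · exact List.mem_append_left _
            ((List.mem_map_of_injective (Option.some_injective _)).1 h)
        · exact List.mem_append_right _ ((List.mem_map_of_injective (Option.some_injective _)).1
            ((List.mem_cons.1 h).resolve_left (by simp)))
      rcases List.mem_append.1 h' with h | h <;> rcases List.mem_append.1 h with h | h <;> simp [h]
    · simp [h]

end Instance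


/-! ### Reasoning about programs -/

section ExecLemmas

variable (σ : State) (x y z a i k r : ℕ)

@[simp] theorem exec_skip : Instr.skip.exec σ = σ := rfl

@[simp] theorem reg_const : ((Instr.const x k).exec σ).reg r = if r = x then k else σ.reg r := by
  simp [Instr.exec, Function.update_apply]
@[simp] theorem arr_const : ((Instr.const x k).exec σ).arr = σ.arr := rfl
@[simp] theorem wreg_const : ((Instr.const x k).exec σ).wreg = σ.wreg := rfl
@[simp] theorem warr_const : ((Instr.const x k).exec σ).warr = σ.warr := rfl

@[simp] theorem reg_copy : ((Instr.copy x y).exec σ).reg r =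
    if r = x then σ.reg y else σ.reg r := by
  simp [Instr.exec, Function.update_apply]
@[simp] theorem arr_copy : ((Instr.copy x y).exec σ).arr = σ.arr := rfl
@[simp] theorem wreg_copy : ((Instr.copy x y).exec σ).wreg = σ.wreg := rfl
@[simp] theorem warr_copy : ((Instr.copy x y).exec σ).warr = σ.warr := rfl

@[simp] theorem reg_inc : ((Instr.inc x).exec σ).reg r =
    if r = x then σ.reg x + 1 else σ.reg r := by
  simp [Instr.exec, Function.update_apply]
@[simp] theorem arr_inc : ((Instr.inc x).exec σ).arr = σ.arr := rfl
@[simp] theorem wreg_inc : ((Instr.inc x).exec σ).wreg = σ.wreg := rfl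
@[simp] theorem warr_inc : ((Instr.inc x).exec σ).warr = σ.warr := rfl

@[simp] theorem reg_load : ((Instr.load x a i).exec σ).reg r =
    if r = x then σ.arr a (σ.reg i) else σ.reg r := by
  simp [Instr.exec, Function.update_apply]
@[simp] theorem arr_load : ((Instr.load x a i).exec σ).arr = σ.arr := rfl
@[simp] theorem wreg_load : ((Instr.load x a i).exec σ).wreg = σ.wreg := rfl
@[simp] theorem warr_load : ((Instr.load x a i).exec σ).warr = σ.warr := rfl

@[simp] theorem reg_store : ((Instr.store a i x).exec σ).reg = σ.reg := rfl
@[simp] theorem arr_store : ((Instr.store a i x).exec σ).arr r =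
    if r = a then Function.update (σ.arr a) (σ.reg i) (σ.reg x) else σ.arr r := by
  simp [Instr.exec, Function.update_apply]
@[simp] theorem wreg_store : ((Instr.store a i x).exec σ).wreg = σ.wreg := rfl
@[simp] theorem warr_store : ((Instr.store a i x).exec σ).warr = σ.warr := rfl

@[simp] theorem reg_wzero : ((Instr.wzero x).exec σ).reg = σ.reg := rfl
@[simp] theorem arr_wzero : ((Instr.wzero x).exec σ).arr = σ.arr := rfl
@[simp] theorem wreg_wzero : ((Instr.wzero x).exec σ).wreg r =
    if r = x then 0 else σ.wreg r := by
  simp [Instr.exec, Function.update_apply]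
@[simp] theorem warr_wzero : ((Instr.wzero x).exec σ).warr = σ.warr := rfl

@[simp] theorem reg_wcopy : ((Instr.wcopy x y).exec σ).reg = σ.reg := rfl
@[simp] theorem arr_wcopy : ((Instr.wcopy x y).exec σ).arr = σ.arr := rfl
@[simp] theorem wreg_wcopy : ((Instr.wcopy x y).exec σ).wreg r =
    if r = x then σ.wreg y else σ.wreg r := by
  simp [Instr.exec, Function.update_apply]
@[simp] theorem warr_wcopy : ((Instr.wcopy x y).exec σ).warr = σ.warr := rfl

@[simp] theorem reg_wadd : ((Instr.wadd x y z).exec σ).reg = σ.reg := rfl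
@[simp] theorem arr_wadd : ((Instr.wadd x y z).exec σ).arr = σ.arr := rfl
@[simp] theorem wreg_wadd : ((Instr.wadd x y z).exec σ).wreg r =
    if r = x then σ.wreg y + σ.wreg z else σ.wreg r := by
  simp [Instr.exec, Function.update_apply]
@[simp] theorem warr_wadd : ((Instr.wadd x y z).exec σ).warr = σ.warr := rfl

@[simp] theorem reg_wload : ((Instr.wload x a i).exec σ).reg = σ.reg := rfl
@[simp] theorem arr_wload : ((Instr.wload x a i).exec σ).arr = σ.arr := rfl
@[simp] theorem wreg_wload : ((Instr.wload x a i).exec σ).wreg r =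
    if r = x then σ.warr a (σ.reg i) else σ.wreg r := by
  simp [Instr.exec, Function.update_apply]
@[simp] theorem warr_wload : ((Instr.wload x a i).exec σ).warr = σ.warr := rfl

@[simp] theorem reg_wstore : ((Instr.wstore a i x).exec σ).reg = σ.reg := rfl
@[simp] theorem arr_wstore : ((Instr.wstore a i x).exec σ).arr = σ.arr := rfl
@[simp] theorem wreg_wstore : ((Instr.wstore a i x).exec σ).wreg = σ.wreg := rfl
@[simp] theorem warr_wstore : ((Instr.wstore a i x).exec σ).warr r =
    if r = a then Function.update (σ.warr a) (σ.reg i) (σ.wreg x) else σ.warr r := by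
  simp [Instr.exec, Function.update_apply]

end ExecLemmas

/-! #### What a program leaves unchanged -/

/-- The instruction may write register `r`. -/
def Instr.writesReg (r : ℕ) : Instr → Bool
  | const x _ | copy x _ | inc x | dec x | load x _ _ => r == x
  | _ => false

/-- The instruction may write array `r`. -/
def Instr.writesArr (r : ℕ) : Instr → Bool
  | store a _ _ => r == a
  | _ => false

/-- The instruction may write weight register `r`. -/
def Instr.writesWReg (r : ℕ) : Instr → Bool
  | wzero x | wcopy x _ | wadd x _ _ | wload x _ _ => r == x
  | _ => false

/-- The instruction may write weight array `r`. -/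
def Instr.writesWArr (r : ℕ) : Instr → Bool
  | wstore a _ _ => r == a
  | _ => false

/-- Some instruction of the program has the property `f`. -/
def Program.any (f : Instr → Bool) : Program → Bool
  | instr c => f c
  | seq P Q => any f P || any f Q
  | ite _ P Q => any f P || any f Q
  | .while _ P => any f P

/-- Two memories agree on all that the program `P` does not write. -/
structure Frame (P : Program) (σ τ : State) : Prop where
  reg : ∀ r, P.any (Instr.writesReg r) = false → τ.reg r = σ.reg r
  arr : ∀ r, P.any (Instr.writesArr r) = false → τ.arr r = σ.arr r
  wreg : ∀ r, P.any (Instr.writesWReg r) = false → τ.wreg r = σ.wreg r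
  warr : ∀ r, P.any (Instr.writesWArr r) = false → τ.warr r = σ.warr r

variable {P Q R : Program} {σ τ υ : State} {k l m : ℕ} {b : Test}

theorem Frame.refl (P : Program) (σ : State) : Frame P σ σ :=
  ⟨fun _ _ => rfl, fun _ _ => rfl, fun _ _ => rfl, fun _ _ => rfl⟩

theorem Frame.trans (h : Frame P σ τ) (h' : Frame P τ υ) : Frame P σ υ :=
  ⟨fun r hr => (h'.reg r hr).trans (h.reg r hr), fun r hr => (h'.arr r hr).trans (h.arr r hr),
    fun r hr => (h'.wreg r hr).trans (h.wreg r hr), fun r hr => (h'.warr r hr).trans (h.warr r hr)⟩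

theorem Frame.mono (h : Frame P σ τ) (hPQ : ∀ f, Q.any f = false → P.any f = false) :
    Frame Q σ τ :=
  ⟨fun r hr => h.reg r (hPQ _ hr), fun r hr => h.arr r (hPQ _ hr),
    fun r hr => h.wreg r (hPQ _ hr), fun r hr => h.warr r (hPQ _ hr)⟩

theorem Frame.exec (c : Instr) (σ : State) : Frame (.instr c) σ (c.exec σ) := by
  refine ⟨fun r hr => ?_, fun r hr => ?_, fun r hr => ?_, fun r hr => ?_⟩ <;>
  · have hr' : (_ : Bool) = false := hr
    cases c <;>
      simp_all [Instr.writesReg, Instr.writesArr, Instr.writesWReg, Instr.writesWArr,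
        Program.any, Instr.exec]

theorem Frame.left (h : Frame P σ τ) (Q : Program) : Frame (.seq P Q) σ τ :=
  h.mono fun f hf => (by simpa [Program.any] using hf : _ ∧ _).1

theorem Frame.right (h : Frame Q σ τ) (P : Program) : Frame (.seq P Q) σ τ :=
  h.mono fun f hf => (by simpa [Program.any] using hf : _ ∧ _).2

/-- What a program may write can be read off its text. For a concrete program the side conditions
are settled by evaluation, so that invariants mention only what changes. -/
theorem Exec.frame (h : Exec P σ k τ) : Frame P σ τ := by
  induction h with
  | instr c σ => exact Frame.exec c σ
  | seq _ _ ih₁ ih₂ => exact (ih₁.left _).trans (ih₂.right _)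
  | iteTrue _ _ ih => exact ih.mono fun f hf => (by simpa [Program.any] using hf : _ ∧ _).1
  | iteFalse _ _ ih => exact ih.mono fun f hf => (by simpa [Program.any] using hf : _ ∧ _).2
  | whileFalse _ => exact Frame.refl _ _
  | whileTrue _ _ _ ih₁ ih₂ => exact Frame.trans (ih₁.mono fun f hf => hf) ih₂

/-! #### Running times and results -/

/-- Started in `σ`, the program `P` halts after at most `k` steps in a state with the property
`Q`. -/
def Runs (P : Program) (k : ℕ) (σ : State) (Q : State → Prop) : Prop :=
  ∃ l τ, Exec P σ l τ ∧ l ≤ k ∧ Q τ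

theorem Runs.mono {Q Q' : State → Prop} (h : Runs P k σ Q) (hkl : k ≤ l)
    (hQ : ∀ τ, Frame P σ τ → Q τ → Q' τ) : Runs P l σ Q' :=
  let ⟨j, τ, he, hj, hτ⟩ := h
  ⟨j, τ, he, hj.trans hkl, hQ τ he.frame hτ⟩

theorem Runs.seq {P R : Program} {Q Q' : State → Prop} (h : Runs P k σ Q')
    (h' : ∀ τ, Frame P σ τ → Q' τ → Runs R l τ Q) (hm : k + l ≤ m) : Runs (.seq P R) m σ Q := by
  obtain ⟨i, τ, he, hi, hτ⟩ := h
  obtain ⟨j, υ, he', hj, hυ⟩ := h' τ he.frame hτ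
  exact ⟨i + j, υ, .seq he he', by omega, hυ⟩

theorem Runs.ite {Q : State → Prop} (h₁ : b.Holds σ → Runs P k σ Q)
    (h₂ : ¬ b.Holds σ → Runs R k σ Q) (hm : k + 1 ≤ m) : Runs (.ite b P R) m σ Q := by
  by_cases hb : b.Holds σ
  · obtain ⟨i, τ, he, hi, hτ⟩ := h₁ hb
    exact ⟨i + 1, τ, .iteTrue hb he, by omega, hτ⟩
  · obtain ⟨i, τ, he, hi, hτ⟩ := h₂ hb
    exact ⟨i + 1, τ, .iteFalse hb he, by omega, hτ⟩

/-- The program has no loops. -/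
def Program.LoopFree : Program → Bool
  | instr _ => true
  | seq P Q => LoopFree P && LoopFree Q
  | ite _ P Q => LoopFree P && LoopFree Q
  | .while _ _ => false

/-- The number of instructions and tests of a program. -/
def Program.size : Program → ℕ
  | instr _ => 1
  | seq P Q => size P + size Q
  | ite _ P Q => size P + size Q + 1
  | .while _ P => size P + 1

open Classical in
/-- The effect of a program without loops. -/
noncomputable def Program.run : Program → State → State
  | instr c, σ => c.exec σ
  | seq P Q, σ => run Q (run P σ)
  | ite b P Q, σ => if b.Holds σ then run P σ else run Q σ
  | .while _ _, σ => σ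

theorem Program.runs_run (P : Program) (h : P.LoopFree = true) (σ : State) :
    Runs P P.size σ (· = P.run σ) := by
  induction P generalizing σ with
  | instr c => exact ⟨1, _, .instr c σ, le_rfl, rfl⟩
  | seq P Q ihP ihQ =>
    simp only [LoopFree, Bool.and_eq_true] at h
    exact (ihP h.1 σ).seq (fun τ _ hτ => hτ ▸ ihQ h.2 _) le_rfl
  | ite b P Q ihP ihQ =>
    simp only [LoopFree, Bool.and_eq_true] at h
    refine Runs.ite (k := P.size + Q.size) (fun hb => ?_) (fun hb => ?_) le_rfl
    · exact (ihP h.1 σ).mono (by omega) fun τ _ hτ => by rw [hτ, run, if_pos hb]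
    · exact (ihQ h.2 σ).mono (by omega) fun τ _ hτ => by rw [hτ, run, if_neg hb]
  | _ => simp [LoopFree] at h

theorem Runs.of_run {Q : State → Prop} (h : P.LoopFree = true) (hQ : Q (P.run σ))
    (hk : P.size ≤ k) : Runs P k σ Q :=
  (P.runs_run h σ).mono hk fun _ _ hτ => hτ ▸ hQ

/-- A list of instructions. -/
def block : List Instr → Program
  | [] => .instr .skip
  | c :: cs => .seq (.instr c) (block cs)

/-- The loop `for i = 0, …, N - 1 do P`. -/
def forLoop (i N : ℕ) (P : Program) : Program :=
  .seq (.instr (.const i 0)) (.while (.lt i N) (.seq P (.instr (.inc i))))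

/-- Each round costs `c` steps plus the test and the increment; the initialization and the last,
failing test account for the final `2`. The invariant refers to the state after the increment, and
the frame makes everything outside of the loop's writes available to each round. -/
theorem Runs.forLoop {i N c n : ℕ} {Inv : ℕ → State → Prop}
    (hi : P.any (Instr.writesReg i) = false) (hN : P.any (Instr.writesReg N) = false)
    (hiN : i ≠ N) (hn : σ.reg N = n) (h0 : Inv 0 ((Instr.const i 0).exec σ))
    (hstep : ∀ j < n, ∀ τ, Frame (Survivable.forLoop i N P) σ τ → τ.reg i = j → Inv j τ →
      Runs P c τ fun υ => Inv (j + 1) ((Instr.inc i).exec υ)) :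
    Runs (Survivable.forLoop i N P) (n * (c + 2) + 2) σ (Inv n) := by
  have key : ∀ d j τ, j + d = n → Frame (Survivable.forLoop i N P) σ τ → τ.reg i = j → Inv j τ →
      Runs (.while (.lt i N) (.seq P (.instr (.inc i)))) (d * (c + 2) + 1) τ (Inv n) := by
    intro d
    induction d with
    | zero =>
      intro j τ hj hF hτ hI
      obtain rfl : j = n := by omega
      have hτN : τ.reg N = j := by
        rw [← hn]
        refine hF.reg N ?_
        simp [Survivable.forLoop, Program.any, hN, Instr.writesReg, hiN.symm]
      refine ⟨1, τ, .whileFalse ?_, by omega, hI⟩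
      simp [Test.Holds, hτ, hτN]
    | succ d ih =>
      intro j τ hj hF hτ hI
      have hτN : τ.reg N = n := by
        rw [← hn]
        refine hF.reg N ?_
        simp [Survivable.forLoop, Program.any, hN, Instr.writesReg, hiN.symm]
      obtain ⟨k, υ, he, hk, hυ⟩ := hstep j (by omega) τ hF hτ hI
      have hυi : ((Instr.inc i).exec υ).reg i = j + 1 := by
        simp [he.frame.reg i hi, hτ]
      have he₂ := he.seq (.instr (.inc i) υ)
      have hF' := hF.trans (Frame.right (he₂.frame.mono 
        (Q := .while (.lt i N) (.seq P (.instr (.inc i)))) fun f hf => by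
          simpa only [Program.any] using hf) _)
      obtain ⟨k', ω, he', hk', hω⟩ := ih (j + 1) _ (by omega) hF' hυi hυ
      refine ⟨_, ω, .whileTrue ?_ he₂ he', ?_, hω⟩
      · simp only [Test.Holds, hτ, hτN]; omega
      · rw [Nat.succ_mul]; omega
  obtain ⟨k, τ, he, hk, hτ⟩ := key n 0 ((Instr.const i 0).exec σ) (by omega)
    ((Frame.exec _ σ).left _) (by simp) h0
  exact ⟨_, τ, .seq (.instr _ _) he, by omega, hτ⟩


/-! ### The search routine

Registers `8`, `9`, `10`, `11` hold `0`, `1`, the number of arcs, and `2`. Arrays `4`, `5`, `6`, `7`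
hold the tail, the head, the link and the opposite of every arc, array `8` tells which arcs are
allowed, and weight array `1` holds their weights. Register `5` holds the root. -/

/-- Replace the best candidate arc by the arc in register `13`. -/
def takeArc : Program := block [.copy 14 9, .copy 15 13, .wcopy 2 5]

/-- Compare the arc in register `13` with the best candidate. -/
def scanArc : Program :=
  .seq (block [.load 18 8 13]) <| .ite (.eq 18 9)
    (.seq (block [.load 16 4 13, .load 18 9 16]) <| .ite (.eq 18 8)
      (.seq (block [.load 17 5 13, .load 18 9 17]) <| .ite (.eq 18 8) (block [])
        (.seq (block [.wload 3 2 17, .wload 4 1 13, .wadd 5 3 4]) <|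
          .ite (.eq 14 8) takeArc (.ite (.wlt 5 2) takeArc (block []))))
      (block []))
    (block [])

/-- Add the tail of the best candidate arc to the tree. -/
def addNode : Program := block [.load 16 4 15, .store 9 16 9, .wstore 2 16 2, .store 10 16 15]

/-- Find the best candidate arc and add its tail to the tree. -/
def searchRound : Program :=
  .seq (block [.copy 14 8]) <| .seq (forLoop 13 10 scanArc) (.ite (.eq 14 9) addNode (block []))

/-- Compute a tree of shortest walks to the node in register `5`. -/
def search : Program :=
  .seq (forLoop 12 0 (.instr (.store 9 12 8))) <|
    .seq (block [.wstore 2 5 0, .store 9 5 11]) (forLoop 12 0 searchRound)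

/-- The part of the memory that the search reads. -/
structure SearchInput (N : Arcs) (A : ℕ → Prop) (W : ℕ → ℝ) (n M t : ℕ) (σ : State) : Prop where
  reg_n : σ.reg 0 = n
  reg_t : σ.reg 5 = t
  reg_zero : σ.reg 8 = 0
  reg_one : σ.reg 9 = 1
  reg_M : σ.reg 10 = M
  reg_two : σ.reg 11 = 2
  wreg_zero : σ.wreg 0 = 0
  tail : σ.arr 4 = N.tail
  head : σ.arr 5 = N.head
  allowed : ∀ a < M, σ.arr 8 a = 1 ↔ A a
  lt_of_allowed : ∀ a, A a → a < M
  weight : ∀ a, A a → σ.warr 1 a = W a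

section Search

variable {N : Arcs} {A : ℕ → Prop} {W : ℕ → ℝ} {n M t j : ℕ} {σ τ : State}

theorem SearchInput.frame (h : SearchInput N A W n M t σ) {P : Program} (hF : Frame P σ τ)
    (h₀ : P.any (Instr.writesReg 0) = false) (h₅ : P.any (Instr.writesReg 5) = false)
    (h₈ : P.any (Instr.writesReg 8) = false) (h₉ : P.any (Instr.writesReg 9) = false)
    (h₁₀ : P.any (Instr.writesReg 10) = false) (h₁₁ : P.any (Instr.writesReg 11) = false)
    (hw : P.any (Instr.writesWReg 0) = false) (ha₄ : P.any (Instr.writesArr 4) = false)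
    (ha₅ : P.any (Instr.writesArr 5) = false) (ha₈ : P.any (Instr.writesArr 8) = false)
    (hw₁ : P.any (Instr.writesWArr 1) = false) : SearchInput N A W n M t τ where
  reg_n := (hF.reg 0 h₀).trans h.reg_n
  reg_t := (hF.reg 5 h₅).trans h.reg_t
  reg_zero := (hF.reg 8 h₈).trans h.reg_zero
  reg_one := (hF.reg 9 h₉).trans h.reg_one
  reg_M := (hF.reg 10 h₁₀).trans h.reg_M
  reg_two := (hF.reg 11 h₁₁).trans h.reg_two
  wreg_zero := (hF.wreg 0 hw).trans h.wreg_zero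
  tail := (hF.arr 4 ha₄).trans h.tail
  head := (hF.arr 5 ha₅).trans h.head
  allowed := by rw [hF.arr 8 ha₈]; exact h.allowed
  lt_of_allowed := h.lt_of_allowed
  weight := by rw [hF.warr 1 hw₁]; exact h.weight

/-- The arc `a` leads from outside of the tree into the tree. -/
def IsCandidate (N : Arcs) (A : ℕ → Prop) (vis : ℕ → ℕ) (a : ℕ) : Prop :=
  A a ∧ vis (N.tail a) = 0 ∧ vis (N.head a) ≠ 0

/-- Register `15` holds the best candidate among the arcs below `j`, if register `14` is not
`0`. -/
def BestBelow (N : Arcs) (A : ℕ → Prop) (W : ℕ → ℝ) (j : ℕ) (σ : State) : Prop :=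
  (σ.reg 14 = 0 ∧ ∀ a < j, ¬ IsCandidate N A (σ.arr 9) a) ∨
  (σ.reg 14 = 1 ∧ IsCandidate N A (σ.arr 9) (σ.reg 15) ∧
    σ.wreg 2 = σ.warr 2 (N.head (σ.reg 15)) + W (σ.reg 15) ∧
    ∀ a < j, IsCandidate N A (σ.arr 9) a → σ.wreg 2 ≤ σ.warr 2 (N.head a) + W a)

theorem scanArc_bestBelow (h : SearchInput N A W n M t τ) (hj : j < M) (hr : τ.reg 13 = j)
    (hb : BestBelow N A W j τ) : BestBelow N A W (j + 1) ((Instr.inc 13).exec (scanArc.run τ)) := by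
  have hA := h.allowed j hj
  have below : ∀ {p : ℕ → Prop}, (∀ a < j, p a) → p j → ∀ a ≤ j, p a := fun h₁ h₂ a ha =>
    ha.lt_or_eq.elim (h₁ a) fun h => h ▸ h₂
  have hT := h.tail
  have hH := h.head
  by_cases hc : IsCandidate N A (τ.arr 9) j
  · obtain ⟨h₁, h₂, h₃⟩ := id hc
    have hW := h.weight j h₁
    have h₁' := hA.2 h₁
    rcases hb with ⟨h₀, hb⟩ | ⟨h₀, hb₁, hb₂, hb₃⟩
    · refine Or.inr ?_
      simp [scanArc, takeArc, block, Program.run, Test.Holds, hr, h.reg_one, h.reg_zero, h₁', hT,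
        hH, h₂, h₃, h₀, hW]
      exact ⟨hc, below (p := fun a => IsCandidate N A (τ.arr 9) a →
        τ.warr 2 (N.head j) + W j ≤ τ.warr 2 (N.head a) + W a)
        (fun a ha h => absurd h (hb a ha)) fun _ => le_rfl⟩
    · by_cases hlt : τ.warr 2 (N.head j) + W j < τ.wreg 2
      · refine Or.inr ?_
        simp [scanArc, takeArc, block, Program.run, Test.Holds, hr, h.reg_one, h.reg_zero, h₁', hT,
          hH, h₂, h₃, h₀, hW, hlt]
        exact ⟨hc, below (fun a ha h => hlt.le.trans (hb₃ a ha h)) fun _ => le_rfl⟩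
      · refine Or.inr ?_
        simp [scanArc, takeArc, block, Program.run, Test.Holds, hr, h.reg_one, h.reg_zero, h₁', hT,
          hH, h₂, h₃, h₀, hW, hlt]
        exact ⟨hb₁, hb₂, below hb₃ fun _ => not_lt.1 hlt⟩
  · have key : (scanArc.run τ).reg 14 = τ.reg 14 ∧ (scanArc.run τ).reg 15 = τ.reg 15 ∧
        (scanArc.run τ).wreg = τ.wreg ∧ (scanArc.run τ).arr = τ.arr ∧
        (scanArc.run τ).warr = τ.warr := by
      by_cases h₁ : A j
      · have h₁' := hA.2 h₁
        by_cases h₂ : τ.arr 9 (N.tail j) = 0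
        · have h₃ : τ.arr 9 (N.head j) = 0 := by_contra fun h₃ => hc ⟨h₁, h₂, h₃⟩
          simp [scanArc, takeArc, block, Program.run, Test.Holds, hr, h.reg_one, h.reg_zero, h₁',
            hT, hH, h₂, h₃]
        · simp [scanArc, takeArc, block, Program.run, Test.Holds, hr, h.reg_one, h.reg_zero, h₁',
            hT, h₂]
      · have h₁' : ¬ τ.arr 8 j = 1 := fun h => h₁ (hA.1 h)
        simp [scanArc, takeArc, block, Program.run, Test.Holds, hr, h.reg_one, h₁']
    obtain ⟨e₁, e₂, e₃, e₄, e₅⟩ := key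
    refine Or.imp (fun hb => ?_) (fun hb => ?_) hb
    · simp only [reg_inc, arr_inc, e₁, e₄]
      exact ⟨by simpa using hb.1, fun a ha => below hb.2 hc a (Nat.lt_succ_iff.1 ha)⟩
    · simp only [reg_inc, arr_inc, wreg_inc, warr_inc, e₁, e₂, e₃, e₄, e₅]
      exact ⟨by simpa using hb.1, by simpa using hb.2.1, by simpa using hb.2.2.1,
        fun a ha => below hb.2.2.2 (fun h => absurd h hc) a (Nat.lt_succ_iff.1 ha)⟩

/-- The memory represents a tree with more than `j` nodes, or with all nodes that can reach the
root. -/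
def TreeAt (N : Arcs) (A : ℕ → Prop) (W : ℕ → ℝ) (n t j : ℕ) (σ : State) : Prop :=
  (∃ T, N.Tree A W n t (σ.arr 9) (σ.warr 2) (σ.arr 10) T) ∧
    (j + 1 ≤ ((Finset.range n).filter fun v => σ.arr 9 v ≠ 0).card ∨
      ∀ a, ¬ IsCandidate N A (σ.arr 9) a)

/-- A round scans all `M` arcs, at `32` steps each at most, and adds one node if there is a
candidate. Rescanning all arcs replaces a priority queue: `n` rounds stay within `O(n M)`. -/
theorem searchRound_runs (h : SearchInput N A W n M t σ)
    (hA : ∀ a, A a → N.tail a < n ∧ N.head a < n) (hW : ∀ a, A a → 0 ≤ W a)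
    (hT : TreeAt N A W n t j σ) :
    Runs searchRound (M * 32 + 20) σ fun τ => TreeAt N A W n t (j + 1) ((Instr.inc 12).exec τ) := by
  refine Runs.seq (k := 2) (l := M * 32 + 18) (Runs.of_run (Q := fun τ =>
    τ = (Instr.copy 14 8).exec σ) rfl rfl le_rfl) (fun τ _ hτ => ?_) (by omega)
  have hI : SearchInput N A W n M t τ := by
    rw [hτ]; exact h.frame (Frame.exec _ σ) rfl rfl rfl rfl rfl rfl rfl rfl rfl rfl rfl
  have hT : TreeAt N A W n t j τ := by rw [hτ]; exact hT
  have h14 : τ.reg 14 = 0 := by rw [hτ]; simp [h.reg_zero]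
  clear hτ
  refine Runs.seq (k := M * (30 + 2) + 2) (l := 16)
    (Runs.forLoop (Inv := BestBelow N A W) (n := M) rfl rfl (by decide) hI.reg_M (Or.inl ?_)
      fun j hj υ hF hr hb => Runs.of_run rfl
        (scanArc_bestBelow (hI.frame hF rfl rfl rfl rfl rfl rfl rfl rfl rfl rfl rfl) hj hr hb)
        (by decide)) (fun υ hF hb => ?_) (by omega)
  · simp [h14]
  have hIυ := hI.frame hF rfl rfl rfl rfl rfl rfl rfl rfl rfl rfl rfl
  have e₁ : υ.arr 9 = τ.arr 9 := hF.arr 9 rfl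
  have e₂ : υ.arr 10 = τ.arr 10 := hF.arr 10 rfl
  have e₃ : υ.warr 2 = τ.warr 2 := hF.warr 2 rfl
  obtain ⟨⟨T, hT⟩, hcard⟩ := hT
  rw [← e₁, ← e₂, ← e₃] at hT
  rw [← e₁] at hcard
  refine Runs.of_run rfl ?_ (by decide)
  rcases hb with ⟨h₀, hb⟩ | ⟨h₀, hb₁, hb₂, hb₃⟩
  · have hno : ∀ a, ¬ IsCandidate N A (υ.arr 9) a := fun a ha =>
      hb a (hI.lt_of_allowed a ha.1) ha
    simp [Program.run, Test.Holds, hIυ.reg_one, h₀, block]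
    exact ⟨⟨T, hT⟩, Or.inr hno⟩
  · have hins := hT.insert hA hW hb₁.1 hb₁.2.1 hb₁.2.2 fun b h₁ h₂ h₃ =>
      hb₂ ▸ hb₃ b (hI.lt_of_allowed b h₁) ⟨h₁, h₂, h₃⟩
    rw [← hb₂] at hins
    simp [Program.run, Test.Holds, hIυ.reg_one, h₀, addNode, block, TreeAt, hIυ.tail]
    refine ⟨⟨_, hins⟩, Or.inl ?_⟩
    have hc := hcard.resolve_right fun h => h _ hb₁
    refine (Nat.succ_le_succ hc).trans (Nat.succ_le_of_lt (Finset.card_lt_card ⟨fun v hv => ?_,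
      fun hsub => ?_⟩))
    · simp only [Finset.mem_filter, Finset.mem_range] at hv ⊢
      refine ⟨hv.1, ?_⟩
      rw [Function.update_apply]
      split_ifs
      exacts [by simp, hv.2]
    · have := hsub (Finset.mem_filter.2 ⟨Finset.mem_range.2 (hA _ hb₁.1).1, by simp⟩)
      simp [hb₁.2.1] at this

theorem search_runs (h : SearchInput N A W n M t σ) (ht : t < n)
    (hA : ∀ a, A a → N.tail a < n ∧ N.head a < n) (hW : ∀ a, A a → 0 ≤ W a) :
    Runs search (n * (M * 32 + 25) + 8) σ fun τ =>
      ∃ T, N.SpanningTree A W n t (τ.arr 9) (τ.warr 2) (τ.arr 10) T := by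
  refine Runs.seq (k := n * (1 + 2) + 2) (l := n * (M * 32 + 22) + 6)
    (Runs.forLoop (Inv := fun j τ => ∀ v < j, τ.arr 9 v = 0) (n := n) rfl rfl (by decide)
      h.reg_n (by simp) fun j hj τ hF hr hI => Runs.of_run rfl ?_ le_rfl)
    (fun τ hF hτ => ?_) (by ring_nf; omega)
  · have := (h.frame hF rfl rfl rfl rfl rfl rfl rfl rfl rfl rfl rfl).reg_zero
    intro v hv
    simp only [Program.run, arr_inc, arr_store, if_true, hr, this, Function.update_apply]
    split_ifs with hvj
    exacts [rfl, hI v (by omega)]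
  have hI := h.frame hF rfl rfl rfl rfl rfl rfl rfl rfl rfl rfl rfl
  refine Runs.seq (k := 3) (l := n * (M * 32 + 20 + 2) + 2) (Runs.of_run (Q := fun υ =>
    (∀ v < n, v ≠ t → υ.arr 9 v = 0) ∧ υ.arr 9 t = 2 ∧ υ.warr 2 t = 0) rfl ?_ le_rfl)
    (fun υ hF hυ => ?_) (by ring_nf; omega)
  · simp only [Program.run, block, exec_skip, arr_store, arr_wstore, if_true, reg_wstore,
      warr_store, warr_wstore, hI.reg_t, hI.reg_two, hI.wreg_zero, Function.update_self, and_true]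
    intro v hv hvt
    rw [Function.update_of_ne hvt]
    exact hτ v hv
  have hIυ := hI.frame hF rfl rfl rfl rfl rfl rfl rfl rfl rfl rfl rfl
  refine (Runs.forLoop (Inv := TreeAt N A W n t) (n := n) rfl rfl (by decide) hIυ.reg_n ?_
    fun j hj ω hF hr hT => searchRound_runs (hIυ.frame hF rfl rfl rfl rfl rfl rfl rfl rfl rfl rfl
      rfl) hA hW hT).mono le_rfl fun ω _ hT => ?_
  · have hT : N.Tree A W n t (υ.arr 9) (υ.warr 2) (υ.arr 10) fun _ => [] :=
      Arcs.Tree.single ht hW hυ.1 hυ.2.1 hυ.2.2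
    refine ⟨⟨_, hT⟩, Or.inl (Finset.card_pos.2 ⟨t, ?_⟩)⟩
    rw [Finset.mem_filter, Finset.mem_range, arr_const, hυ.2.1]
    exact ⟨ht, two_ne_zero⟩
  · obtain ⟨⟨T, hT⟩, hc⟩ := hT
    refine ⟨T, hT, hA, fun a ha h₁ h₂ => ?_⟩
    -- After `n` rounds the first alternative would require `n + 1` marked nodes among `n`, so no
    -- candidate arc is left and the tree spans.
    rcases hc with hc | hc
    · have := Finset.card_filter_le (Finset.range n) fun v => ω.arr 9 v ≠ 0
      rw [Finset.card_range] at this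
      omega
    · exact hc a ⟨ha, h₂, h₁⟩

end Search


theorem Program.frame_run {P : Program} (h : P.LoopFree = true) (σ : State) :
    Frame P σ (P.run σ) := by
  obtain ⟨_, _, he, -, rfl⟩ := P.runs_run h σ
  exact he.frame

/-! ### Extraction of a walk from the tree -/

/-- Write the links of the walk from the node in register `4` to the root into array `ls`, its length
into register `ln`, and mark its arcs in array `mk`. -/
def extract (mk ls ln : ℕ) : Program :=
  .seq (forLoop 13 10 (.instr (.store mk 13 8))) <|
    .seq (block [.copy 17 4, .const ln 0, .load 18 9 17]) <|
      .while (.eq 18 9) (block [.load 15 10 17, .store mk 15 9, .load 16 6 15, .store ls ln 16,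
        .inc ln, .load 17 5 15, .load 18 9 17])

section Extract

variable {N : Arcs} {A : ℕ → Prop} {W : ℕ → ℝ} {n M s t : ℕ} {σ τ : State} {T : ℕ → List ℕ}
  {vis nxt : ℕ → ℕ} {D : ℕ → ℝ} {π : List ℕ} {mk ls ln : ℕ}

theorem Arcs.Simple.length_lt {u : ℕ} (hs : N.Simple u π) (hu : u < n)
    (hπ : ∀ a ∈ π, N.head a < n) : π.length < n := by
  have h : (u :: π.map N.head).toFinset ⊆ Finset.range n := by
    intro v hv
    rw [List.mem_toFinset, List.mem_cons, List.mem_map] at hv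
    rw [Finset.mem_range]
    rcases hv with rfl | ⟨a, ha, rfl⟩
    exacts [hu, hπ a ha]
  have := Finset.card_le_card h
  rwa [List.toFinset_card_of_nodup hs, Finset.card_range, List.length_cons, List.length_map] at this

/-- Induction on the rest `ρ` of the walk; the loop stops at the root, whose mark is `2` instead of
`1`. A round costs `9` steps: seven instructions, the closing `skip` and the test. The lower bounds
on `mk`, `ls`, `ln` keep the output clear of the arrays and registers in use. -/
theorem extract_loop (h : N.SpanningTree A W n t vis D nxt T) (hmk : 12 ≤ mk) (hls : 12 ≤ ls)
    (hml : mk ≠ ls) (hln : 19 ≤ ln) : ∀ (ρ : List ℕ) (v k : ℕ) (σ : State), σ.reg 9 = 1 →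
      σ.arr 5 = N.head → σ.arr 6 = N.link → σ.arr 9 = vis → σ.arr 10 = nxt → v < n → vis v ≠ 0 →
      T v = ρ → σ.reg 17 = v → σ.reg 18 = vis v → σ.reg ln = k →
      Runs (.while (.eq 18 9) (block [.load 15 10 17, .store mk 15 9, .load 16 6 15,
        .store ls ln 16, .inc ln, .load 17 5 15, .load 18 9 17])) (ρ.length * 9 + 1) σ fun τ =>
          τ.reg ln = k + ρ.length ∧ (∀ i < k, τ.arr ls i = σ.arr ls i) ∧
          (∀ i (hi : i < ρ.length), τ.arr ls (k + i) = N.link ρ[i]) ∧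
          ∀ a, τ.arr mk a = if a ∈ ρ then 1 else σ.arr mk a := by
  intro ρ
  induction ρ with
  | nil =>
    intro v k σ h9 h5 h6 hvis hnxt hv hv' hρ h17 h18 hk
    have hv2 : vis v ≠ 1 := fun h1 => by
      rw [h.step v hv h1] at hρ
      exact absurd hρ (by simp)
    refine ⟨1, σ, .whileFalse ?_, by simp, by simp [hk], fun _ _ => rfl, by simp, by simp⟩
    simp [Test.Holds, h18, h9, hv2]
  | cons a ρ ih =>
    intro v k σ h9 h5 h6 hvis hnxt hv hv' hρ h17 h18 hk
    have hv1 : vis v = 1 := by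
      have h₁ := h.vis_le v hv
      have h₂ : vis v ≠ 2 := fun h2 => by
        rw [h.eq_root v hv h2, h.root] at hρ
        exact absurd hρ (by simp)
      omega
    have hstep := h.step v hv hv1
    rw [hρ] at hstep
    obtain ⟨rfl, hρ'⟩ := List.cons.inj hstep
    have hw := h.walk v hv hv'
    rw [hρ] at hw
    have hh := h.vis_head v hv hv' (nxt v) (hρ ▸ List.mem_cons_self)
    have e₁ : (5 : ℕ) ≠ mk := by omega
    have e₂ : (6 : ℕ) ≠ mk := by omega
    have e₃ : (9 : ℕ) ≠ mk := by omega
    have e₄ : (5 : ℕ) ≠ ls := by omega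
    have e₅ : (6 : ℕ) ≠ ls := by omega
    have e₆ : (9 : ℕ) ≠ ls := by omega
    have e₇ : (10 : ℕ) ≠ mk := by omega
    have e₈ : (10 : ℕ) ≠ ls := by omega
    have e₉ : ∀ r < 19, r ≠ ln := by omega
    have e₁₀ : ∀ r < 19, ln ≠ r := by omega
    set P := block [.load 15 10 17, .store mk 15 9, .load 16 6 15, .store ls ln 16,
      .inc ln, .load 17 5 15, .load 18 9 17] with hP
    obtain ⟨k', τ, he, hk', hτ⟩ := P.runs_run rfl σ
    have r₉ : τ.reg 9 = 1 := by simp [hτ, hP, block, Program.run, e₉, h9]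
    have a₅ : τ.arr 5 = N.head := by simp [hτ, hP, block, Program.run, e₁, e₄, h5]
    have a₆ : τ.arr 6 = N.link := by simp [hτ, hP, block, Program.run, e₂, e₅, h6]
    have a₉ : τ.arr 9 = vis := by simp [hτ, hP, block, Program.run, e₃, e₆, hvis]
    have a₁₀ : τ.arr 10 = nxt := by simp [hτ, hP, block, Program.run, e₇, e₈, hnxt]
    have r₁₇ : τ.reg 17 = N.head (nxt v) := by
      simp [hτ, hP, block, Program.run, e₁, e₄, e₉, h5, hnxt, h17]
    have r₁₈ : τ.reg 18 = vis (N.head (nxt v)) := by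
      simp [hτ, hP, block, Program.run, e₁, e₃, e₄, e₆, e₉, h5, hnxt, h17, hvis]
    have rln : τ.reg ln = k + 1 := by
      simp [hτ, hP, block, Program.run, e₁₀, hk]
    have als : τ.arr ls = Function.update (σ.arr ls) k (N.link (nxt v)) := by
      simp [hτ, hP, block, Program.run, e₂, e₁₀, h6, hnxt, h17, hk, hml.symm]
    have amk : τ.arr mk = Function.update (σ.arr mk) (nxt v) 1 := by
      simp [hτ, hP, block, Program.run, hnxt, h17, hml, h9]
    obtain ⟨l, υ, he', hl, hυ₁, hυ₂, hυ₃, hυ₄⟩ := ih (N.head (nxt v)) (k + 1) τ r₉ a₅ a₆ a₉ a₁₀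
      (h.arc_lt _ hw.1).2 hh hρ'.symm r₁₇ r₁₈ rln
    refine ⟨_, υ, .whileTrue (by simp [Test.Holds, h18, h9, hv1]) he he', ?_, ?_, ?_, ?_, ?_⟩
    · have : P.size = 8 := rfl
      rw [List.length_cons]
      omega
    · rw [hυ₁, List.length_cons]; omega
    · intro i hi
      rw [hυ₂ i (by omega), als, Function.update_of_ne (by omega)]
    · rintro (_ | i) hi
      · rw [add_zero, hυ₂ k (by omega), als, Function.update_self, List.getElem_cons_zero]
      · rw [List.getElem_cons_succ, ← hυ₃ i (by simpa using hi)]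
        congr 1; omega
    · intro b
      rw [hυ₄ b, amk, Function.update_apply]
      by_cases hb : b = nxt v <;> by_cases hb' : b ∈ ρ <;> simp [hb, hb']

theorem extract_runs (h : SearchInput N A W n M t σ) (hlink : σ.arr 6 = N.link)
    (hs : σ.reg 4 = s) (hT : N.SpanningTree A W n t (σ.arr 9) (σ.warr 2) (σ.arr 10) T)
    (hsn : s < n) (hv : σ.arr 9 s ≠ 0) (hmk : 12 ≤ mk) (hls : 12 ≤ ls) (hml : mk ≠ ls)
    (hln : 19 ≤ ln) : Runs (extract mk ls ln) (M * 3 + n * 9 + 8) σ fun τ =>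
      τ.reg ln = (T s).length ∧ (∀ i (hi : i < (T s).length), τ.arr ls i = N.link (T s)[i]) ∧
      ∀ a < M, τ.arr mk a = if a ∈ T s then 1 else 0 := by
  have hlen := (hT.simple s hsn hv).length_lt hsn fun a ha =>
    (hT.arc_lt a ((hT.walk s hsn hv).mem ha)).2
  have wF : ∀ r < 12, (forLoop 13 10 (.instr (.store mk 13 8))).any (Instr.writesArr r) = false := by
    intro r hr
    simp only [forLoop, Program.any, Instr.writesArr, Bool.false_or, Bool.or_false,
      beq_eq_false_iff_ne]
    omega
  refine Runs.seq (k := M * (1 + 2) + 2) (l := n * 9 + 6)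
    (Runs.forLoop (Inv := fun j τ => ∀ a < j, τ.arr mk a = 0) (n := M) rfl rfl (by decide)
      h.reg_M (by simp) fun j hj τ hF hr hI => Runs.of_run rfl ?_ le_rfl)
    (fun τ hF hτ => ?_) (by omega)
  · have := (hF.reg 8 rfl).trans h.reg_zero
    intro v hv
    simp only [Program.run, arr_inc, arr_store, if_true, hr, this, Function.update_apply]
    split_ifs with hvj
    exacts [rfl, hI v (by omega)]
  have e₁ : ∀ r < 12, τ.arr r = σ.arr r := fun r hr => hF.arr r (wF r hr)
  have e₂ : τ.reg 4 = s := (hF.reg 4 rfl).trans hs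
  have e₃ : τ.reg 9 = 1 := (hF.reg 9 rfl).trans h.reg_one
  have e₄ : ∀ r < 19, r ≠ ln := by omega
  refine Runs.seq (k := 4) (l := (T s).length * 9 + 1) (Runs.of_run (Q := fun υ =>
    υ.reg 9 = 1 ∧ υ.arr = τ.arr ∧ υ.reg 17 = s ∧ υ.reg 18 = σ.arr 9 s ∧ υ.reg ln = 0) rfl ?_ le_rfl)
    (fun υ _ hυ => ?_) (by omega)
  · simp [block, Program.run, e₂, e₃, e₄, e₁]
    omega
  obtain ⟨u₁, u₂, u₃, u₄, u₅⟩ := hυ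
  refine (extract_loop hT hmk hls hml hln (T s) s 0 υ u₁ (by rw [u₂, e₁ 5 (by omega), h.head])
    (by rw [u₂, e₁ 6 (by omega), hlink]) (by rw [u₂, e₁ 9 (by omega)])
    (by rw [u₂, e₁ 10 (by omega)]) hsn hv rfl u₃ u₄ u₅).mono le_rfl fun ω _ hω => ?_
  obtain ⟨w₁, -, w₃, w₄⟩ := hω
  refine ⟨by simpa using w₁, by simpa using w₃, fun a ha => ?_⟩
  rw [w₄ a, u₂, hτ a ha]

end Extract

/-! ### Loops over the arcs -/

/-- Fill array `X`: the program `P` computes the value for the arc in register `13` in register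
`19`. -/
def fill (X : ℕ) (P : Program) : Program := forLoop 13 10 (.seq P (.instr (.store X 13 19)))

/-- Fill weight array `X`: the program `P` computes the value for the arc in register `13` in weight
register `5`. -/
def wfill (X : ℕ) (P : Program) : Program := forLoop 13 10 (.seq P (.instr (.wstore X 13 5)))

section Fill

variable {M X : ℕ} {P : Program} {σ τ : State}

theorem fill_runs (f : ℕ → ℕ) (hP : P.LoopFree = true) (h₁₃ : P.any (Instr.writesReg 13) = false)
    (h₁₀ : P.any (Instr.writesReg 10) = false) (hX : P.any (Instr.writesArr X) = false)
    (hM : σ.reg 10 = M)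
    (h : ∀ a < M, ∀ τ, Frame (fill X P) σ τ → τ.reg 13 = a → (P.run τ).reg 19 = f a) :
    Runs (fill X P) (M * (P.size + 3) + 2) σ fun τ => ∀ a < M, τ.arr X a = f a := by
  refine (Runs.forLoop (c := P.size + 1) (Inv := fun j τ => ∀ a < j, τ.arr X a = f a)
    (by simp [Program.any, h₁₃, Instr.writesReg]) (by simp [Program.any, h₁₀, Instr.writesReg])
    (by decide) hM (by simp) fun j hj τ hF hr hI => ?_).mono le_rfl fun _ _ h => h
  refine Runs.of_run (by simp [Program.LoopFree, hP]) (fun a ha => ?_) le_rfl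
  have hF' := P.frame_run hP τ
  rw [arr_inc, Program.run, Program.run, arr_store, if_pos rfl, hF'.reg 13 h₁₃, hr, h j hj τ hF hr,
    hF'.arr X hX, Function.update_apply]
  split_ifs with haj
  exacts [haj ▸ rfl, hI a (by omega)]

theorem wfill_runs (f : ℕ → ℝ) (hP : P.LoopFree = true)
    (h₁₃ : P.any (Instr.writesReg 13) = false) (h₁₀ : P.any (Instr.writesReg 10) = false)
    (hX : P.any (Instr.writesWArr X) = false) (hM : σ.reg 10 = M)
    (h : ∀ a < M, ∀ τ, Frame (wfill X P) σ τ → τ.reg 13 = a → (P.run τ).wreg 5 = f a) :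
    Runs (wfill X P) (M * (P.size + 3) + 2) σ fun τ => ∀ a < M, τ.warr X a = f a := by
  refine (Runs.forLoop (c := P.size + 1) (Inv := fun j τ => ∀ a < j, τ.warr X a = f a)
    (by simp [Program.any, h₁₃, Instr.writesReg]) (by simp [Program.any, h₁₀, Instr.writesReg])
    (by decide) hM (by simp) fun j hj τ hF hr hI => ?_).mono le_rfl fun _ _ h => h
  refine Runs.of_run (by simp [Program.LoopFree, hP]) (fun a ha => ?_) le_rfl
  have hF' := P.frame_run hP τ
  rw [warr_inc, Program.run, Program.run, warr_wstore, if_pos rfl, hF'.reg 13 h₁₃, hr,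
    h j hj τ hF hr, hF'.warr X hX, Function.update_apply]
  split_ifs with haj
  exacts [haj ▸ rfl, hI a (by omega)]

end Fill


namespace Instance

variable {n m : ℕ} (I : Instance n m)

/-! ### The arcs of an instance -/

/-- The arcs `2 e` and `2 e + 1` represent the link `e`; the arcs `2 m` and `2 m + 1` represent the
fictitious link between `x` and `y`. -/
def arcs (x y : ℕ) : Arcs where
  tail a := if a < 2 * m then
      if a % 2 = 0 then arrayOf (fun e => (I.ends e).1.val) (a / 2)
      else arrayOf (fun e => (I.ends e).2.val) (a / 2)
    else if a = 2 * m then x else if a = 2 * m + 1 then y else 0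
  head a := if a < 2 * m then
      if a % 2 = 0 then arrayOf (fun e => (I.ends e).2.val) (a / 2)
      else arrayOf (fun e => (I.ends e).1.val) (a / 2)
    else if a = 2 * m then y else if a = 2 * m + 1 then x else 0
  rev a := if a < 2 * m + 2 then if a % 2 = 0 then a + 1 else a - 1 else 0
  link a := if a < 2 * m + 2 then a / 2 else 0

/-- The numbers of the links in `l` are marked by `1`. -/
noncomputable def _root_.Survivable.marks (l : List (Fin m)) (e : ℕ) : ℕ :=
  if e ∈ l.map Fin.val then 1 else 0

/-- The part of the memory that holds the instance. -/
structure Memory (x y : ℕ) (σ : State) : Prop where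
  reg : σ.reg 0 = n ∧ σ.reg 1 = m ∧ σ.reg 2 = I.s₁ ∧ σ.reg 4 = I.s₂ ∧ σ.reg 5 = I.t₂ ∧
    σ.reg 6 = I.p₁.length ∧ σ.reg 7 = I.b₁.length
  reg' : σ.reg 8 = 0 ∧ σ.reg 9 = 1 ∧ σ.reg 10 = 2 * m + 2 ∧ σ.reg 11 = 2
  wreg : σ.wreg 0 = 0 ∧ σ.wreg 1 = 1
  arr : σ.arr 0 = (arrayOf fun e => (I.ends e).1.val) ∧
    σ.arr 1 = (arrayOf fun e => (I.ends e).2.val) ∧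
    σ.arr 2 = (arrayOf fun i => (I.p₁.get i).val) ∧ σ.arr 3 = arrayOf fun i => (I.b₁.get i).val
  arcs : σ.arr 4 = (I.arcs x y).tail ∧ σ.arr 5 = (I.arcs x y).head ∧
    σ.arr 6 = (I.arcs x y).link ∧ σ.arr 7 = (I.arcs x y).rev
  marks : σ.arr 19 = marks I.p₁ ∧ σ.arr 20 = marks I.b₁
  warr : σ.warr 0 = arrayOf I.prob

end Instance

/-- The program does not write the part of the memory that holds the instance. -/
def Program.keepsMemory (P : Program) : Bool :=
  [0, 1, 2, 4, 5, 6, 7, 8, 9, 10, 11].all (fun r => !P.any (Instr.writesReg r)) &&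
  [0, 1].all (fun r => !P.any (Instr.writesWReg r)) &&
  [0, 1, 2, 3, 4, 5, 6, 7, 19, 20].all (fun r => !P.any (Instr.writesArr r)) &&
  [0].all (fun r => !P.any (Instr.writesWArr r))

namespace Instance

variable {n m : ℕ} {I : Instance n m} {x y : ℕ} {σ τ : State}

theorem Memory.frame (h : I.Memory x y σ) {P : Program} (hF : Frame P σ τ)
    (hP : P.keepsMemory = true) : I.Memory x y τ := by
  simp only [Program.keepsMemory, List.all_cons, List.all_nil, Bool.and_true, Bool.and_eq_true,
    Bool.not_eq_true'] at hP
  obtain ⟨⟨⟨⟨r0, r1, r2, r4, r5, r6, r7, r8, r9, r10, r11⟩, w0, w1⟩,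
    a0, a1, a2, a3, a4, a5, a6, a7, a19, a20⟩, v0⟩ := hP
  refine ⟨?_, ?_, ?_, ?_, ?_, ?_, ?_⟩
  · rw [hF.reg 0 r0, hF.reg 1 r1, hF.reg 2 r2, hF.reg 4 r4, hF.reg 5 r5, hF.reg 6 r6, hF.reg 7 r7]
    exact h.reg
  · rw [hF.reg 8 r8, hF.reg 9 r9, hF.reg 10 r10, hF.reg 11 r11]
    exact h.reg'
  · rw [hF.wreg 0 w0, hF.wreg 1 w1]
    exact h.wreg
  · rw [hF.arr 0 a0, hF.arr 1 a1, hF.arr 2 a2, hF.arr 3 a3]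
    exact h.arr
  · rw [hF.arr 4 a4, hF.arr 5 a5, hF.arr 6 a6, hF.arr 7 a7]
    exact h.arcs
  · rw [hF.arr 19 a19, hF.arr 20 a20]
    exact h.marks
  · rw [hF.warr 0 v0]
    exact h.warr

theorem Memory.searchInput (h : I.Memory x y σ) {A : ℕ → Prop} {W : ℕ → ℝ}
    (hA : ∀ a < 2 * m + 2, σ.arr 8 a = 1 ↔ A a) (hlt : ∀ a, A a → a < 2 * m + 2)
    (hW : ∀ a, A a → σ.warr 1 a = W a) :
    SearchInput (I.arcs x y) A W n (2 * m + 2) I.t₂ σ :=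
  ⟨h.reg.1, h.reg.2.2.2.2.1, h.reg'.1, h.reg'.2.1, h.reg'.2.2.1, h.reg'.2.2.2, h.wreg.1, h.arcs.1,
    h.arcs.2.1, hA, hlt, hW⟩

theorem arrayOf_val {A : Type*} [Zero A] (f : Fin m → A) (e : Fin m) : arrayOf f e.val = f e := by
  simp [arrayOf]

end Instance

/-! ### Initialization -/

/-- Build the arcs of the links and add up the failure probabilities. -/
def buildArcs : Program := forLoop 12 1 <| block [.load 16 0 12, .load 17 1 12, .store 4 10 16,
  .store 5 10 17, .store 6 10 12, .copy 13 10, .inc 13, .store 7 10 13, .store 4 13 17,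
  .store 5 13 16, .store 6 13 12, .store 7 13 10, .inc 10, .inc 10, .wload 3 0 12, .wadd 1 1 3]

/-- Build the arcs of the fictitious link. -/
def buildFictitious : Program := block [.const 9 1, .const 11 2, .store 6 10 1, .copy 13 10,
  .inc 13, .store 7 10 13, .store 6 13 1, .store 7 13 10, .inc 10, .inc 10]

/-- Mark the links of a path of the first connection, with length in register `r`, given by
array `a`, in array `b`. -/
def markPath (r a b : ℕ) : Program := forLoop 12 r (block [.load 16 a 12, .store b 16 9])

/-- Build the arcs and mark the links of the two paths of the first connection. -/
def setup : Program :=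
  .seq buildArcs <| .seq buildFictitious <| .seq (markPath 6 2 19) (markPath 7 3 20)

namespace Instance

variable {n m : ℕ} {I : Instance n m} {σ τ : State}

/-- The arrays of the arcs after the links below `j` have been treated. -/
structure ArcsBelow (I : Instance n m) (j : ℕ) (σ : State) : Prop where
  reg : σ.reg 10 = 2 * j
  wreg : σ.wreg 1 = ∑ e ∈ Finset.range j, arrayOf I.prob e
  tail : σ.arr 4 = fun a => if a < 2 * j then
      if a % 2 = 0 then arrayOf (fun e => (I.ends e).1.val) (a / 2)
      else arrayOf (fun e => (I.ends e).2.val) (a / 2) else 0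
  head : σ.arr 5 = fun a => if a < 2 * j then
      if a % 2 = 0 then arrayOf (fun e => (I.ends e).2.val) (a / 2)
      else arrayOf (fun e => (I.ends e).1.val) (a / 2) else 0
  link : σ.arr 6 = fun a => if a < 2 * j then a / 2 else 0
  rev : σ.arr 7 = fun a => if a < 2 * j then if a % 2 = 0 then a + 1 else a - 1 else 0

/-- This has the shape of the two stores of a round, first at position `2 j`, then at `2 j + 1`. -/
theorem ite_lt_two_mul_succ {B : Type*} (j a : ℕ) (f : ℕ → B) (c : B) :
    (if a < 2 * (j + 1) then f a else c) = if a = 2 * j + 1 then f (2 * j + 1) else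
      if a = 2 * j then f (2 * j) else if a < 2 * j then f a else c := by
  grind

theorem buildArcs_runs : Runs buildArcs (m * 19 + 2) I.encode (I.ArcsBelow m) := by
  refine Runs.forLoop (c := 17) (Inv := I.ArcsBelow) rfl rfl (by decide) rfl ?_
    fun j hj τ hF hr hI => Runs.of_run rfl ?_ (by decide)
  · constructor <;> simp [encode]
  · have h0 : τ.arr 0 = arrayOf fun e => (I.ends e).1.val := hF.arr 0 rfl
    have h1 : τ.arr 1 = arrayOf fun e => (I.ends e).2.val := hF.arr 1 rfl
    have hp : τ.warr 0 = arrayOf I.prob := hF.warr 0 rfl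
    obtain ⟨hI₁, hI₂, hI₃, hI₄, hI₅, hI₆⟩ := hI
    have m₀ : (2 * j) % 2 = 0 := by omega
    have m₁ : (2 * j + 1) % 2 = 1 := by omega
    have d₀ : (2 * j) / 2 = j := by omega
    have d₁ : (2 * j + 1) / 2 = j := by omega
    constructor
    · simp [block, Program.run, hI₁]; omega
    · simp [block, Program.run, hI₂, hp, hr, Finset.sum_range_succ]
    · funext a
      refine .trans ?_ (ite_lt_two_mul_succ j a (fun a => if a % 2 = 0 then arrayOf (fun e => (I.ends e).1.val) (a / 2)
        else arrayOf (fun e => (I.ends e).2.val) (a / 2)) 0).symm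
      simp [block, Program.run, hI₁, hI₃, hr, h0, h1, Function.update_apply, m₀, m₁, d₀, d₁]
    · funext a
      refine .trans ?_ (ite_lt_two_mul_succ j a (fun a => if a % 2 = 0 then arrayOf (fun e => (I.ends e).2.val) (a / 2)
        else arrayOf (fun e => (I.ends e).1.val) (a / 2)) 0).symm
      simp [block, Program.run, hI₁, hI₄, hr, h0, h1, Function.update_apply, m₀, m₁, d₀, d₁]
    · funext a
      refine .trans ?_ (ite_lt_two_mul_succ j a (fun a => a / 2) 0).symm
      simp [block, Program.run, hI₁, hI₅, hr, Function.update_apply, d₀, d₁]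
    · funext a
      refine .trans ?_ (ite_lt_two_mul_succ j a (fun a => if a % 2 = 0 then a + 1 else a - 1) 0).symm
      simp [block, Program.run, hI₁, hI₆, Function.update_apply, m₀, m₁]

theorem markPath_runs {r a b : ℕ} {l : List (Fin m)} (hl : σ.HoldsList r a l)
    (hb : σ.arr b = fun _ => 0)
    (h9 : σ.reg 9 = 1) (hab : a ≠ b) (hr12 : r ≠ 12) (hr16 : r ≠ 16) :
    Runs (markPath r a b) (l.length * 5 + 2) σ fun τ => τ.arr b = marks l := by
  refine (Runs.forLoop (c := 3) (Inv := fun j τ => ∀ e, τ.arr b e =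
    if e ∈ (l.take j).map Fin.val then 1 else 0) rfl
    (by simp [block, Program.any, Instr.writesReg, hr16]) hr12.symm hl.1 (by simp [hb])
    fun j hj τ hF hrj hI => Runs.of_run rfl ?_ le_rfl).mono le_rfl fun τ _ h => ?_
  · have ha' : τ.arr a = σ.arr a := by
      refine hF.arr a ?_
      simp [forLoop, block, Program.any, Instr.writesArr, hab]
    have h9' : τ.reg 9 = 1 := by
      refine (hF.reg 9 rfl).trans h9
    intro e
    have : σ.arr a j = l[j].val := hl.2 ⟨j, hj⟩
    simp only [block, Program.run, exec_skip, arr_inc, arr_store, arr_load, reg_load, if_true, ha',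
      hrj, h9', this, Function.update_apply, List.take_succ_eq_append_getElem hj, List.map_append,
      List.mem_append, hI]
    by_cases he : e = l[j].val <;> simp [he]
  · funext e
    rw [h e, List.take_length, marks]

theorem length_le_m {l : List (Fin m)} (h : l.Nodup) : l.length ≤ m := by
  simpa using h.length_le_card

theorem setup_runs : Runs setup (m * 29 + 20) I.encode fun τ =>
    I.Memory 0 0 τ ∧ τ.warr 1 = (fun _ => 0) ∧ ∀ r ∈ [21, 29, 30], τ.arr r = fun _ => 0 := by
  refine Runs.seq (l := m * 10 + 18) buildArcs_runs (fun τ₁ F₁ h₁ => ?_) (by omega)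
  have hr : ∀ r, r ≠ 10 → r ≠ 12 → r ≠ 13 → r ≠ 16 → r ≠ 17 → τ₁.reg r = I.encode.reg r := by
    intro r _ _ _ _ _
    refine F₁.reg r ?_
    simp [buildArcs, forLoop, block, Program.any, Instr.writesReg, *]
  refine Runs.seq (k := 11) (l := m * 10 + 7) (Runs.of_run (Q := fun τ =>
    τ.reg 8 = 0 ∧ τ.reg 9 = 1 ∧ τ.reg 10 = 2 * m + 2 ∧ τ.reg 11 = 2 ∧
    τ.arr 6 = (I.arcs 0 0).link ∧ τ.arr 7 = (I.arcs 0 0).rev) rfl ?_ (by decide))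
    (fun τ₂ F₂ h₂ => ?_) (by omega)
  · refine ⟨?_, ?_, ?_, ?_, ?_, ?_⟩
    · simp [buildFictitious, block, Program.run, hr 8, encode]
    · simp [buildFictitious, block, Program.run]
    · simp [buildFictitious, block, Program.run, h₁.reg]
    · simp [buildFictitious, block, Program.run]
    · have : I.encode.reg 1 = m := rfl
      funext a
      simp only [buildFictitious, block, Program.run, arcs]
      simp [h₁.reg, h₁.link, hr 1, this, Function.update_apply]
      grind
    · funext a
      simp only [buildFictitious, block, Program.run, arcs]
      simp [h₁.reg, h₁.rev, Function.update_apply]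
      grind
  obtain ⟨r8, r9, r10, r11, a6, a7⟩ := h₂
  have hr₂ : ∀ r < 8, τ₂.reg r = I.encode.reg r := by
    intro r hr8
    rw [← hr r (by omega) (by omega) (by omega) (by omega) (by omega)]
    refine F₂.reg r ?_
    simp only [buildFictitious, block, Program.any, Instr.writesReg, Bool.or_false, Bool.false_or,
      Bool.or_eq_false_iff, beq_eq_false_iff_ne]
    omega
  have hp := length_le_m I.isPath_p₁.nodup_links
  have hb := length_le_m I.isPath_b₁.nodup_links
  refine Runs.seq (l := m * 5 + 5) (markPath_runs (l := I.p₁) (a := 2)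
    ⟨hr₂ 6 (by omega), fun i => by
      rw [F₂.arr 2 rfl, F₁.arr 2 rfl]; exact arrayOf_val (fun i => (I.p₁.get i).val) i⟩ ((F₂.arr 19 rfl).trans (F₁.arr 19 rfl)) r9 (by decide)
    (by decide) (by decide)) (fun τ₃ F₃ h₃ => ?_) (by omega)
  refine (markPath_runs (l := I.b₁) (a := 3) ⟨(F₃.reg 7 rfl).trans (hr₂ 7 (by omega)), fun i => by
      rw [F₃.arr 3 rfl, F₂.arr 3 rfl, F₁.arr 3 rfl]
      exact arrayOf_val (fun i => (I.b₁.get i).val) i⟩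
    ((F₃.arr 20 rfl).trans ((F₂.arr 20 rfl).trans (F₁.arr 20 rfl))) ((F₃.reg 9 rfl).trans r9)
    (by decide) (by decide) (by decide)).mono (by omega) fun τ₄ F₄ h₄ => ?_
  have hr₄ : ∀ r < 8, τ₄.reg r = I.encode.reg r := by
    intro r hr8
    rw [← hr₂ r hr8, ← F₃.reg r, F₄.reg r] <;>
    · simp only [markPath, forLoop, block, Program.any, Instr.writesReg, Bool.or_false,
        Bool.or_eq_false_iff, beq_eq_false_iff_ne]
      omega
  refine ⟨⟨?_, ?_, ?_, ?_, ?_, ?_, ?_⟩, ?_, ?_⟩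
  · exact ⟨hr₄ 0 (by omega), hr₄ 1 (by omega), hr₄ 2 (by omega), hr₄ 4 (by omega),
      hr₄ 5 (by omega), hr₄ 6 (by omega), hr₄ 7 (by omega)⟩
  · rw [F₄.reg 8 rfl, F₄.reg 9 rfl, F₄.reg 10 rfl, F₄.reg 11 rfl, F₃.reg 8 rfl, F₃.reg 9 rfl,
      F₃.reg 10 rfl, F₃.reg 11 rfl]
    exact ⟨r8, r9, r10, r11⟩
  -- No instruction produces the weight `1`. It is obtained as the sum of all failure probabilities,
  -- accumulated in weight register `1` while the arcs are built.
  · rw [F₄.wreg 0 rfl, F₄.wreg 1 rfl, F₃.wreg 0 rfl, F₃.wreg 1 rfl, F₂.wreg 0 rfl, F₂.wreg 1 rfl,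
      F₁.wreg 0 rfl, h₁.wreg, ← I.sum_prob, Finset.sum_range]
    exact ⟨rfl, Finset.sum_congr rfl fun e _ => arrayOf_val _ e⟩
  · rw [F₄.arr 0 rfl, F₄.arr 1 rfl, F₄.arr 2 rfl, F₄.arr 3 rfl, F₃.arr 0 rfl, F₃.arr 1 rfl,
      F₃.arr 2 rfl, F₃.arr 3 rfl, F₂.arr 0 rfl, F₂.arr 1 rfl, F₂.arr 2 rfl, F₂.arr 3 rfl,
      F₁.arr 0 rfl, F₁.arr 1 rfl, F₁.arr 2 rfl, F₁.arr 3 rfl]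
    exact ⟨rfl, rfl, rfl, rfl⟩
  · rw [F₄.arr 4 rfl, F₄.arr 5 rfl, F₄.arr 6 rfl, F₄.arr 7 rfl, F₃.arr 4 rfl, F₃.arr 5 rfl,
      F₃.arr 6 rfl, F₃.arr 7 rfl, F₂.arr 4 rfl, F₂.arr 5 rfl, h₁.tail, h₁.head]
    refine ⟨?_, ?_, a6, a7⟩ <;>
    · funext a
      simp [arcs]
  · exact ⟨(F₄.arr 19 rfl).trans h₃, h₄⟩
  · rw [F₄.warr 0 rfl, F₃.warr 0 rfl, F₂.warr 0 rfl, F₁.warr 0 rfl]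
    rfl
  · rw [F₄.warr 1 rfl, F₃.warr 1 rfl, F₂.warr 1 rfl, F₁.warr 1 rfl]
    rfl
  · intro r hr
    fin_cases hr <;>
    · rw [F₄.arr _ rfl, F₃.arr _ rfl, F₂.arr _ rfl, F₁.arr _ rfl]
      rfl

end Instance


namespace Instance

variable {n m : ℕ} (I : Instance n m)

/-! ### The graphs of an instance and their arcs -/

section Arcs

variable (x y : ℕ) {a b : ℕ} {A : ℕ → Prop}

theorem arcs_link (ha : a < 2 * m + 2) : (I.arcs x y).link a = a / 2 := if_pos ha

theorem arcs_rev (ha : a < 2 * m + 2) :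
    (I.arcs x y).rev a = if a % 2 = 0 then a + 1 else a - 1 := if_pos ha

theorem arcs_even (e : Fin m) : (I.arcs x y).tail (2 * e) = (I.ends e).1 ∧
    (I.arcs x y).head (2 * e) = (I.ends e).2 := by
  have h₁ : 2 * e.val < 2 * m := by omega
  have h₂ : 2 * e.val % 2 = 0 := by omega
  have h₃ : 2 * e.val / 2 = e := by omega
  simp only [arcs, h₁, h₂, h₃, if_true, arrayOf_val, and_self]

theorem arcs_odd (e : Fin m) : (I.arcs x y).tail (2 * e + 1) = (I.ends e).2 ∧
    (I.arcs x y).head (2 * e + 1) = (I.ends e).1 := by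
  have h₁ : 2 * e.val + 1 < 2 * m := by omega
  have h₂ : ¬ (2 * e.val + 1) % 2 = 0 := by omega
  have h₃ : (2 * e.val + 1) / 2 = e := by omega
  simp only [arcs, h₁, h₂, h₃, if_true, if_false, arrayOf_val, and_self]

theorem arcs_fictitious : (I.arcs x y).tail (2 * m) = x ∧ (I.arcs x y).head (2 * m) = y ∧
    (I.arcs x y).tail (2 * m + 1) = y ∧ (I.arcs x y).head (2 * m + 1) = x := by
  simp [arcs]

theorem arcs_tail_rev (ha : a < 2 * m + 2) :
    (I.arcs x y).tail ((I.arcs x y).rev a) = (I.arcs x y).head a ∧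
      (I.arcs x y).head ((I.arcs x y).rev a) = (I.arcs x y).tail a := by
  rw [I.arcs_rev x y ha]
  have hf := I.arcs_fictitious x y
  by_cases hm : a / 2 < m
  · have h₁ := I.arcs_even x y ⟨a / 2, hm⟩
    have h₂ := I.arcs_odd x y ⟨a / 2, hm⟩
    rcases Nat.mod_two_eq_zero_or_one a with h | h
    · have h₃ : 2 * (a / 2) = a := by omega
      simp_all
    · have h₃ : 2 * (a / 2) + 1 = a := by omega
      have h₄ : a - 1 = 2 * (a / 2) := by omega
      simp_all
  · obtain rfl | rfl : a = 2 * m ∨ a = 2 * m + 1 := by omega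
    · simp [hf]
    · simp [hf]

/-- The arcs of a link are `2 e` and `2 e + 1`, so a set of arcs that depends only on `a / 2` is
closed under reversal. -/
theorem arcs_isSymm (hlt : ∀ a, A a → a < 2 * m + 2) (hA : ∀ a b, a / 2 = b / 2 → A a → A b) :
    (I.arcs x y).IsSymm A where
  rev_mem {a} ha := hA a _ (by rw [I.arcs_rev x y (hlt a ha)]; grind) ha
  tail_rev {a} ha := (I.arcs_tail_rev x y (hlt a ha)).1
  head_rev {a} ha := (I.arcs_tail_rev x y (hlt a ha)).2
  rev_rev {a} ha := by
    have h₁ := hlt a ha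
    rw [I.arcs_rev x y h₁, I.arcs_rev x y (by grind)]
    grind
  eq_or_eq_rev {a b} ha hb := by
    rw [I.arcs_link x y (hlt a ha), I.arcs_link x y (hlt b hb), I.arcs_rev x y (hlt a ha)]
    grind

end Arcs

/-- The arcs of the links that are not in `F`. -/
def _root_.Survivable.linkArcs (F : Set (Fin m)) (a : ℕ) : Prop := ∃ e : Fin m, a / 2 = e ∧ e ∉ F

variable {F : Set (Fin m)} {a : ℕ}

theorem _root_.Survivable.linkArcs.lt (h : linkArcs F a) : a < 2 * m := by
  obtain ⟨e, h, -⟩ := h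
  omega

theorem linkArcs_exists_link (x y : ℕ) (ha : linkArcs F a) : ∃ e u v,
    (I.arcs x y).link a = e.val ∧ (I.arcs x y).tail a = Fin.val u ∧
      (I.arcs x y).head a = Fin.val v ∧ (I.G.deleteEdges F).IsLink e u v := by
  have hlt := ha.lt
  obtain ⟨e, he, heF⟩ := ha
  rw [I.arcs_link x y (by omega), he]
  rcases Nat.mod_two_eq_zero_or_one a with h | h
  · obtain rfl : a = 2 * e := by omega
    exact ⟨e, _, _, rfl, (I.arcs_even x y e).1, (I.arcs_even x y e).2,
      (Graph.deleteEdges_isLink ..).mpr ⟨Or.inl rfl, heF⟩⟩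
  · obtain rfl : a = 2 * e + 1 := by omega
    exact ⟨e, _, _, rfl, (I.arcs_odd x y e).1, (I.arcs_odd x y e).2,
      (Graph.deleteEdges_isLink ..).mpr ⟨Or.inr rfl, heF⟩⟩

theorem linkArcs_exists_arc (x y : ℕ) {e : Fin m} {u v : Fin n}
    (h : (I.G.deleteEdges F).IsLink e u v) : ∃ a, linkArcs F a ∧ (I.arcs x y).link a = e ∧
      (I.arcs x y).tail a = u ∧ (I.arcs x y).head a = v := by
  obtain ⟨h, he⟩ := (Graph.deleteEdges_isLink ..).mp h
  rcases h with h | h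
  · exact ⟨2 * e, ⟨e, by omega, he⟩, by rw [I.arcs_link x y (by omega)]; omega,
      by rw [(I.arcs_even x y e).1, h], by rw [(I.arcs_even x y e).2, h]⟩
  · exact ⟨2 * e + 1, ⟨e, by omega, he⟩, by rw [I.arcs_link x y (by omega)]; omega,
      by rw [(I.arcs_odd x y e).1, h], by rw [(I.arcs_odd x y e).2, h]⟩

theorem represents (F : Set (Fin m)) (x y : ℕ) :
    Represents (I.arcs x y) (linkArcs F) (I.G.deleteEdges F) Fin.val where
  symm := I.arcs_isSymm x y (fun a ha => by have := ha.lt; omega) fun a b h ⟨e, he⟩ =>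
    ⟨e, h ▸ he.1, he.2⟩
  injective := Fin.val_injective
  mem_vertexSet x := Set.mem_univ x
  exists_link a ha := I.linkArcs_exists_link x y ha
  exists_arc e u v h := I.linkArcs_exists_arc x y h

theorem represents_addFictitious (F : Set (Fin m)) (x y : Fin n) :
    Represents (I.arcs x y) (fun a => linkArcs F a ∨ a / 2 = m)
      (addFictitious (I.G.deleteEdges F) x y) fun o => o.elim m Fin.val where
  symm := I.arcs_isSymm x y (fun a ha => by
      rcases ha with ha | ha
      · have := ha.lt; omega
      · omega)
    fun a b h ha => ha.imp (fun ⟨e, he⟩ => ⟨e, h ▸ he.1, he.2⟩) fun h' => h ▸ h'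
  injective := by
    rintro (_ | e) (_ | e') h
    · rfl
    · have h : m = e'.val := h
      omega
    · have h : e.val = m := h
      omega
    · exact congrArg some (Fin.ext h)
  mem_vertexSet x := Or.inl (Set.mem_univ x)
  exists_link a ha := by
    rcases ha with ha | ha
    · obtain ⟨e, u, v, h⟩ := I.linkArcs_exists_link x y ha
      exact ⟨some e, u, v, h⟩
    · obtain ⟨h₁, h₂, h₃, h₄⟩ := I.arcs_fictitious x y
      refine ⟨none, ?_⟩
      obtain rfl | rfl : a = 2 * m ∨ a = 2 * m + 1 := by omega
      · exact ⟨x, y, by rw [I.arcs_link _ _ (by omega), ha]; rfl, h₁, h₂, Or.inl ⟨rfl, rfl⟩⟩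
      · exact ⟨y, x, by rw [I.arcs_link _ _ (by omega), ha]; rfl, h₃, h₄, Or.inr ⟨rfl, rfl⟩⟩
  exists_arc o u v h := by
    obtain ⟨h₁, h₂, h₃, h₄⟩ := I.arcs_fictitious x y
    rcases o with _ | e
    · rcases h with ⟨rfl, rfl⟩ | ⟨rfl, rfl⟩
      · exact ⟨2 * m, Or.inr (by omega), by rw [I.arcs_link _ _ (by omega)]; simp, h₁, h₂⟩
      · exact ⟨2 * m + 1, Or.inr (by omega), by rw [I.arcs_link _ _ (by omega)]; simp; omega, h₃, h₄⟩
    · obtain ⟨a, ha, h⟩ := I.linkArcs_exists_arc x y (e := e) h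
      exact ⟨a, Or.inl ha, h⟩

theorem m_pos {n m : ℕ} (I : Instance n m) : 0 < m := by
  refine Nat.pos_of_ne_zero ?_
  rintro rfl
  simpa using I.sum_prob

/-- There is a node, and there is a link because the probabilities add up to `1`. Hence constants
and multiples of `n` or `m` can all be absorbed into multiples of `n * m`. -/
theorem bounds {n m : ℕ} (I : Instance n m) : 1 ≤ n * m ∧ n ≤ n * m ∧ m ≤ n * m :=
  have hn := I.s₂.pos
  ⟨Nat.mul_pos hn I.m_pos, Nat.le_mul_of_pos_right n I.m_pos, Nat.le_mul_of_pos_left m hn⟩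

end Instance

/-! ### Search for a walk -/

/-- Register `ln` holds the length of the walk `π`, array `ls` its links, and array `mk` marks its
arcs. -/
structure State.HoldsWalk (σ : State) (N : Arcs) (M ln ls mk : ℕ) (π : List ℕ) : Prop where
  length : σ.reg ln = π.length
  link : ∀ i (hi : i < π.length), σ.arr ls i = N.link π[i]
  mark : ∀ a < M, σ.arr mk a = if a ∈ π then 1 else 0

theorem State.HoldsWalk.frame {σ τ : State} {N : Arcs} {M ln ls mk : ℕ} {π : List ℕ}
    (h : σ.HoldsWalk N M ln ls mk π) {P : Program} (hF : Frame P σ τ)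
    (h₁ : P.any (Instr.writesReg ln) = false) (h₂ : P.any (Instr.writesArr ls) = false)
    (h₃ : P.any (Instr.writesArr mk) = false) : τ.HoldsWalk N M ln ls mk π :=
  ⟨(hF.reg ln h₁).trans h.length, by rw [hF.arr ls h₂]; exact h.link,
    by rw [hF.arr mk h₃]; exact h.mark⟩

theorem State.HoldsWalk.holdsList {σ : State} {N : Arcs} {M ln ls mk m : ℕ} {π : List ℕ}
    {l : List (Fin m)} (h : σ.HoldsWalk N M ln ls mk π) (hl : π.map N.link = l.map Fin.val) :
    σ.HoldsList ln ls l := by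
  have hlen : π.length = l.length := by simpa using congrArg List.length hl
  refine ⟨h.length.trans hlen, fun i => ?_⟩
  rw [h.link i (by omega)]
  have := List.getElem_of_eq hl (i := i) (by simp [hlen])
  simpa using this

/-- Search a shortest walk and extract it. -/
def searchWalk (mk ls ln : ℕ) : Program := .seq search (extract mk ls ln)

namespace Instance

variable {n m : ℕ} {I : Instance n m} {σ : State} {A : ℕ → Prop} {W : ℕ → ℝ} {mk ls ln : ℕ}
  {x y : ℕ}

theorem Memory.search_runs (h : I.Memory x y σ) (hA : ∀ a < 2 * m + 2, σ.arr 8 a = 1 ↔ A a)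
    (hlt : ∀ a, A a → a < 2 * m + 2)
    (hend : ∀ a, A a → (I.arcs x y).tail a < n ∧ (I.arcs x y).head a < n)
    (hW : ∀ a, A a → σ.warr 1 a = W a) (hW₀ : ∀ a, A a → 0 ≤ W a) :
    Runs search (161 * (n * m)) σ fun τ => ∃ T,
      (I.arcs x y).SpanningTree A W n I.t₂ (τ.arr 9) (τ.warr 2) (τ.arr 10) T := by
  obtain ⟨h₁, h₂, h₃⟩ := I.bounds
  refine (Survivable.search_runs (h.searchInput hA hlt hW) I.t₂.2 hend hW₀).mono ?_ fun _ _ h => h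
  -- Together with the additive `8` this gives `64 + 89 + 8 = 161`.
  have : n * ((2 * m + 2) * 32 + 25) = 64 * (n * m) + 89 * n := by ring
  omega

theorem Memory.searchWalk_runs (h : I.Memory x y σ) (hA : ∀ a < 2 * m + 2, σ.arr 8 a = 1 ↔ A a)
    (hlt : ∀ a, A a → a < 2 * m + 2)
    (hend : ∀ a, A a → (I.arcs x y).tail a < n ∧ (I.arcs x y).head a < n)
    (hW : ∀ a, A a → σ.warr 1 a = W a) (hW₀ : ∀ a, A a → 0 ≤ W a)
    (hex : ∃ π, (I.arcs x y).Walk A I.s₂ π I.t₂) (hmk : 12 ≤ mk) (hls : 12 ≤ ls) (hml : mk ≠ ls)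
    (hln : 19 ≤ ln) :
    Runs (searchWalk mk ls ln) (190 * (n * m)) σ fun τ => ∃ T,
      (I.arcs x y).SpanningTree A W n I.t₂ (τ.arr 9) (τ.warr 2) (τ.arr 10) T ∧
      τ.arr 9 I.s₂ ≠ 0 ∧ τ.HoldsWalk (I.arcs x y) (2 * m + 2) ln ls mk (T I.s₂) := by
  obtain ⟨h₁, h₂, h₃⟩ := I.bounds
  refine Runs.seq (l := (2 * m + 2) * 3 + n * 9 + 8) (h.search_runs hA hlt hend hW hW₀)
    (fun τ hF ⟨T, hT⟩ => ?_) (by omega)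
  obtain ⟨π, hπ⟩ := hex
  have hv := hT.vis_of_walk hπ
  have hτ : I.Memory x y τ := h.frame hF rfl
  refine (extract_runs (hτ.searchInput (A := A) (W := W) (by rw [hF.arr 8 rfl]; exact hA) hlt
    (by rw [hF.warr 1 rfl]; exact hW)) hτ.arcs.2.2.1 hτ.reg.2.2.2.1 hT I.s₂.2 hv hmk hls hml
    hln).mono le_rfl fun υ hF' hυ => ?_
  have e₁ : ∀ r < 12, υ.arr r = τ.arr r := fun r hr => hF'.arr r (by
    simp only [extract, forLoop, block, Program.any, Instr.writesArr, Bool.false_or, Bool.or_false,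
      Bool.or_eq_false_iff, beq_eq_false_iff_ne]
    omega)
  have e₂ : υ.warr 2 = τ.warr 2 := hF'.warr 2 rfl
  rw [e₁ 9 (by omega), e₁ 10 (by omega), e₂]
  exact ⟨T, hT, hv, hυ.1, hυ.2.1, hυ.2.2⟩

end Instance


/-! ### Two paths with few common links -/

/-- Arc `13` is on the path of array `12` and its opposite is not on the path of array `13`, or
vice versa. -/
def inUnion : Program :=
  .seq (block [.load 17 7 13, .const 19 0, .load 16 12 13, .load 18 13 17]) <|
    .seq (.ite (.eq 16 9) (.ite (.eq 18 8) (.instr (.const 19 1)) (block [])) (block [])) <|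
      .seq (block [.load 16 13 13, .load 18 12 17]) <|
        .ite (.eq 16 9) (.ite (.eq 18 8) (.instr (.const 19 1)) (block [])) (block [])

/-- Arc `13` is marked in array `11`, and it is not fictitious. -/
def inRealUnion : Program :=
  .seq (block [.load 16 11 13, .load 17 6 13, .const 19 0]) <|
    .ite (.eq 16 9) (.ite (.lt 17 1) (.instr (.const 19 1)) (block [])) (block [])

/-- Arc `13` is marked in array `11`, and it is not on the path of array `14`, unless it is on the
paths of arrays `12` and `13`. -/
def inRemainder : Program :=
  .seq (block [.load 16 11 13, .load 17 14 13, .const 19 0]) <|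
    .ite (.eq 16 9) (.ite (.eq 17 8) (.instr (.const 19 1))
      (.seq (block [.load 17 12 13, .load 18 13 13])
        (.ite (.eq 17 9) (.ite (.eq 18 9) (.instr (.const 19 1)) (block [])) (block []))))
      (block [])

/-- Arc `13` is not fictitious, and it is on the path of array `15` or its link is marked in array
`21`. -/
def inBackup : Program :=
  .seq (block [.load 16 6 13, .load 17 15 13, .load 18 21 16, .const 19 0]) <|
    .ite (.lt 16 1) (.ite (.eq 17 9) (.instr (.const 19 1))
      (.ite (.eq 18 9) (.instr (.const 19 1)) (block []))) (block [])

/-- From a path that is marked in array `12`, whose arcs have weight `1`, compute a primary path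
and a backup path. -/
def pair : Program :=
  .seq (searchWalk 13 23 31) <| .seq (fill 11 inUnion) <| .seq (fill 8 inRealUnion) <|
    .seq (searchWalk 14 24 22) <| .seq (fill 8 inRemainder) <| .seq (searchWalk 15 25 23) <|
      .seq (fill 8 inBackup) (searchWalk 16 26 24)

/-- If `s` could not reach `t`, the cut condition would fail for the set of nodes that can. It turns
the counting lemmas on cuts into the existence of walks. -/
theorem Arcs.exists_walk_of_enter {N : Arcs} {A : ℕ → Prop} {s t : ℕ}
    (h : ∀ S : ℕ → Prop, ¬ S s → S t → ∃ a, A a ∧ ¬ S (N.tail a) ∧ S (N.head a)) :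
    ∃ π, N.Walk A s π t := by
  by_contra hs
  obtain ⟨a, ha, h₁, π, h₂⟩ := h (fun v => ∃ π, N.Walk A v π t) hs ⟨[], rfl⟩
  exact h₁ ⟨a :: π, ha, rfl, h₂⟩

section Runs

variable {τ : State}

theorem inUnion_run (h₈ : τ.reg 8 = 0) (h₉ : τ.reg 9 = 1) : (inUnion.run τ).reg 19 =
    if τ.arr 12 (τ.reg 13) = 1 ∧ τ.arr 13 (τ.arr 7 (τ.reg 13)) = 0 ∨
      τ.arr 13 (τ.reg 13) = 1 ∧ τ.arr 12 (τ.arr 7 (τ.reg 13)) = 0 then 1 else 0 := by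
  simp only [inUnion, block, Program.run]
  by_cases h₁ : τ.arr 12 (τ.reg 13) = 1 <;>
  by_cases h₂ : τ.arr 13 (τ.arr 7 (τ.reg 13)) = 0 <;>
  by_cases h₃ : τ.arr 13 (τ.reg 13) = 1 <;>
  by_cases h₄ : τ.arr 12 (τ.arr 7 (τ.reg 13)) = 0 <;>
  simp [Test.Holds, h₈, h₉, h₁, h₂, h₃, h₄]

theorem inRealUnion_run (h₉ : τ.reg 9 = 1) : (inRealUnion.run τ).reg 19 =
    if τ.arr 11 (τ.reg 13) = 1 ∧ τ.arr 6 (τ.reg 13) < τ.reg 1 then 1 else 0 := by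
  simp only [inRealUnion, block, Program.run]
  by_cases h₁ : τ.arr 11 (τ.reg 13) = 1 <;>
  by_cases h₂ : τ.arr 6 (τ.reg 13) < τ.reg 1 <;>
  simp [Test.Holds, h₉, h₁, h₂]

theorem inRemainder_run (h₈ : τ.reg 8 = 0) (h₉ : τ.reg 9 = 1) : (inRemainder.run τ).reg 19 =
    if τ.arr 11 (τ.reg 13) = 1 ∧ (τ.arr 14 (τ.reg 13) = 0 ∨
      τ.arr 12 (τ.reg 13) = 1 ∧ τ.arr 13 (τ.reg 13) = 1) then 1 else 0 := by
  simp only [inRemainder, block, Program.run]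
  by_cases h₁ : τ.arr 11 (τ.reg 13) = 1 <;>
  by_cases h₂ : τ.arr 14 (τ.reg 13) = 0 <;>
  by_cases h₃ : τ.arr 12 (τ.reg 13) = 1 <;>
  by_cases h₄ : τ.arr 13 (τ.reg 13) = 1 <;>
  simp [Test.Holds, h₈, h₉, h₁, h₂, h₃, h₄]

theorem inBackup_run (h₉ : τ.reg 9 = 1) : (inBackup.run τ).reg 19 =
    if τ.arr 6 (τ.reg 13) < τ.reg 1 ∧ (τ.arr 15 (τ.reg 13) = 1 ∨
      τ.arr 21 (τ.arr 6 (τ.reg 13)) = 1) then 1 else 0 := by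
  simp only [inBackup, block, Program.run]
  by_cases h₁ : τ.arr 6 (τ.reg 13) < τ.reg 1 <;>
  by_cases h₂ : τ.arr 15 (τ.reg 13) = 1 <;>
  by_cases h₃ : τ.arr 21 (τ.arr 6 (τ.reg 13)) = 1 <;>
  simp [Test.Holds, h₉, h₁, h₂, h₃]

end Runs

namespace Instance

variable {n m : ℕ} {I : Instance n m} {σ : State} {A : ℕ → Prop} {x y : ℕ} {P : List ℕ}
  {g : List (Fin m)}

/-- What `pair` computes. -/
structure IsPair (I : Instance n m) (x y : ℕ) (A : ℕ → Prop) (g : List (Fin m))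
    (P' B b : List ℕ) : Prop where
  walk : (I.arcs x y).Walk A I.s₂ P' I.t₂
  simple : (I.arcs x y).Simple I.s₂ P'
  real : ∀ a ∈ P', a < 2 * m
  walk_B : (I.arcs x y).Walk A I.s₂ B I.t₂
  simple_B : (I.arcs x y).Simple I.s₂ B
  walk_b : (I.arcs x y).Walk (fun a => a < 2 * m ∧ (a ∈ B ∨ a / 2 ∈ g.map Fin.val)) I.s₂ b I.t₂
  simple_b : (I.arcs x y).Simple I.s₂ b
  common : ∀ a ∈ P', ∀ c ∈ B, (I.arcs x y).link a = (I.arcs x y).link c →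
    ∀ ρ, (I.arcs x y).Walk A I.s₂ ρ I.t₂ → a ∈ ρ

/-- Four searches: `Q` against the weights of `P`; the primary path `P'` among the real arcs of the
union; `B` in the remainder; and the backup path among the real arcs of `B` and the links of `g`,
which stand for the fictitious link. The weights stay in memory, but they matter only for the choice
of `Q`, which makes common links separate. -/
theorem Memory.pair_runs (h : I.Memory x y σ) (hsymm : (I.arcs x y).IsSymm A)
    (hA : ∀ a < 2 * m + 2, σ.arr 8 a = 1 ↔ A a) (hlt : ∀ a, A a → a < 2 * m + 2)
    (hend : ∀ a < 2 * m + 2, (I.arcs x y).tail a < n ∧ (I.arcs x y).head a < n)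
    (hP : (I.arcs x y).Walk A I.s₂ P I.t₂) (hPs : (I.arcs x y).Simple I.s₂ P)
    (hPr : ∀ a ∈ P, a < 2 * m) (hm : ∀ a < 2 * m + 2, σ.arr 12 a = if a ∈ P then 1 else 0)
    (hW : ∀ a < 2 * m + 2, σ.warr 1 a = if a ∈ P then 1 else 0) (hg : σ.arr 21 = Survivable.marks g)
    (hreach : ∀ B, (I.arcs x y).Walk A I.s₂ B I.t₂ →
      ∃ π, (I.arcs x y).Walk (fun a => a < 2 * m ∧ (a ∈ B ∨ a / 2 ∈ g.map Fin.val)) I.s₂ π I.t₂) :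
    Runs pair (1300 * (n * m)) σ fun τ => ∃ P' B b, I.IsPair x y A g P' B b ∧
      τ.HoldsWalk (I.arcs x y) (2 * m + 2) 22 24 14 P' ∧
      τ.HoldsWalk (I.arcs x y) (2 * m + 2) 24 26 16 b := by
  classical
  obtain ⟨n₁, n₂, n₃⟩ := I.bounds
  set N := I.arcs x y with hN
  have hW₀ : ∀ a, 0 ≤ if a ∈ P then (1 : ℝ) else 0 := fun a => by split_ifs <;> norm_num
  have hrev : ∀ a < 2 * m + 2, N.rev a < 2 * m + 2 := fun a ha => by
    rw [hN, I.arcs_rev x y ha]; grind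
  have hlink : ∀ a < 2 * m + 2, N.link a = a / 2 := fun a ha => I.arcs_link x y ha
  refine Runs.seq (l := 1110 * (n * m)) (h.searchWalk_runs hA hlt (fun a ha => hend a (hlt a ha))
    (fun a ha => hW a (hlt a ha)) (fun a _ => hW₀ a) ⟨P, hP⟩ (by decide) (by decide) (by decide)
    (by decide)) (fun σ₁ F₁ ⟨T, hT, hv, hQm⟩ => ?_) (by omega)
  have M₁ := h.frame F₁ rfl
  have hQ := hT.walk _ I.s₂.2 hv
  have hQs := hT.simple _ I.s₂.2 hv
  set Q := T I.s₂ with hQdef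
  set U : ℕ → Prop := fun a => a ∈ P ∧ N.rev a ∉ Q ∨ a ∈ Q ∧ N.rev a ∉ P with hU
  have hUA : ∀ a, U a → A a := fun a ha => ha.elim (fun h => hP.mem h.1) fun h => hQ.mem h.1
  have hUlt : ∀ a, U a → a < 2 * m + 2 := fun a ha => hlt a (hUA a ha)
  have m₁ : ∀ a < 2 * m + 2, σ₁.arr 12 a = if a ∈ P then 1 else 0 := by
    rw [F₁.arr 12 rfl]; exact hm
  have bound : ∀ P : Program, P.size ≤ 20 → (2 * m + 2) * (P.size + 3) + 2 ≤ 100 * (n * m) :=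
    fun P hP => by
      have := Nat.mul_le_mul_left (2 * m + 2) (show P.size + 3 ≤ 23 by omega)
      omega
  refine Runs.seq (k := 100 * (n * m)) (l := 1010 * (n * m)) ((fill_runs
    (fun a => if U a then 1 else 0) rfl rfl rfl rfl M₁.reg'.2.2.1 fun a ha τ hF hr => ?_).mono
    (bound _ (by decide)) fun _ _ h => h) (fun σ₂ F₂ f₂ => ?_) (by omega)
  · have h₁ := M₁.frame hF rfl
    rw [inUnion_run h₁.reg'.1 h₁.reg'.2.1, hr, hF.arr 12 rfl, hF.arr 13 rfl, h₁.arcs.2.2.2,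
      m₁ a ha, m₁ _ (hrev a ha), hQm.mark a ha, hQm.mark _ (hrev a ha)]
    simp [hU]
  have M₂ := M₁.frame F₂ rfl
  refine Runs.seq (k := 100 * (n * m)) (l := 910 * (n * m)) ((fill_runs
    (fun a => if U a ∧ a < 2 * m then 1 else 0) rfl rfl rfl rfl M₂.reg'.2.2.1
    fun a ha τ hF hr => ?_).mono (bound _ (by decide)) fun _ _ h => h)
    (fun σ₃ F₃ f₃ => ?_) (by omega)
  · have h₁ := M₂.frame hF rfl
    rw [inRealUnion_run h₁.reg'.2.1, hr, hF.arr 11 rfl, f₂ a ha, h₁.arcs.2.2.1,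
      hlink a ha, h₁.reg.2.1]
    have : a / 2 < m ↔ a < 2 * m := by omega
    simp [this]
  have M₃ := M₂.frame F₃ rfl
  have hW₃ : ∀ a, U a → σ₃.warr 1 a = if a ∈ P then 1 else 0 := fun a ha => by
    rw [F₃.warr 1 rfl, F₂.warr 1 rfl, F₁.warr 1 rfl, hW a (hUlt a ha)]
  refine Runs.seq (l := 720 * (n * m)) (M₃.searchWalk_runs (A := fun a => U a ∧ a < 2 * m)
    (W := fun a => if a ∈ P then 1 else 0) (fun a ha => ?_) (fun a ha => hUlt a ha.1)
    (fun a ha => hend a (hUlt a ha.1)) (fun a ha => hW₃ a ha.1) (fun a _ => hW₀ a) ?_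
    (by decide) (by decide) (by decide) (by decide)) (fun σ₄ F₄ ⟨T₄, hT₄, hv₄, hP'm⟩ => ?_)
    (by omega)
  · rw [f₃ a ha]; simp
  · refine Arcs.exists_walk_of_enter fun S hs ht => ?_
    -- Both fictitious arcs, `2 m` and `2 m + 1`, carry the link number `m`, so all unreal arcs
    -- belong to one link.
    have hreal : ∀ a ∈ Q, ∀ b ∈ Q, ¬ a < 2 * m → ¬ b < 2 * m → N.link a = N.link b := by
      intro a ha b hb h₁ h₂
      have h₃ := hlt a (hQ.mem ha)
      have h₄ := hlt b (hQ.mem hb)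
      rw [hlink a h₃, hlink b h₄]
      omega
    obtain ⟨a, ha, h₁⟩ := Arcs.exists_enter_union hsymm hP hPs hQ hQs hreal hs ht
    refine ⟨a, ?_, h₁⟩
    rcases ha with ha | ha
    exacts [⟨Or.inl ha, hPr a ha.1⟩, ⟨Or.inr ⟨ha.1, ha.2.1⟩, ha.2.2⟩]
  have M₄ := M₃.frame F₄ rfl
  have hP' := hT₄.walk _ I.s₂.2 hv₄
  have hPs' := hT₄.simple _ I.s₂.2 hv₄
  set P' := T₄ I.s₂
  refine Runs.seq (k := 100 * (n * m)) (l := 620 * (n * m)) ((fill_runs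
    (fun a => if U a ∧ (a ∈ P' → a ∈ P ∧ a ∈ Q) then 1 else 0) rfl rfl rfl rfl M₄.reg'.2.2.1
    fun a ha τ hF hr => ?_).mono (bound _ (by decide)) fun _ _ h => h)
    (fun σ₅ F₅ f₅ => ?_) (by omega)
  · have h₁ := M₄.frame hF rfl
    rw [inRemainder_run h₁.reg'.1 h₁.reg'.2.1, hr, hF.arr 11 rfl, hF.arr 12 rfl, hF.arr 13 rfl,
      hF.arr 14 rfl, F₄.arr 11 rfl, F₄.arr 12 rfl, F₄.arr 13 rfl, F₃.arr 11 rfl, F₃.arr 12 rfl,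
      F₃.arr 13 rfl, F₂.arr 12 rfl, F₂.arr 13 rfl, f₂ a ha, m₁ a ha, hQm.mark a ha,
      hP'm.mark a ha]
    by_cases hu : U a <;> by_cases hp : a ∈ P' <;> simp [hu, hp]
  have M₅ := M₄.frame F₅ rfl
  have hW₅ : ∀ a, U a → σ₅.warr 1 a = if a ∈ P then 1 else 0 := fun a ha => by
    rw [F₅.warr 1 rfl, F₄.warr 1 rfl, hW₃ a ha]
  refine Runs.seq (l := 430 * (n * m)) (M₅.searchWalk_runs
    (A := fun a => U a ∧ (a ∈ P' → a ∈ P ∧ a ∈ Q))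
    (W := fun a => if a ∈ P then 1 else 0) (fun a ha => ?_) (fun a ha => hUlt a ha.1)
    (fun a ha => hend a (hUlt a ha.1)) (fun a ha => hW₅ a ha.1) (fun a _ => hW₀ a) ?_
    (by decide) (by decide) (by decide) (by decide)) (fun σ₆ F₆ ⟨T₆, hT₆, hv₆, hBm⟩ => ?_)
    (by omega)
  · rw [f₅ a ha]; simp
  · refine Arcs.exists_walk_of_enter fun S hs ht => ?_
    obtain ⟨a, ha, h₁, h₂⟩ := Arcs.exists_enter_remainder hsymm hP hPs hQ hQs
      (hP'.mono fun a _ ha => hUA a ha.1) hPs' (fun a ha => (hP'.mem ha).1) hs ht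
    exact ⟨a, ⟨ha, h₁⟩, h₂⟩
  have M₆ := M₅.frame F₆ rfl
  have hB := hT₆.walk _ I.s₂.2 hv₆
  have hBs := hT₆.simple _ I.s₂.2 hv₆
  set B := T₆ I.s₂
  refine Runs.seq (k := 100 * (n * m)) (l := 330 * (n * m)) ((fill_runs
    (fun a => if a < 2 * m ∧ (a ∈ B ∨ a / 2 ∈ g.map Fin.val) then 1 else 0) rfl rfl rfl rfl
    M₆.reg'.2.2.1 fun a ha τ hF hr => ?_).mono (bound _ (by decide)) fun _ _ h => h)
    (fun σ₇ F₇ f₇ => ?_) (by omega)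
  · have h₁ := M₆.frame hF rfl
    have h₂ : a / 2 < m ↔ a < 2 * m := by omega
    rw [inBackup_run h₁.reg'.2.1, hr, hF.arr 15 rfl, hF.arr 21 rfl, h₁.arcs.2.2.1,
      hlink a ha, h₁.reg.2.1, hBm.mark a ha, F₆.arr 21 rfl, F₅.arr 21 rfl, F₄.arr 21 rfl,
      F₃.arr 21 rfl, F₂.arr 21 rfl, F₁.arr 21 rfl, hg, Survivable.marks]
    simp [h₂]
  have M₇ := M₆.frame F₇ rfl
  refine (M₇.searchWalk_runs
    (A := fun a => a < 2 * m ∧ (a ∈ B ∨ a / 2 ∈ g.map Fin.val))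
    (W := fun a => if a ∈ P then 1 else 0) (fun a ha => ?_) (fun a ha => by omega)
    (fun a ha => hend a (by omega)) (fun a ha => ?_) (fun a _ => hW₀ a) (hreach B ?_)
    (by decide) (by decide) (by decide) (by decide)).mono (by omega)
    fun σ₈ F₈ ⟨T₈, hT₈, hv₈, hbm⟩ => ?_
  · rw [f₇ a ha]; simp [or_iff_not_imp_left]
  · rw [F₇.warr 1 rfl, F₆.warr 1 rfl, F₅.warr 1 rfl, F₄.warr 1 rfl, F₃.warr 1 rfl, F₂.warr 1 rfl,
      F₁.warr 1 rfl, hW a (by omega)]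
  · exact hB.mono fun a _ ha => hUA a ha.1
  refine ⟨P', B, T₈ I.s₂, ⟨hP'.mono fun a _ ha => hUA a ha.1, hPs', fun a ha => (hP'.mem ha).2,
    hB.mono fun a _ ha => hUA a ha.1, hBs, hT₈.walk _ I.s₂.2 hv₈, hT₈.simple _ I.s₂.2 hv₈,
    fun a ha c hc hac => ?_⟩, ?_, hbm⟩
  · exact hT.mem_of_common hsymm hP hPs I.s₂.2 hv (hP'.mem ha).1 (hB.mem hc).1
      (fun hca => hca ▸ (hB.mem hc).2 (hca ▸ ha)) hac
  · exact ((((hP'm.frame F₅ rfl rfl rfl).frame F₆ rfl rfl rfl).frame F₇ rfl rfl rfl).frame F₈ rfl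
      rfl rfl)

end Instance


/-! ### Segments of `b₁`, and computed paths as results of the algorithm -/

section Segments

variable {α β : Type*} {G : Graph α β} {u w : α} {es : List β} {vs : List α}

/-- The nodes are numbered by all of `ℕ`, with arbitrary values past the end, to fit the counters of
the program's loops. -/
theorem IsWalk.exists_nodes (h : IsWalk G u es w vs) : ∃ v : ℕ → α, v 0 = u ∧ v es.length = w ∧
    (∀ k (hk : k < es.length), G.IsLink es[k] (v k) (v (k + 1))) ∧
    (∀ k, v k ∈ G.vertexSet) ∧ ∀ x, x ∈ vs ↔ ∃ k ≤ es.length, v k = x := by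
  induction h with
  | @nil u hu => exact ⟨fun _ => u, rfl, rfl, by simp, fun _ => hu, by simp [eq_comm]⟩
  | @cons a w t e es vs hl h ih =>
    obtain ⟨v, rfl, hv, hlink, hmem, hvs⟩ := ih
    refine ⟨fun k => Nat.casesOn k a v, rfl, hv, ?_, ?_, fun x => ?_⟩
    · rintro (_ | k) hk
      exacts [hl, hlink k (by simpa using hk)]
    · rintro (_ | k)
      exacts [hl.left_mem, hmem k]
    · rw [List.mem_cons, hvs]
      constructor
      · rintro (rfl | ⟨k, hk, rfl⟩)
        exacts [⟨0, by simp, rfl⟩, ⟨k + 1, by simpa using hk, rfl⟩]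
      · rintro ⟨_ | k, hk, rfl⟩
        exacts [Or.inl rfl, Or.inr ⟨k, by simpa using hk, rfl⟩]

theorem walkFromTo_segment {v : ℕ → α}
    (hl : ∀ k (hk : k < es.length), G.IsLink es[k] (v k) (v (k + 1)))
    (hv : ∀ k, v k ∈ G.vertexSet) {i j : ℕ} (hij : i ≤ j) (hj : j ≤ es.length) :
    WalkFromTo G (v i) ((es.take j).drop i) (v j) := by
  induction j, hij using Nat.le_induction with
  | base =>
    rw [List.drop_eq_nil_of_le (by simp)]
    exact ⟨_, .nil (hv i)⟩
  | succ j hij ih =>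
    obtain ⟨vs, h⟩ := ih (by omega)
    rw [List.take_succ_eq_append_getElem (by omega), List.drop_append_of_le_length (by simp; omega)]
    exact ⟨_, h.append (.cons (hl j (by omega)) (.nil (hv _)))⟩

end Segments

namespace Instance

variable {n m : ℕ} {I : Instance n m}

/-- The node `x` may come after `y` on `b₁`. The links are described without regard to the
direction, since the program only marks those between the smaller and the larger position. -/
theorem segmentOfB₁ {v : ℕ → Fin n} (h₀ : v 0 = I.s₁) (h₁ : v I.b₁.length = I.t₁)
    (hl : ∀ k (hk : k < I.b₁.length), I.G.IsLink I.b₁[k] (v k) (v (k + 1))) {i j : ℕ}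
    (hi : i ≤ I.b₁.length) (hj : j ≤ I.b₁.length) : ∃ g, I.SegmentOfB₁ (v i) (v j) g ∧
      ∀ e, e ∈ g ↔ e ∈ (I.b₁.take (max i j)).drop (min i j) := by
  have hv : ∀ k, v k ∈ I.G.vertexSet := fun k => Set.mem_univ _
  have key : ∀ i j, i ≤ j → j ≤ I.b₁.length → I.b₁ = I.b₁.take i ++ (I.b₁.take j).drop i ++
      I.b₁.drop j ∧ WalkFromTo I.G I.s₁ (I.b₁.take i) (v i) ∧
      WalkFromTo I.G (v i) ((I.b₁.take j).drop i) (v j) ∧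
      WalkFromTo I.G (v j) (I.b₁.drop j) I.t₁ := by
    intro i j hij hj
    have h₂ := walkFromTo_segment hl hv (Nat.zero_le i) (hij.trans hj)
    have h₃ := walkFromTo_segment hl hv hj le_rfl
    rw [List.drop_zero, h₀] at h₂
    rw [List.take_length, h₁] at h₃
    refine ⟨?_, h₂, walkFromTo_segment hl hv hij hj, h₃⟩
    have : I.b₁.take i = (I.b₁.take j).take i := by rw [List.take_take, min_eq_left hij]
    rw [this, List.take_append_drop, List.take_append_drop]
  rcases le_total i j with hij | hij
  · rw [max_eq_right hij, min_eq_left hij]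
    exact ⟨_, Or.inl ⟨_, _, key i j hij hj⟩, fun e => Iff.rfl⟩
  · rw [max_eq_left hij, min_eq_right hij]
    obtain ⟨h₂, h₃, h₄, h₅⟩ := key j i hij hi
    refine ⟨((I.b₁.take i).drop j).reverse, Or.inr ⟨_, _, ?_, h₃, ?_, h₅⟩, fun e => by simp⟩
    · rw [List.reverse_reverse]; exact h₂
    · rw [List.reverse_reverse]; exact h₄

theorem SegmentOfB₁.walkFromTo {x y : Fin n} {g : List (Fin m)} (h : I.SegmentOfB₁ x y g) :
    WalkFromTo I.G x g y := by
  obtain ⟨_, _, -, -, h, -⟩ | ⟨_, _, -, -, h, -⟩ := h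
  · exact h
  · obtain ⟨vs, h⟩ := h
    exact ⟨_, by simpa using h.reverse⟩

variable {F : Set (Fin m)} {P' B b : List ℕ}

/-- Without a fictitious link, the two computed paths form a tunable pair. -/
theorem IsPair.tunablePair {x y : ℕ} (h : I.IsPair x y (linkArcs F) [] P' B b) : ∃ p q,
    P'.map (I.arcs x y).link = p.map Fin.val ∧ b.map (I.arcs x y).link = q.map Fin.val ∧
      TunablePair (I.G.deleteEdges F) I.s₂ I.t₂ p q := by
  have hR := I.represents F x y
  have hb : ∀ a ∈ b, a ∈ B := fun a ha => by simpa using (h.walk_b.mem ha).2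
  obtain ⟨p, hp, hpp⟩ := hR.isPath_of_walk h.walk h.simple
  obtain ⟨q, hq, hqp⟩ := hR.isPath_of_walk (h.walk_b.mono fun a ha _ => h.walk_B.mem (hb a ha))
    h.simple_b
  refine ⟨p, q, hp, hq, hR.tunablePair (P' := P') (B' := B) hpp hqp hp (fun e he => ?_)
    (fun a ha => h.walk.mem ha) h.common⟩
  obtain ⟨a, ha, hae⟩ := List.mem_map.1 (hq ▸ List.mem_map_of_mem he : e.val ∈ b.map _)
  exact ⟨a, hb a ha, hae⟩

/-- With the fictitious link, the backup path can use the segment of `b₁` instead. -/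
theorem exists_walk_of_segment {x y : Fin n} {g : List (Fin m)} (hg : I.SegmentOfB₁ x y g) {u w : ℕ}
    (hB : (I.arcs x y).Walk (fun a => linkArcs F a ∨ a / 2 = m) u B w) :
    ∃ π, (I.arcs x y).Walk (fun a => a < 2 * m ∧ (a ∈ B ∨ a / 2 ∈ g.map Fin.val)) u π w := by
  have hwalk : ∀ {u w : Fin n} {l : List (Fin m)}, (∀ e ∈ l, e ∈ g) → WalkFromTo I.G u l w →
      ∃ π, (I.arcs x y).Walk (fun a => a < 2 * m ∧ a / 2 ∈ g.map Fin.val) u π w := by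
    rintro u w l hl ⟨vs, hw⟩
    have hw' : IsWalk (I.G.deleteEdges ∅) u l w vs := hw.deleteEdges (by simp)
    obtain ⟨π, hπ, hπl, -⟩ := (I.represents ∅ x y).walk_of_isWalk hw'
    refine ⟨π, hπ.mono fun a ha hA => ⟨hA.lt, ?_⟩⟩
    have : (I.arcs x y).link a ∈ l.map Fin.val := hπl ▸ List.mem_map_of_mem ha
    rw [I.arcs_link _ _ (by have := hA.lt; omega)] at this
    obtain ⟨e, he, hea⟩ := List.mem_map.1 this
    exact hea ▸ List.mem_map_of_mem (hl e he)
  obtain ⟨vs, hw⟩ := hg.walkFromTo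
  obtain ⟨π₁, h₁⟩ := hwalk (fun _ h => h) ⟨vs, hw⟩
  -- The path `B` may traverse the fictitious link in either direction, so the segment is needed in
  -- both.
  obtain ⟨π₂, h₂⟩ := hwalk (fun _ h => List.mem_reverse.1 h) ⟨_, hw.reverse⟩
  obtain ⟨f₁, f₂, f₃, f₄⟩ := I.arcs_fictitious x y
  suffices ∀ ρ ⊆ B, ∀ u, (I.arcs x y).Walk (fun a => linkArcs F a ∨ a / 2 = m) u ρ w →
      ∃ π, (I.arcs x y).Walk (fun a => a < 2 * m ∧ (a ∈ B ∨ a / 2 ∈ g.map Fin.val)) u π w from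
    this B (fun _ h => h) u hB
  intro ρ hρ
  induction ρ with
  | nil => exact fun u h => ⟨[], h⟩
  | cons a ρ ih =>
    rintro u ⟨ha, rfl, h⟩
    obtain ⟨π, hπ⟩ := ih (fun _ h => hρ (.tail _ h)) _ h
    rcases ha with ha | ha
    · exact ⟨a :: π, ⟨ha.lt, Or.inl (hρ List.mem_cons_self)⟩, rfl, hπ⟩
    · obtain rfl | rfl : a = 2 * m ∨ a = 2 * m + 1 := by omega
      · rw [f₁]
        rw [f₂] at hπ
        exact ⟨_, (h₁.mono fun a _ h => ⟨h.1, Or.inr h.2⟩).append hπ⟩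
      · rw [f₃]
        rw [f₄] at hπ
        exact ⟨_, (h₂.mono fun a _ h => ⟨h.1, Or.inr h.2⟩).append hπ⟩

/-- The two paths computed with the fictitious link are a result of the algorithm. -/
theorem IsPair.sca_detour {x y : Fin n} {g : List (Fin m)}
    (h : I.IsPair x y (fun a => linkArcs {e | e ∈ I.p₁ ∨ e ∈ I.b₁} a ∨ a / 2 = m) g P' B b)
    (hc : Connected I.G₂ I.s₂ I.t₂) (D : DecompositionD1 I.G₂ I.s₂ I.t₂) {i j : Fin (D.r + 1)}
    (hE : I.Extremal D i j x y) (hij : i ≠ j) (hg : I.SegmentOfB₁ x y g) : ∃ p q,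
      P'.map (I.arcs x y).link = p.map Fin.val ∧ b.map (I.arcs x y).link = q.map Fin.val ∧
        I.SCA (some (p, q)) := by
  have hR := I.represents {e | e ∈ I.p₁ ∨ e ∈ I.b₁} x y
  have hR' := I.represents_addFictitious {e | e ∈ I.p₁ ∨ e ∈ I.b₁} x y
  have hP' : (I.arcs x y).Walk (linkArcs {e | e ∈ I.p₁ ∨ e ∈ I.b₁}) I.s₂ P' I.t₂ :=
    h.walk.mono fun a ha hA => hA.resolve_right (by have := h.real a ha; omega)
  obtain ⟨p, hp, hpp⟩ := hR.isPath_of_walk hP' h.simple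
  obtain ⟨B', hB', hBp⟩ := hR'.isPath_of_walk h.walk_B h.simple_B
  obtain ⟨q, hq, hqp⟩ := (I.represents ∅ x y).isPath_of_walk
    (h.walk_b.mono fun a _ ha => (⟨⟨a / 2, by omega⟩, rfl, by simp⟩ : linkArcs ∅ a)) h.simple_b
  -- No tunable pair of `G₂` has been computed in this case; its existence is enough.
  obtain ⟨p₀, b₀, hT⟩ := hR.exists_tunablePair
    ((Set.finite_lt_nat (2 * m)).subset fun a ha => ha.lt) hc
  refine ⟨p, q, hp, hq, I.sca_detour hc D hE hij hpp hBp (fun e he heB => ?_) hg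
    (IsPath.deleteEdges_iff.1 hqp).1 (fun e he => ?_) hT⟩
  · obtain ⟨a, ha, hae⟩ := List.mem_map.1 (hp ▸ List.mem_map_of_mem he : e.val ∈ P'.map _)
    obtain ⟨c, hc, hce⟩ := List.mem_map.1 (hB' ▸ List.mem_map_of_mem heB : e.val ∈ B.map _)
    exact hR'.not_connected_of_mem fun ρ hρ => ⟨a, h.common a ha c hc (hae.trans hce.symm) ρ hρ, hae⟩
  · obtain ⟨a, ha, hae⟩ := List.mem_map.1 (hq ▸ List.mem_map_of_mem he : e.val ∈ b.map _)
    obtain ⟨hlt, ha⟩ := h.walk_b.mem ha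
    rcases ha with ha | ha
    · left
      have : e.val ∈ B'.map fun o => o.elim m Fin.val := by
        rw [← hB', ← hae]; exact List.mem_map_of_mem ha
      obtain ⟨o, ho, hoe⟩ := List.mem_map.1 this
      obtain rfl : o = some e := hR'.injective hoe
      exact ho
    · right
      rw [I.arcs_link _ _ (by omega)] at hae
      obtain ⟨e', he', h'⟩ := List.mem_map.1 ha
      obtain rfl : e' = e := Fin.ext (h'.trans hae)
      exact he'

end Instance


/-! ### The nodes of `b₁` in the extreme components -/

/-- The current node, in register `27`, becomes the farthest node: its position is in register
`29`, the node in register `30`, its distance in weight register `6`. -/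
def takeFirst : Program := block [.copy 29 12, .copy 30 27, .wcopy 6 3]

/-- The current node, in register `27`, becomes the closest node: its position is in register
`32`, the node in register `33`, its distance in weight register `7`. -/
def takeLast : Program := block [.copy 32 12, .copy 33 27, .wcopy 7 3]

/-- Compare the current node with the closest and the farthest one. -/
def scanNode : Program :=
  .seq (block [.load 18 9 27, .wload 3 2 27]) <| .ite (.eq 18 8) (block []) <|
    .ite (.eq 28 8) (.seq takeFirst (.seq takeLast (block [.copy 28 9]))) <|
      .seq (.ite (.wlt 6 3) takeFirst (block [])) (.ite (.wlt 3 7) takeLast (block []))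

/-- Go to the next node of `b₁`. -/
def nextNode : Program :=
  .seq (block [.load 16 3 12, .load 17 0 16]) <|
    .ite (.eq 17 27) (.instr (.load 27 1 16)) (.instr (.copy 27 17))

/-- Find the nodes of `b₁` that are closest to the root and farthest from it. -/
def findExtremal : Program :=
  .seq (block [.copy 27 2, .const 28 0, .copy 20 7, .inc 20])
    (forLoop 12 20 (.seq scanNode nextNode))

/-- The extreme nodes of the walk with nodes `v 0, …, v (j - 1)`. -/
def ExtremalBelow (v : ℕ → ℕ) (vis : ℕ → ℕ) (D : ℕ → ℝ) (j : ℕ) (σ : State) : Prop :=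
  (σ.reg 28 = 0 ∧ ∀ k < j, vis (v k) = 0) ∨
  (σ.reg 28 = 1 ∧ (σ.reg 29 < j ∧ σ.reg 30 = v (σ.reg 29) ∧ vis (σ.reg 30) ≠ 0 ∧
      σ.wreg 6 = D (σ.reg 30)) ∧
    (σ.reg 32 < j ∧ σ.reg 33 = v (σ.reg 32) ∧ vis (σ.reg 33) ≠ 0 ∧ σ.wreg 7 = D (σ.reg 33)) ∧
    ∀ k < j, vis (v k) ≠ 0 → D (v k) ≤ σ.wreg 6 ∧ σ.wreg 7 ≤ D (v k))

/-- The next node is the end of the current link that differs from the current node; for a loop both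
ends agree, and either value is right. -/
theorem nextNode_run {v : ℕ → ℕ} {j : ℕ} {σ : State} (hj : σ.reg 12 = j) (hv : σ.reg 27 = v j)
    (hl : σ.arr 0 (σ.arr 3 j) = v j ∧ σ.arr 1 (σ.arr 3 j) = v (j + 1) ∨
      σ.arr 0 (σ.arr 3 j) = v (j + 1) ∧ σ.arr 1 (σ.arr 3 j) = v j) :
    (nextNode.run σ).reg 27 = v (j + 1) := by
  simp only [nextNode, block, Program.run]
  rcases hl with ⟨h₀, h₁⟩ | ⟨h₀, h₁⟩
  · simp [Test.Holds, hj, hv, h₀, h₁]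
  · by_cases h : v (j + 1) = v j <;> simp [Test.Holds, hj, hv, h₀, h₁, h]

theorem scanNode_run {v : ℕ → ℕ} {j : ℕ} {σ : State} (h₈ : σ.reg 8 = 0) (h₉ : σ.reg 9 = 1)
    (hj : σ.reg 12 = j) (hv : σ.reg 27 = v j) (h : ExtremalBelow v (σ.arr 9) (σ.warr 2) j σ) :
    ExtremalBelow v (σ.arr 9) (σ.warr 2) (j + 1) (scanNode.run σ) := by
  have below : ∀ {p : ℕ → Prop}, (∀ k < j, p k) → p j → ∀ k < j + 1, p k := fun h₁ h₂ k hk =>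
    (Nat.lt_succ_iff_lt_or_eq.1 hk).elim (h₁ k) fun h => h ▸ h₂
  have below' : ∀ {p : ℕ → Prop}, (∀ k < j, p k) → p j → ∀ k ≤ j, p k := fun h₁ h₂ k hk =>
    below h₁ h₂ k (Nat.lt_succ_of_le hk)
  by_cases hz : σ.arr 9 (v j) = 0
  · have e : scanNode.run σ = (block [.load 18 9 27, .wload 3 2 27]).run σ := by
      simp [scanNode, block, Program.run, Test.Holds, hv, hz, h₈]
    rw [e]
    refine h.imp (fun h => ⟨by simpa [block, Program.run] using h.1, below h.2 hz⟩) fun h => ?_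
    simp only [block, Program.run, exec_skip, wreg_wload, wreg_load, reg_wload, reg_load]
    simp only [Nat.reduceEqDiff, if_false]
    obtain ⟨a₁, ⟨a₂, a₃⟩, ⟨a₄, a₅⟩, a₆⟩ := h
    exact ⟨a₁, ⟨by omega, a₃⟩, ⟨by omega, a₅⟩, below a₆ fun h => absurd hz h⟩
  · rcases h with ⟨h₁, h₂⟩ | ⟨h₁, ⟨h₂, h₃, h₄, h₅⟩, ⟨h₆, h₇, h₁₀, h₁₁⟩, h₁₂⟩
    · right
      simp [scanNode, takeFirst, takeLast, block, Program.run, Test.Holds, hv, hz, h₈, h₁, h₉, hj]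
      exact below' (fun k hk h => absurd (h₂ k hk) h) fun _ => ⟨le_rfl, le_rfl⟩
    · right
      by_cases c₁ : σ.wreg 6 < σ.warr 2 (v j) <;> by_cases c₂ : σ.warr 2 (v j) < σ.wreg 7
      · simp [scanNode, takeFirst, takeLast, block, Program.run, Test.Holds, hv, hz, h₈, h₁, hj,
          c₁, c₂]
        exact below' (fun k hk h => ⟨(h₁₂ k hk h).1.trans c₁.le, c₂.le.trans (h₁₂ k hk h).2⟩)
          fun _ => ⟨le_rfl, le_rfl⟩
      · simp [scanNode, takeFirst, takeLast, block, Program.run, Test.Holds, hv, hz, h₈, h₁, hj,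
          c₁, c₂]
        exact ⟨⟨by omega, h₇, h₁₀, h₁₁⟩, below' (fun k hk h => ⟨(h₁₂ k hk h).1.trans c₁.le,
          (h₁₂ k hk h).2⟩) fun _ => ⟨le_rfl, not_lt.1 c₂⟩⟩
      · simp [scanNode, takeFirst, takeLast, block, Program.run, Test.Holds, hv, hz, h₈, h₁, hj,
          c₁, c₂]
        exact ⟨⟨by omega, h₃, h₄, h₅⟩, below' (fun k hk h => ⟨(h₁₂ k hk h).1,
          c₂.le.trans (h₁₂ k hk h).2⟩) fun _ => ⟨not_lt.1 c₁, le_rfl⟩⟩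
      · simp [scanNode, takeFirst, takeLast, block, Program.run, Test.Holds, hv, hz, h₈, h₁, c₁,
          c₂]
        exact ⟨⟨by omega, h₃, h₄, h₅⟩, ⟨by omega, h₇, h₁₀, h₁₁⟩, below' h₁₂
          fun _ => ⟨not_lt.1 c₁, not_lt.1 c₂⟩⟩

namespace Instance

variable {n m : ℕ} {I : Instance n m} {σ : State} {x y : ℕ}

theorem Memory.findExtremal_runs (h : I.Memory x y σ) {v : ℕ → Fin n} (h₀ : v 0 = I.s₁)
    (hl : ∀ k (hk : k < I.b₁.length), I.G.IsLink I.b₁[k] (v k) (v (k + 1))) :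
    Runs findExtremal (120 * (n * m)) σ
      (ExtremalBelow (fun k => v k) (σ.arr 9) (σ.warr 2) (I.b₁.length + 1)) := by
  have hlen := length_le_m I.isPath_b₁.nodup_links
  obtain ⟨n₁, n₂, n₃⟩ := I.bounds
  have hr := h.reg
  have hr' := h.reg'
  refine Runs.seq (k := 5) (l := (I.b₁.length + 1) * (50 + 2) + 2) (Runs.of_run (Q := fun τ =>
    τ.reg 27 = v 0 ∧ τ.reg 28 = 0 ∧ τ.reg 20 = I.b₁.length + 1) rfl ?_ (by decide))
    (fun τ F ⟨h₁, h₂, h₃⟩ => ?_) ?_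
  · simp [block, Program.run, hr, h₀]
  · have hτ := h.frame F rfl
    rw [← F.arr 9 rfl, ← F.warr 2 rfl]
    -- There is one node more than there are links. After the last node the body still tries to
    -- advance and leaves an arbitrary value in register `27`; hence the restriction to `j ≤
    -- I.b₁.length`.
    refine (Runs.forLoop (Inv := fun j υ => (j ≤ I.b₁.length → υ.reg 27 = v j) ∧
      ExtremalBelow (fun k => v k) (τ.arr 9) (τ.warr 2) j υ) rfl rfl (by decide) h₃
      ⟨fun _ => by simpa using h₁, Or.inl ⟨by simpa using h₂, by simp⟩⟩
      fun j hj υ F' hrj ⟨hI₁, hI₂⟩ => Runs.of_run rfl ?_ (by decide)).mono le_rfl fun _ _ h => h.2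
    have hυ := hτ.frame F' rfl
    have hv := hI₁ (by omega)
    rw [← F'.arr 9 rfl, ← F'.warr 2 rfl] at hI₂ ⊢
    have hs := scanNode_run (v := fun k => v k) hυ.reg'.1 hυ.reg'.2.1 hrj hv hI₂
    have Fs := Program.frame_run (P := scanNode) rfl υ
    have hω := hυ.frame Fs rfl
    have Fn := Program.frame_run (P := nextNode) rfl (scanNode.run υ)
    refine ⟨fun hj' => ?_, ?_⟩
    · rw [reg_inc, if_neg (by decide), Program.run]
      refine nextNode_run (v := fun k => v k) ((Fs.reg 12 rfl).trans hrj)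
        ((Fs.reg 27 rfl).trans hv) ?_
      rw [hω.arr.1, hω.arr.2.1, hω.arr.2.2.2]
      have : (arrayOf fun i => (I.b₁.get i).val) j = I.b₁[j].val := by
        simp only [arrayOf, List.get_eq_getElem]
        rw [dif_pos (by omega)]
      rw [this, arrayOf_val, arrayOf_val]
      rcases hl j (by omega) with hl | hl
      · left; rw [hl]; exact ⟨rfl, rfl⟩
      · right; rw [hl]; exact ⟨rfl, rfl⟩
    · have e : ∀ r ∈ [28, 29, 30, 32, 33], ((Instr.inc 12).exec ((Program.seq scanNode
        nextNode).run υ)).reg r = (scanNode.run υ).reg r := by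
        intro r hr
        fin_cases hr <;> exact Fn.reg _ rfl
      have e' : ∀ r, ((Instr.inc 12).exec ((Program.seq scanNode
          nextNode).run υ)).wreg r = (scanNode.run υ).wreg r := fun r => Fn.wreg r rfl
      simpa only [ExtremalBelow, e, e', List.mem_cons, List.mem_nil_iff, Nat.reduceEqDiff, or_true, true_or] using hs
  · omega

end Instance


section DecLemmas

variable (σ : State) (x r : ℕ)

@[simp] theorem reg_dec : ((Instr.dec x).exec σ).reg r =
    if r = x then σ.reg x - 1 else σ.reg r := by
  simp [Instr.exec, Function.update_apply]
@[simp] theorem arr_dec : ((Instr.dec x).exec σ).arr = σ.arr := rfl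
@[simp] theorem wreg_dec : ((Instr.dec x).exec σ).wreg = σ.wreg := rfl
@[simp] theorem warr_dec : ((Instr.dec x).exec σ).warr = σ.warr := rfl

end DecLemmas

/-! ### The fictitious link -/

/-- Store the ends of the fictitious link, and allow its arcs. -/
def storeFictitious : Program := block [.copy 16 10, .dec 16, .copy 17 16, .dec 17, .store 4 17 30,
  .store 5 17 33, .store 4 16 33, .store 5 16 30, .store 8 17 9, .store 8 16 9]

/-- Sort the two positions in registers `29` and `32`. -/
def sortPositions : Program :=
  .ite (.lt 29 32) (block [.copy 34 29, .copy 35 32]) (block [.copy 34 32, .copy 35 29])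

/-- Mark the link of `b₁` at the position in register `12` if it is between the two positions. -/
def markBetween : Program :=
  .ite (.lt 12 34) (block []) (.ite (.lt 12 35) (block [.load 16 3 12, .store 21 16 9]) (block []))

/-- Add the fictitious link between the two extreme nodes of `b₁`, and mark the links of `b₁`
between them. -/
def addDetour : Program := .seq storeFictitious (.seq sortPositions (forLoop 12 7 markBetween))

namespace Instance

variable {n m : ℕ} {I : Instance n m} {σ : State} {x y i j : ℕ}

/-- The last two arcs have been reserved from the start, with dummy ends `0`; only their ends and
their permission change. -/
theorem Memory.storeFictitious_run (h : I.Memory 0 0 σ) (hx : σ.reg 30 = x) (hy : σ.reg 33 = y) :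
    I.Memory x y (storeFictitious.run σ) ∧ ∀ a < 2 * m + 2,
      (storeFictitious.run σ).arr 8 a = 1 ↔ σ.arr 8 a = 1 ∨ a / 2 = m := by
  have F := Program.frame_run (P := storeFictitious) rfl σ
  refine ⟨⟨?_, ?_, ?_, ?_, ?_, ?_, ?_⟩, fun a ha => ?_⟩
  · exact h.reg
  · exact h.reg'
  · exact h.wreg
  · exact h.arr
  · have h₁ := h.reg'
    have h₂ := h.arcs
    refine ⟨?_, ?_, h₂.2.2.1, h₂.2.2.2⟩
    · funext a
      simp [storeFictitious, block, Program.run, hx, hy, h₁, h₂, Function.update_apply]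
      simp only [Instance.arcs]
      grind
    · funext a
      simp [storeFictitious, block, Program.run, hx, hy, h₁, h₂, Function.update_apply]
      simp only [Instance.arcs]
      grind
  · exact h.marks
  · exact h.warr
  · have h₁ := h.reg'
    simp [storeFictitious, block, Program.run, h₁, Function.update_apply]
    grind

theorem mem_segment_iff {l : List (Fin m)} {e : ℕ} : e ∈ ((l.take j).drop i).map Fin.val ↔
    ∃ k < l.length, (i ≤ k ∧ k < j) ∧ (arrayOf fun i => (l.get i).val) k = e := by
  have hk : ∀ k (hk : k < l.length), (arrayOf fun i => (l.get i).val) k = (l[k]).val := fun k hk =>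
    dif_pos hk
  rw [List.mem_map]
  constructor
  · rintro ⟨e, he, rfl⟩
    obtain ⟨k, hk', rfl⟩ := List.getElem_of_mem he
    simp only [List.length_drop, List.length_take] at hk'
    refine ⟨i + k, by omega, by omega, ?_⟩
    rw [hk _ (by omega)]
    simp
  · rintro ⟨k, hk', ⟨h₁, h₂⟩, rfl⟩
    refine ⟨l[k], List.mem_iff_getElem.2 ⟨k - i, by simp; omega, ?_⟩, (hk k hk').symm⟩
    simp [Nat.add_sub_cancel' h₁]

theorem Memory.addDetour_runs (h : I.Memory 0 0 σ) (hx : σ.reg 30 = x) (hy : σ.reg 33 = y)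
    (hi : σ.reg 29 = i) (hj : σ.reg 32 = j) (h₂₁ : σ.arr 21 = fun _ => 0) {g : List (Fin m)}
    (hg : ∀ e, e ∈ g ↔ e ∈ (I.b₁.take (max i j)).drop (min i j)) :
    Runs addDetour (40 * (n * m)) σ fun τ => I.Memory x y τ ∧ τ.arr 21 = Survivable.marks g ∧
      ∀ a < 2 * m + 2, τ.arr 8 a = 1 ↔ σ.arr 8 a = 1 ∨ a / 2 = m := by
  classical
  have hlen := length_le_m I.isPath_b₁.nodup_links
  obtain ⟨n₁, n₂, n₃⟩ := I.bounds
  refine Runs.seq (k := 11) (l := 7 + (m * 10 + 2)) (Runs.of_run (Q := fun τ => I.Memory x y τ ∧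
    ∀ a < 2 * m + 2, τ.arr 8 a = 1 ↔ σ.arr 8 a = 1 ∨ a / 2 = m) rfl
    (h.storeFictitious_run hx hy) le_rfl) (fun τ F ⟨hM, h₈⟩ => ?_) (by omega)
  refine Runs.seq (k := 7) (l := m * 10 + 2) (Runs.of_run (Q := fun υ => υ.reg 34 = min i j ∧
    υ.reg 35 = max i j) rfl ?_ (by decide)) (fun υ F' ⟨h₁, h₂⟩ => ?_) (by omega)
  · rw [← F.reg 29 rfl] at hi
    rw [← F.reg 32 rfl] at hj
    simp only [sortPositions, Program.run, block, Test.Holds, hi, hj]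
    split_ifs with hij <;> simp [hi, hj] <;> omega
  have hMυ := hM.frame F' rfl
  refine (Runs.forLoop (c := 8) (Inv := fun k ω => ∀ e, ω.arr 21 e = if ∃ k' < k,
    (min i j ≤ k' ∧ k' < max i j) ∧ (arrayOf fun i => (I.b₁.get i).val) k' = e then 1 else 0)
    (n := I.b₁.length) rfl rfl (by decide) hMυ.reg.2.2.2.2.2.2 ?_
    fun k hk ω F₁ hr hI => Runs.of_run rfl ?_ (by decide)).mono (by omega) fun ω F₁ hω => ?_
  · simp [F'.arr 21 rfl, F.arr 21 rfl, h₂₁]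
  · have hMω := hMυ.frame F₁ rfl
    rw [← F₁.reg 34 rfl] at h₁
    rw [← F₁.reg 35 rfl] at h₂
    intro e
    have key : ∀ p : ℕ → Prop, (∃ k' < k + 1, p k') ↔ (∃ k' < k, p k') ∨ p k := fun p => by
      simp only [Nat.lt_succ_iff_lt_or_eq, or_and_right, exists_or, exists_eq_left]
    refine .trans ?_ (if_congr (key _) rfl rfl).symm
    by_cases c₁ : k < min i j
    · simp only [markBetween, Program.run, block, Test.Holds, hr, h₁, c₁, if_true, exec_skip,
        arr_inc, hI]
      simp [c₁.not_ge]
    · by_cases c₂ : k < max i j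
      · simp only [markBetween, Program.run, block, Test.Holds, hr, h₁, h₂, c₁, c₂, if_true,
          if_false, exec_skip, arr_inc, arr_store, arr_load, reg_load, hMω.reg'.2.1,
          hMω.arr.2.2.2, Function.update_apply, hI]
        simp only [not_lt.1 c₁, true_and]
        by_cases he : (arrayOf fun i => (I.b₁.get i).val) k = e
        · simp only [he, if_true, or_true]
          rfl
        · simp only [he, Ne.symm he, if_false, or_false]
      · simp only [markBetween, Program.run, block, Test.Holds, hr, h₁, h₂, c₁, c₂, if_false,
          exec_skip, arr_inc, hI]
        simp
  · refine ⟨?_, ?_, ?_⟩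
    · exact hMυ.frame F₁ rfl
    · funext e
      rw [hω e, Survivable.marks]
      have : e ∈ g.map Fin.val ↔ e ∈ ((I.b₁.take (max i j)).drop (min i j)).map Fin.val := by
        simp only [List.mem_map, hg]
      simp only [this, mem_segment_iff]
    · rw [F₁.arr 8 rfl, F'.arr 8 rfl]
      exact h₈

end Instance


/-! ### The first case: the terminals are connected without the links of the first connection -/

/-- Arc `13` gets weight `1` if it is on the path of array `12`, and weight `0` otherwise. -/
def pathWeight : Program :=
  .seq (block [.load 16 12 13]) (.ite (.eq 16 9) (.instr (.wcopy 5 1)) (.instr (.wcopy 5 0)))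

/-- Extract the path of the search tree, and give weight `1` to its arcs. -/
def firstPath : Program := .seq (extract 12 22 31) (wfill 1 pathWeight)

/-- The steps of the algorithm that follow the search in the network without the links of the first
connection, if it has been successful. -/
def detourCase : Program :=
  .seq firstPath <| .seq search <| .seq findExtremal <|
    .seq (.ite (.eq 28 9) (.ite (.wlt 7 6) addDetour (block [])) (block [])) pair

namespace Instance

variable {n m : ℕ} {I : Instance n m} {σ : State} {x y : ℕ} {A : ℕ → Prop} {W : ℕ → ℝ}
  {T : ℕ → List ℕ}

theorem Memory.firstPath_runs (h : I.Memory x y σ) (hA : ∀ a < 2 * m + 2, σ.arr 8 a = 1 ↔ A a)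
    (hlt : ∀ a, A a → a < 2 * m + 2) (hW : ∀ a, A a → σ.warr 1 a = W a)
    (hT : (I.arcs x y).SpanningTree A W n I.t₂ (σ.arr 9) (σ.warr 2) (σ.arr 10) T)
    (hv : σ.arr 9 I.s₂ ≠ 0) : Runs firstPath (70 * (n * m)) σ fun τ => ∃ P,
      (I.arcs x y).Walk A I.s₂ P I.t₂ ∧ (I.arcs x y).Simple I.s₂ P ∧
      (∀ a < 2 * m + 2, τ.arr 12 a = if a ∈ P then 1 else 0) ∧
      ∀ a < 2 * m + 2, τ.warr 1 a = if a ∈ P then 1 else 0 := by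
  obtain ⟨n₁, n₂, n₃⟩ := I.bounds
  refine Runs.seq (k := (2 * m + 2) * 3 + n * 9 + 8) (l := (2 * m + 2) * 8 + 2)
    (extract_runs (h.searchInput hA hlt hW) h.arcs.2.2.1
      h.reg.2.2.2.1 hT I.s₂.2 hv (by decide) (by decide) (by decide)
      (by decide)) (fun τ F ⟨_, _, h₃⟩ => ?_) (by omega)
  have hτ := h.frame F rfl
  refine (wfill_runs (P := pathWeight) (fun a => if a ∈ T I.s₂ then 1 else 0) rfl rfl rfl rfl
    hτ.reg'.2.2.1 fun a ha υ F' hr => ?_).mono le_rfl fun υ F' hυ => ⟨T I.s₂, hT.walk _ I.s₂.2 hv,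
      hT.simple _ I.s₂.2 hv, by rw [F'.arr 12 rfl]; exact h₃, hυ⟩
  have hυ := hτ.frame F' rfl
  have := h₃ a ha
  rw [← F'.arr 12 rfl] at this
  by_cases haT : a ∈ T I.s₂ <;>
    simp [pathWeight, block, Program.run, Test.Holds, hr, hυ.reg', hυ.wreg, this, haT]

/-- The path `P` is found before the fictitious link has its ends. It survives the change of the arc
system because the real arcs do not depend on these ends. -/
theorem arcs_congr (x' y' : ℕ) {a : ℕ} (ha : a < 2 * m) :
    (I.arcs x y).tail a = (I.arcs x' y').tail a ∧ (I.arcs x y).head a = (I.arcs x' y').head a := by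
  simp [arcs, ha]

theorem walk_congr (x' y' : ℕ) (hA : ∀ a, A a → a < 2 * m) {u v : ℕ} {π : List ℕ}
    (h : (I.arcs x y).Walk A u π v) : (I.arcs x' y').Walk A u π v := by
  induction π generalizing u with
  | nil => exact h
  | cons a π ih =>
    obtain ⟨h₁, h₂, h₃⟩ := h
    have := I.arcs_congr (x := x) (y := y) x' y' (hA a h₁)
    exact ⟨h₁, this.1 ▸ h₂, this.2 ▸ ih h₃⟩

theorem simple_congr (x' y' : ℕ) {u : ℕ} {π : List ℕ} (hπ : ∀ a ∈ π, a < 2 * m)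
    (h : (I.arcs x y).Simple u π) : (I.arcs x' y').Simple u π := by
  rwa [Arcs.Simple, ← List.map_congr_left fun a ha => (I.arcs_congr (x := x) (y := y) x' y' (hπ a ha)).2]

theorem arcs_lt (hx : x < n) (hy : y < n) {a : ℕ} (ha : a < 2 * m + 2) :
    (I.arcs x y).tail a < n ∧ (I.arcs x y).head a < n := by
  refine (I.represents_addFictitious ∅ ⟨x, hx⟩ ⟨y, hy⟩).arc_lt a ?_
  by_cases h : a < 2 * m
  · exact Or.inl ⟨⟨a / 2, by omega⟩, rfl, by simp⟩
  · exact Or.inr (by omega)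

/-- The links that are not available in the network `G₂`. -/
def firstLinks (I : Instance n m) : Set (Fin m) := {e | e ∈ I.p₁ ∨ e ∈ I.b₁}

/-- The memory is ready for the computation of the two paths of a result of the algorithm. -/
def Ready (I : Instance n m) (P : List ℕ) (σ : State) : Prop :=
  ∃ (x y : Fin n) (A : ℕ → Prop) (g : List (Fin m)), I.Memory x y σ ∧ (I.arcs x y).IsSymm A ∧
    (∀ a < 2 * m + 2, σ.arr 8 a = 1 ↔ A a) ∧ (∀ a, A a → a < 2 * m + 2) ∧
    (∀ a, linkArcs I.firstLinks a → A a) ∧ σ.arr 21 = Survivable.marks g ∧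
    (∀ a < 2 * m + 2, σ.arr 12 a = if a ∈ P then 1 else 0) ∧
    (∀ a < 2 * m + 2, σ.warr 1 a = if a ∈ P then 1 else 0) ∧
    (∀ B, (I.arcs x y).Walk A I.s₂ B I.t₂ →
      ∃ π, (I.arcs x y).Walk (fun a => a < 2 * m ∧ (a ∈ B ∨ a / 2 ∈ g.map Fin.val)) I.s₂ π I.t₂) ∧
    ∀ P' B b, I.IsPair x y A g P' B b → ∃ p q, P'.map (I.arcs x y).link = p.map Fin.val ∧
      b.map (I.arcs x y).link = q.map Fin.val ∧ I.SCA (some (p, q))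

theorem Ready.pair_runs {P : List ℕ} (h : I.Ready P σ)
    (hP : (I.arcs 0 0).Walk (linkArcs I.firstLinks) I.s₂ P I.t₂)
    (hPs : (I.arcs 0 0).Simple I.s₂ P) :
    Runs pair (1300 * (n * m)) σ fun τ => ∃ p q, I.SCA (some (p, q)) ∧ τ.HoldsList 22 24 p ∧
      τ.HoldsList 24 26 q := by
  obtain ⟨x, y, A, g, hM, hsymm, hA, hlt, hle, hg, h₁₂, hW, hreach, hres⟩ := h
  have hPr : ∀ a ∈ P, a < 2 * m := fun a ha => (hP.mem ha).lt
  refine (hM.pair_runs hsymm hA hlt (fun a ha => arcs_lt x.2 y.2 ha)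
    ((walk_congr x y (fun a ha => ha.lt) hP).mono fun a _ => hle a) (simple_congr x y hPr hPs) hPr
    h₁₂ hW hg hreach).mono le_rfl fun τ _ ⟨P', B, b, hpair, h₁, h₂⟩ => ?_
  obtain ⟨p, q, hp, hq, hS⟩ := hres P' B b hpair
  exact ⟨p, q, hS, h₁.holdsList hp, h₂.holdsList hq⟩

/-- Without a detour the fictitious arcs are not allowed, so their dummy ends are harmless and `g`
is empty. The backup path is then sought in `B` itself. -/
theorem Memory.ready_of_tunable (h : I.Memory 0 0 σ) {P : List ℕ}
    (hA : ∀ a < 2 * m + 2, σ.arr 8 a = 1 ↔ linkArcs I.firstLinks a) (h₂₁ : σ.arr 21 = fun _ => 0)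
    (h₁₂ : ∀ a < 2 * m + 2, σ.arr 12 a = if a ∈ P then 1 else 0)
    (hW : ∀ a < 2 * m + 2, σ.warr 1 a = if a ∈ P then 1 else 0)
    (hS : ∀ p q, TunablePair I.G₂ I.s₂ I.t₂ p q → I.SCA (some (p, q))) : I.Ready P σ := by
  refine ⟨⟨0, I.s₂.pos⟩, ⟨0, I.s₂.pos⟩, linkArcs I.firstLinks, [], h, (I.represents _ _ _).symm, hA,
    fun a ha => by have := ha.lt; omega, fun a ha => ha, ?_, h₁₂, hW, fun B hB => ⟨B, ?_⟩,
    fun P' B b hp => ?_⟩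
  · rw [h₂₁]
    funext e
    simp [Survivable.marks]
  · exact hB.mono fun a ha hA => ⟨hA.lt, Or.inl ha⟩
  · obtain ⟨p, q, hp, hq, hT⟩ := hp.tunablePair
    exact ⟨p, q, hp, hq, hS p q hT⟩

theorem Memory.ready_of_detour {x y : Fin n} (h : I.Memory x y σ) {P : List ℕ}
    {g : List (Fin m)}
    (hA : ∀ a < 2 * m + 2, σ.arr 8 a = 1 ↔ linkArcs I.firstLinks a ∨ a / 2 = m)
    (h₂₁ : σ.arr 21 = Survivable.marks g)
    (h₁₂ : ∀ a < 2 * m + 2, σ.arr 12 a = if a ∈ P then 1 else 0)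
    (hW : ∀ a < 2 * m + 2, σ.warr 1 a = if a ∈ P then 1 else 0)
    (hc : Connected I.G₂ I.s₂ I.t₂) (D : DecompositionD1 I.G₂ I.s₂ I.t₂) {i j : Fin (D.r + 1)}
    (hE : I.Extremal D i j x y) (hij : i ≠ j) (hg : I.SegmentOfB₁ x y g) : I.Ready P σ := by
  refine ⟨x, y, fun a => linkArcs I.firstLinks a ∨ a / 2 = m, g, h,
    (I.represents_addFictitious _ _ _).symm, hA, fun a ha => ?_, fun a ha => Or.inl ha, h₂₁, h₁₂, hW,
    fun B hB => exists_walk_of_segment hg hB, fun P' B b hp => hp.sca_detour hc D hE hij hg⟩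
  rcases ha with ha | ha
  · have := ha.lt; omega
  · omega

/-- The arcs of the first path found get weight `1`. One search then gives the distances that order
the components, and the same weights serve the subsequent computation of the pair. -/
theorem Memory.detourCase_runs (h : I.Memory 0 0 σ)
    (hA : ∀ a < 2 * m + 2, σ.arr 8 a = 1 ↔ linkArcs I.firstLinks a) (h₂₁ : σ.arr 21 = fun _ => 0)
    (hW : ∀ a, linkArcs I.firstLinks a → σ.warr 1 a = W a)
    (hT : (I.arcs 0 0).SpanningTree (linkArcs I.firstLinks) W n I.t₂ (σ.arr 9) (σ.warr 2) (σ.arr 10)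
      T) (hv : σ.arr 9 I.s₂ ≠ 0) :
    Runs detourCase (1700 * (n * m)) σ fun τ => ∃ p q, I.SCA (some (p, q)) ∧
      τ.HoldsList 22 24 p ∧ τ.HoldsList 24 26 q := by
  obtain ⟨n₁, n₂, n₃⟩ := I.bounds
  have hR : Represents (I.arcs 0 0) (linkArcs I.firstLinks) I.G₂ Fin.val :=
    I.represents I.firstLinks 0 0
  have hlt : ∀ a, linkArcs I.firstLinks a → a < 2 * m + 2 := fun a ha => by
    have := ha.lt; omega
  refine Runs.seq (l := 1630 * (n * m)) (h.firstPath_runs hA hlt hW hT hv)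
    (fun σ₁ F₁ ⟨P, hP, hPs, h₁₂, hW₁⟩ => ?_) (by omega)
  have M₁ := h.frame F₁ rfl
  rw [← F₁.arr 8 rfl] at hA
  rw [← F₁.arr 21 rfl] at h₂₁
  refine Runs.seq (l := 1469 * (n * m)) (M₁.search_runs hA hlt hR.arc_lt (fun a ha => hW₁ a (hlt a ha))
    fun a _ => by split_ifs <;> norm_num) (fun σ₂ F₂ ⟨T₂, hT₂⟩ => ?_) (by omega)
  have M₂ := M₁.frame F₂ rfl
  rw [← F₂.arr 8 rfl] at hA
  rw [← F₂.arr 21 rfl] at h₂₁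
  rw [← F₂.arr 12 rfl] at h₁₂
  rw [← F₂.warr 1 rfl] at hW₁
  obtain ⟨vs, hb, -⟩ := id I.isPath_b₁
  obtain ⟨v, hv₀, hv₁, hlink, -, hvs⟩ := hb.exists_nodes
  have honwalk : ∀ z, OnWalk I.G I.s₁ I.b₁ z ↔ ∃ k ≤ I.b₁.length, v k = z := by
    intro z
    rw [← hvs]
    exact ⟨fun ⟨w, ws, hw, hz⟩ => (hw.unique hb).2 ▸ hz, fun hz => ⟨_, _, hb, hz⟩⟩
  refine Runs.seq (l := 1349 * (n * m)) (M₂.findExtremal_runs hv₀ hlink) (fun σ₃ F₃ hE => ?_)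
    (by omega)
  have M₃ := M₂.frame F₃ rfl
  rw [← F₃.arr 8 rfl] at hA
  rw [← F₃.arr 21 rfl] at h₂₁
  rw [← F₃.arr 12 rfl] at h₁₂
  rw [← F₃.warr 1 rfl] at hW₁
  have hc : Connected I.G₂ I.s₂ I.t₂ := hR.connected_iff.2 ⟨P, hP⟩
  -- The decomposition is present in the proof only; the program sees marks and distances.
  obtain ⟨D⟩ := nonempty_decomposition hc
  have hvis : ∀ z : Fin n, σ₂.arr 9 z ≠ 0 ↔ ∃ l, z ∈ D.C l := by
    intro z
    rw [hT₂.vis_iff z.2, ← hR.connected_iff]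
    exact ⟨fun hz => D.exists_mem_C (hc.trans hz.symm),
      fun ⟨l, hz⟩ => (D.connected_s hz hc).symm.trans hc⟩
  refine Runs.seq (k := 42 * (n * m)) (l := 1300 * (n * m)) (Q' := I.Ready P) ?_
    (fun σ₄ F₄ h => h.pair_runs hP hPs) (by omega)
  rcases hE with ⟨h₂₈, hE⟩ | ⟨h₂₈, ⟨hx₁, hx₂, hx₃, hx₄⟩, ⟨hy₁, hy₂, hy₃, hy₄⟩, hE⟩
  · refine Runs.ite (k := 1) (fun hb => ?_) (fun _ => Runs.of_run rfl ?_ le_rfl) (by omega)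
    · have : σ₃.reg 28 = σ₃.reg 9 := hb
      rw [h₂₈, M₃.reg'.2.1] at this
      omega
    · refine M₃.ready_of_tunable hA h₂₁ h₁₂ hW₁ fun p q hpq => .untouched D hc (fun l hl => ?_) hpq
      obtain ⟨z, hz, hzb⟩ := hl
      obtain ⟨k, hk, rfl⟩ := (honwalk z).1 hzb
      exact (hvis _).2 ⟨l, hz⟩ (hE k (by omega))
  · rw [hx₂] at hx₃ hx₄
    rw [hy₂] at hy₃ hy₄
    obtain ⟨i, hi⟩ := (hvis _).1 hx₃
    obtain ⟨j, hj⟩ := (hvis _).1 hy₃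
    -- The distance to `t₂` decreases along the components, so the farthest node of `b₁` lies in the
    -- first touched component and the closest one in the last.
    have hExt : I.Extremal D i j (v (σ₃.reg 29)) (v (σ₃.reg 32)) := by
      refine ⟨fun l ⟨z, hz, hzb⟩ => ?_, hi, (honwalk _).2 ⟨_, by omega, rfl⟩, hj,
        (honwalk _).2 ⟨_, by omega, rfl⟩⟩
      obtain ⟨k, hk, rfl⟩ := (honwalk z).1 hzb
      have := hE k (by omega) ((hvis _).2 ⟨l, hz⟩)
      rw [hx₄, hy₄] at this
      constructor
      · by_contra hlt
        exact absurd ((hR.dist_lt_iff hP hPs hT₂ D hz hi).2 (not_le.1 hlt)) (not_lt.2 this.1)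
      · by_contra hlt
        exact absurd ((hR.dist_lt_iff hP hPs hT₂ D hj hz).2 (not_le.1 hlt)) (not_lt.2 this.2)
    have hlt_iff := hR.dist_lt_iff hP hPs hT₂ D hi hj
    refine Runs.ite (k := 41 * (n * m)) (fun _ => ?_) (fun hb => ?_) (by omega)
    · refine Runs.ite (k := 40 * (n * m)) (fun hb => ?_) (fun hb => ?_) (by omega)
      · have hij : i < j := by
          rw [← hlt_iff, ← hx₄, ← hy₄]
          exact hb
        obtain ⟨g, hg, hgm⟩ := I.segmentOfB₁ hv₀ hv₁ hlink (i := σ₃.reg 29) (j := σ₃.reg 32)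
          (by omega) (by omega)
        refine (M₃.addDetour_runs hx₂ hy₂ rfl rfl h₂₁ hgm).mono le_rfl
          fun σ₄ F₄ ⟨h₁, h₂, h₃⟩ => ?_
        refine h₁.ready_of_detour (fun a ha => ?_) h₂ (by rw [F₄.arr 12 rfl]; exact h₁₂)
          (by rw [F₄.warr 1 rfl]; exact hW₁) hc D hExt hij.ne hg
        rw [h₃ a ha, hA a ha]
      · refine Runs.of_run (P := block []) rfl ?_ (by simp [block, Program.size]; omega)
        refine M₃.ready_of_tunable hA h₂₁ h₁₂ hW₁ fun p q hpq =>
          .sameComponent D hc hExt ?_ hpq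
        -- If the closest node is not strictly closer than the farthest one, then `i < j` is
        -- excluded, and both nodes are in the same component.
        have h₁ : i ≤ j := (hExt.1 i ⟨_, hi, hExt.2.2.1⟩).2
        refine h₁.eq_of_not_lt fun hij => hb ?_
        rw [← hlt_iff, ← hx₄, ← hy₄] at hij
        exact hij
    · exact absurd (h₂₈.trans M₃.reg'.2.1.symm) hb

end Instance


/-! ### Shortest paths -/

namespace Represents

variable {n : ℕ} {β : Type*} {N : Arcs} {A : ℕ → Prop} {G : Graph (Fin n) β} {code : β → ℕ}
  {s t : Fin n} {W : ℕ → ℝ} {D : ℕ → ℝ} {vis nxt : ℕ → ℕ} {T : ℕ → List ℕ} {w : β → ℝ}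

theorem _root_.List.map_eq_map_of_link {link : ℕ → ℕ}
    (hW : ∀ a e, A a → link a = code e → W a = w e) {π : List ℕ} (hπ : ∀ a ∈ π, A a) {es : List β}
    (h : π.map link = es.map code) : π.map W = es.map w := by
  induction π generalizing es with
  | nil =>
    obtain rfl : es = [] := by simpa using h.symm
    rfl
  | cons a π ih =>
    cases es with
    | nil => simp at h
    | cons e es =>
      rw [List.map_cons, List.map_cons, List.cons.injEq] at h
      rw [List.map_cons, List.map_cons, hW a e (hπ a List.mem_cons_self) h.1,
        ih (fun b hb => hπ b (.tail _ hb)) h.2]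

/-- The tree walk is minimal among all walks to the root, in particular among those that represent
simple paths, and it is simple itself. -/
theorem exists_isShortestPath (h : Represents N A G code)
    (hW : ∀ a e, A a → N.link a = code e → W a = w e) (hT : N.SpanningTree A W n t vis D nxt T)
    (hv : vis s ≠ 0) : ∃ es, (T s).map N.link = es.map code ∧ IsShortestPath G w s es t ∧
      D s = (es.map w).sum := by
  have hw := hT.walk s s.2 hv
  obtain ⟨es, hes, hp⟩ := h.isPath_of_walk hw (hT.simple s s.2 hv)
  have hD : D s = (es.map w).sum := by
    rw [hT.weight s s.2 hv, List.map_eq_map_of_link hW (fun a => hw.mem) hes]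
  refine ⟨es, hes, ⟨hp, fun es' hp' => ?_⟩, hD⟩
  obtain ⟨π, hπ, -, hl⟩ := h.walk_of_isPath hp'
  rw [← hD, ← List.map_eq_map_of_link hW (fun a => hπ.mem) hl]
  exact hT.opt s s.2 hv π hπ

end Represents

/-! ### The arcs of the networks without a path of the first connection -/

/-- Arc `13` is not fictitious, and its link is marked neither in array `r` nor in array `r'`. -/
def avoids (r r' : ℕ) : Program :=
  .seq (block [.load 16 6 13, .load 17 r 16, .load 18 r' 16, .const 19 0]) <|
    .ite (.lt 16 1) (.ite (.eq 17 8) (.ite (.eq 18 8) (.instr (.const 19 1)) (block []))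
      (block [])) (block [])

theorem avoids_run {r r' : ℕ} {τ : State} (h₈ : τ.reg 8 = 0) : ((avoids r r').run τ).reg 19 =
    if τ.arr 6 (τ.reg 13) < τ.reg 1 ∧ τ.arr r (τ.arr 6 (τ.reg 13)) = 0 ∧
      τ.arr r' (τ.arr 6 (τ.reg 13)) = 0 then 1 else 0 := by
  simp only [avoids, block, Program.run]
  by_cases h₁ : τ.arr 6 (τ.reg 13) < τ.reg 1 <;>
  by_cases h₂ : τ.arr r (τ.arr 6 (τ.reg 13)) = 0 <;>
  by_cases h₃ : τ.arr r' (τ.arr 6 (τ.reg 13)) = 0 <;>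
  simp [Test.Holds, h₈, h₁, h₂, h₃]

/-- The weight of arc `13` is the failure probability of its link. -/
def linkWeight : Program := block [.load 16 6 13, .wload 5 0 16]

/-- The weight of arc `13` is the failure probability of its link if this is marked in array `19`,
and `0` otherwise. -/
def markedWeight : Program :=
  .seq (block [.load 16 6 13, .load 17 19 16]) <|
    .ite (.eq 17 9) (.instr (.wload 5 0 16)) (.instr (.wcopy 5 0))

/-! ### The failure probability of a tunable pair -/

/-- Add the failure probability of link `12` to weight register `8`. -/
def addWeight : Program := block [.wload 3 0 12, .wadd 8 8 3]

/-- Add up the failure probabilities of the links of the path that is marked in array `19`, and of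
the common links of the lists in arrays `24` and `26`. -/
def tunableWeight : Program :=
  .seq (markPath 22 24 29) <| .seq (markPath 24 26 30) <| .seq (block [.wzero 8]) <|
    forLoop 12 1 <| .seq (block [.load 16 19 12, .load 17 29 12, .load 18 30 12]) <|
      .ite (.eq 16 9) addWeight <| .ite (.eq 17 9) (.ite (.eq 18 9) addWeight (block [])) (block [])

namespace Instance

variable {n m : ℕ} {I : Instance n m} {σ : State} {x y : ℕ}

theorem marks_val {l : List (Fin m)} (e : Fin m) :
    Survivable.marks l e = if e ∈ l then 1 else 0 := by
  have : e.val ∈ l.map Fin.val ↔ e ∈ l := List.mem_map_of_injective Fin.val_injective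
  simp only [Survivable.marks, this]

theorem Memory.avoids_runs (h : I.Memory x y σ) {r r' : ℕ} {l l' : List (Fin m)} {F : Set (Fin m)}
    (hr : σ.arr r = Survivable.marks l) (hr' : σ.arr r' = Survivable.marks l') (h₈ : r ≠ 8)
    (h₈' : r' ≠ 8) (hF : ∀ e, e ∈ F ↔ e ∈ l ∨ e ∈ l') :
    Runs (fill 8 (avoids r r')) (100 * (n * m)) σ fun τ =>
      ∀ a < 2 * m + 2, τ.arr 8 a = 1 ↔ linkArcs F a := by
  classical
  obtain ⟨n₁, n₂, n₃⟩ := I.bounds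
  refine (fill_runs (P := avoids r r') (fun a => if linkArcs F a then 1 else 0) rfl rfl rfl rfl
    h.reg'.2.2.1 fun a ha τ hF' hr₁₃ => ?_).mono ?_ fun τ _ hτ a ha => by simp [hτ a ha]
  · have hτ := h.frame hF' rfl
    have hw : ∀ b ≠ 8, (fill 8 (avoids r r')).any (Instr.writesArr b) = false := fun b hb => by
      simp [fill, forLoop, avoids, block, Program.any, Instr.writesArr, hb]
    rw [avoids_run hτ.reg'.1, hr₁₃, hF'.arr r (hw r h₈), hF'.arr r' (hw r' h₈'), hr, hr',
      hτ.arcs.2.2.1, I.arcs_link x y ha, hτ.reg.2.1]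
    refine if_congr ?_ rfl rfl
    constructor
    · rintro ⟨h₁, h₂, h₃⟩
      rw [marks_val ⟨a / 2, h₁⟩] at h₂ h₃
      refine ⟨⟨a / 2, h₁⟩, rfl, ?_⟩
      rw [hF]
      rintro (h | h) <;> simp [h] at h₂ h₃
    · rintro ⟨e, he, heF⟩
      rw [hF, not_or] at heF
      rw [he, marks_val, marks_val]
      simp [heF.1, heF.2]
  · have : (avoids r r').size = 12 := rfl
    rw [this]
    omega

theorem Memory.linkWeight_runs (h : I.Memory x y σ) :
    Runs (wfill 1 linkWeight) (40 * (n * m)) σ fun τ => ∀ a < 2 * m + 2, ∀ e : Fin m,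
      (I.arcs x y).link a = e → τ.warr 1 a = I.prob e := by
  obtain ⟨n₁, n₂, n₃⟩ := I.bounds
  refine (wfill_runs (P := linkWeight) (fun a => arrayOf I.prob ((I.arcs x y).link a)) rfl rfl rfl
    rfl h.reg'.2.2.1 fun a ha τ hF hr => ?_).mono ?_ fun τ _ hτ a ha e he => ?_
  · have hτ := h.frame hF rfl
    simp [linkWeight, block, Program.run, hr, hτ.arcs, hτ.warr]
  · have : linkWeight.size = 3 := rfl
    rw [this]
    omega
  · rw [hτ a ha, he, arrayOf_val]

theorem Memory.markedWeight_runs (h : I.Memory x y σ) :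
    Runs (wfill 1 markedWeight) (60 * (n * m)) σ fun τ => ∀ a < 2 * m + 2, ∀ e : Fin m,
      (I.arcs x y).link a = e → τ.warr 1 a = I.weight' e := by
  obtain ⟨n₁, n₂, n₃⟩ := I.bounds
  refine (wfill_runs (P := markedWeight) (fun a => if Survivable.marks I.p₁ ((I.arcs x y).link a) = 1
    then arrayOf I.prob ((I.arcs x y).link a) else 0) rfl rfl rfl
    rfl h.reg'.2.2.1 fun a ha τ hF hr => ?_).mono ?_ fun τ _ hτ a ha e he => ?_
  · have hτ := h.frame hF rfl
    simp only [markedWeight, block, Program.run]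
    by_cases hm : Survivable.marks I.p₁ ((I.arcs x y).link a) = 1 <;>
      simp [Test.Holds, hr, hτ.arcs, hτ.warr, hτ.marks, hτ.reg', hτ.wreg, hm]
  · have : markedWeight.size = 6 := rfl
    rw [this]
    omega
  · rw [hτ a ha, he, arrayOf_val, marks_val, weight']
    by_cases he : e ∈ I.p₁ <;> simp [he]

theorem Memory.tunableWeight_runs (h : I.Memory x y σ) {p q : List (Fin m)} (hp : p.Nodup)
    (hq : q.Nodup) (hpσ : σ.HoldsList 22 24 p) (hqσ : σ.HoldsList 24 26 q)
    (h₂₉ : σ.arr 29 = fun _ => 0) (h₃₀ : σ.arr 30 = fun _ => 0) :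
    Runs tunableWeight (40 * (n * m)) σ fun τ => τ.wreg 8 =
      ∑ e, if e ∈ I.p₁ ∨ e ∈ p ∧ e ∈ q then I.prob e else 0 := by
  have hp' := length_le_m hp
  have hq' := length_le_m hq
  obtain ⟨n₁, n₂, n₃⟩ := I.bounds
  refine Runs.seq (k := m * 5 + 2) (l := m * 22 + 10) ((markPath_runs hpσ h₂₉ h.reg'.2.1 (by decide)
    (by decide) (by decide)).mono (by omega) fun _ _ h => h) (fun τ F h₁ => ?_) (by omega)
  have hτ := h.frame F rfl
  refine Runs.seq (k := m * 5 + 2) (l := m * 17 + 8) ((markPath_runs (l := q) (a := 26) ⟨?_, ?_⟩ ?_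
    hτ.reg'.2.1 (by decide) (by decide) (by decide)).mono (by omega) fun _ _ h => h)
    (fun υ F' h₂ => ?_) (by omega)
  · rw [F.reg 24 rfl]; exact hqσ.1
  · rw [F.arr 26 rfl]; exact hqσ.2
  · rw [F.arr 30 rfl]; exact h₃₀
  have hυ := hτ.frame F' rfl
  rw [← F'.arr 29 rfl] at h₁
  refine Runs.seq (k := 2) (l := m * 17 + 2) (Runs.of_run (Q := fun ω => ω.wreg 8 = 0) rfl
    (by simp [block, Program.run]) le_rfl) (fun ω F₁ hω => ?_) (by omega)
  have hMω := hυ.frame F₁ rfl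
  rw [← F₁.arr 29 rfl] at h₁
  rw [← F₁.arr 30 rfl] at h₂
  refine (Runs.forLoop (c := 15) (n := m) (Inv := fun j ρ => ρ.wreg 8 = ∑ e ∈ Finset.range j,
    if Survivable.marks I.p₁ e = 1 ∨ Survivable.marks p e = 1 ∧ Survivable.marks q e = 1 then
      arrayOf I.prob e else 0) rfl rfl (by decide) hMω.reg.2.1 (by simpa using hω)
    fun j hj ρ F₂ hr hI => Runs.of_run rfl ?_ (by decide)).mono le_rfl fun ρ F₂ hρ => ?_
  · have hMρ := hMω.frame F₂ rfl
    rw [← F₂.arr 29 rfl] at h₁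
    rw [← F₂.arr 30 rfl] at h₂
    rw [Finset.sum_range_succ, ← hI]
    simp only [block, Program.run, addWeight]
    by_cases c₁ : Survivable.marks I.p₁ j = 1 <;> by_cases c₂ : Survivable.marks p j = 1 <;>
      by_cases c₃ : Survivable.marks q j = 1 <;>
      simp [Test.Holds, hr, hMρ.reg', hMρ.marks, hMρ.warr, h₁, h₂, c₁, c₂, c₃]
  · rw [hρ, Finset.sum_range]
    refine Finset.sum_congr rfl fun e _ => ?_
    rw [marks_val, marks_val, marks_val, arrayOf_val]
    simp

/-- Since `p₁` and `b₁` are disjoint, `p₁ \ b₁` is all of `p₁`, and it is disjoint from `p ∩ b`. So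
the value is a single sum over the links, which one pass can compute. -/
theorem failureProb_eq_sum {p b : List (Fin m)} (hc : ¬ Connected I.G₂ I.s₂ I.t₂)
    (h : TunablePair I.G₁ I.s₂ I.t₂ p b) : I.failureProb p b =
      ∑ e, if e ∈ I.p₁ ∨ e ∈ p ∧ e ∈ b then I.prob e else 0 := by
  obtain ⟨hf, hv⟩ := TunablePair.value_G₁ hc h
  have hd := hf.2.2
  rw [hv.eq_failureProb hd, linkProb, linkProb, ← Finset.sum_union, ← Finset.sum_filter]
  · refine Finset.sum_congr (Finset.ext fun e => ?_) fun _ _ => rfl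
    have := @I.disjoint₁ e
    simp only [Finset.mem_union, Finset.mem_inter, Finset.mem_sdiff, List.mem_toFinset,
      Finset.mem_filter, Finset.mem_univ, true_and]
    tauto
  · rw [Finset.disjoint_left]
    intro e h₁ h₂
    simp only [Finset.mem_inter, Finset.mem_sdiff, List.mem_toFinset] at h₁ h₂
    exact hd h₂.1 h₁.1

end Instance


/-! ### Output -/

/-- Copy the list with length in register `r` from array `a` to array `b`. -/
def copyList (r a b : ℕ) : Program := forLoop 12 r (block [.load 16 a 12, .store b 12 16])

/-- Write two lists, with lengths in registers `r` and `r'`, from arrays `a` and `a'` to the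
output. -/
def output (r a r' a' : ℕ) : Program :=
  .seq (copyList r a 0) <| .seq (copyList r' a' 1) (block [.const 0 1, .copy 1 r, .copy 2 r'])

section Output

variable {m : ℕ} {σ : State} {r a b r' a' : ℕ} {p q : List (Fin m)}

theorem State.HoldsList.frame {τ : State}
    (h : σ.HoldsList r a p) {P : Program} (hF : Frame P σ τ)
    (h₁ : P.any (Instr.writesReg r) = false) (h₂ : P.any (Instr.writesArr a) = false) :
    τ.HoldsList r a p :=
  ⟨(hF.reg r h₁).trans h.1, by rw [hF.arr a h₂]; exact h.2⟩

theorem copyList_runs (h : σ.HoldsList r a p) (hab : a ≠ b) (h₁₂ : r ≠ 12) (h₁₆ : r ≠ 16) :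
    Runs (copyList r a b) (p.length * 5 + 2) σ fun τ =>
      ∀ i : Fin p.length, τ.arr b i = (p.get i).val := by
  refine (Runs.forLoop (c := 3) (Inv := fun j τ => ∀ i : Fin p.length, i < j →
    τ.arr b i = (p.get i).val) rfl (by simp [block, Program.any, Instr.writesReg, h₁₆]) h₁₂.symm h.1
    (by simp) fun j hj τ F hr hI => Runs.of_run rfl ?_ le_rfl).mono le_rfl
    fun τ F h i => h i i.2
  have ha : τ.arr a = σ.arr a := F.arr a (by
    simp [forLoop, block, Program.any, Instr.writesArr, hab])
  have hv := h.2 ⟨j, hj⟩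
  intro i hij
  simp only [block, Program.run, exec_skip, arr_inc, arr_store, arr_load, reg_load, if_true, hr, ha,
    Function.update_apply]
  rw [if_neg (by decide : ¬ 12 = 16)]
  split_ifs with hi
  · obtain rfl : i = ⟨j, hj⟩ := Fin.ext hi
    exact hv
  · exact hI i (by omega)

theorem output_runs (hp : σ.HoldsList r a p) (hq : σ.HoldsList r' a' q) (hr : 19 ≤ r) (ha : 2 ≤ a)
    (hr' : 19 ≤ r') (ha' : 2 ≤ a') (hpm : p.length ≤ m) (hqm : q.length ≤ m) :
    Runs (output r a r' a') (m * 10 + 8) σ fun τ => τ.Outputs (some (p, q)) := by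
  refine Runs.seq (l := m * 5 + 6) (copyList_runs hp (by omega) (by omega) (by omega))
    (fun τ F h₁ => ?_) (by omega)
  have wr : ∀ k a b, ∀ c ≥ 19, (copyList k a b).any (Instr.writesReg c) = false := by
    intro k a b c hc
    simp only [copyList, forLoop, block, Program.any, Instr.writesReg, Bool.or_false,
      Bool.or_eq_false_iff, beq_eq_false_iff_ne]
    omega
  have wa : ∀ k a b, ∀ c ≠ b, (copyList k a b).any (Instr.writesArr c) = false := by
    intro k a b c hc
    simp [copyList, forLoop, block, Program.any, Instr.writesArr, hc]
  refine Runs.seq (l := 4) (copyList_runs (a := a') (r := r') (p := q)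
    ⟨by rw [F.reg r' (wr _ _ _ _ hr')]; exact hq.1,
      by rw [F.arr a' (wa _ _ _ _ (by omega))]; exact hq.2⟩ (by omega) (by omega) (by omega))
    (fun υ F' h₂ => Runs.of_run rfl ?_ le_rfl) (by omega)
  have e₁ : r ≠ 0 := by omega
  have e₂ : r' ≠ 0 := by omega
  have e₃ : r' ≠ 1 := by omega
  have h₃ : υ.reg r = p.length :=
    (F'.reg r (wr _ _ _ _ hr)).trans ((F.reg r (wr _ _ _ _ hr)).trans hp.1)
  have h₄ : υ.reg r' = q.length :=
    (F'.reg r' (wr _ _ _ _ hr')).trans ((F.reg r' (wr _ _ _ _ hr')).trans hq.1)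
  rw [← F'.arr 0 (wa _ _ _ _ (by omega))] at h₁
  simp only [block, Program.run, State.Outputs, State.HoldsList]
  simp [e₁, e₂, e₃, h₃, h₄]
  exact ⟨by simpa using h₁, by simpa using h₂⟩

end Output

/-! ### The second case: the terminals are separated by the links of the first connection -/

/-- Compare the tunable pair with the pair of shortest paths, whose second path is to be extracted
from the search tree. -/
def choosePair : Program :=
  .ite (.eq 18 8) (output 22 24 24 26) <| .seq (block [.wload 10 2 4, .wadd 9 9 10]) <|
    .ite (.wlt 9 8) (.seq (extract 18 28 26) (output 25 27 26 28)) (output 22 24 24 26)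

/-- The steps of the algorithm that follow the search in the network without the links of the first
primary path, if it has been successful. -/
def tunableCase : Program :=
  .seq firstPath <| .seq pair <| .seq tunableWeight <| .seq (fill 8 (avoids 19 19)) <|
    .seq (wfill 1 linkWeight) <| .seq (searchWalk 17 27 25) <| .seq (block [.wload 9 2 4]) <|
      .seq (fill 8 (avoids 20 20)) <| .seq (wfill 1 markedWeight) <| .seq search <|
        .seq (block [.load 18 9 4]) choosePair

namespace Instance

variable {n m : ℕ} {I : Instance n m} {σ : State} {x y : ℕ} {A : ℕ → Prop} {W : ℕ → ℝ}
  {T : ℕ → List ℕ} {p b p₂ : List (Fin m)}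

theorem prob_nonneg' {a : ℕ} {W : ℕ → ℝ} {w : Fin m → ℝ} {F : Set (Fin m)} (hw : ∀ e, 0 ≤ w e)
    (hW : ∀ a < 2 * m + 2, ∀ e : Fin m, (I.arcs x y).link a = e → W a = w e) (ha : linkArcs F a) :
    0 ≤ W a := by
  have hlt := ha.lt
  obtain ⟨e, he, -⟩ := ha
  rw [hW a (by omega) e (by rw [I.arcs_link x y (by omega), he])]
  exact hw e

theorem weight'_nonneg (e : Fin m) : 0 ≤ I.weight' e := by
  rw [weight']
  split_ifs
  exacts [I.prob_nonneg e, le_rfl]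

/-- The value of the pair of shortest paths splits into two path weights: that of `p₂` is in weight
register `9`, and the search has left that of the backup path as the distance of `s₂`. One addition
and one comparison decide, and the backup path is extracted only if it is returned. -/
theorem Memory.choosePair_runs (h : I.Memory 0 0 σ) (hc : ¬ Connected I.G₂ I.s₂ I.t₂)
    (hpb : TunablePair I.G₁ I.s₂ I.t₂ p b) (hp : σ.HoldsList 22 24 p) (hb : σ.HoldsList 24 26 b)
    (h₈ : σ.wreg 8 = I.failureProb p b) (hp₂ : IsShortestPath I.G₁ I.prob I.s₂ p₂ I.t₂)
    (hp₂σ : σ.HoldsList 25 27 p₂) (h₉ : σ.wreg 9 = (p₂.map I.prob).sum)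
    (hA : ∀ a < 2 * m + 2, σ.arr 8 a = 1 ↔ linkArcs {e | e ∈ I.b₁} a)
    (hW : ∀ a < 2 * m + 2, ∀ e : Fin m, (I.arcs 0 0).link a = e → σ.warr 1 a = I.weight' e)
    (hT : (I.arcs 0 0).SpanningTree (linkArcs {e | e ∈ I.b₁}) (σ.warr 1) n I.t₂ (σ.arr 9)
      (σ.warr 2) (σ.arr 10) T) (h₁₈ : σ.reg 18 = σ.arr 9 I.s₂) :
    Runs choosePair (60 * (n * m)) σ fun τ => ∃ o, τ.Outputs o ∧ I.SCA o := by
  obtain ⟨n₁, n₂, n₃⟩ := I.bounds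
  have hR : Represents (I.arcs 0 0) (linkArcs {e | e ∈ I.b₁}) I.G₁' Fin.val :=
    I.represents {e | e ∈ I.b₁} 0 0
  have hpm := length_le_m hpb.1.nodup_links
  have hbm := length_le_m hpb.2.1.nodup_links
  have hp₂m := length_le_m hp₂.1.nodup_links
  refine Runs.ite (k := 59 * (n * m)) (fun ht => ?_) (fun ht => ?_) (by omega)
  · have hv : σ.arr 9 I.s₂ = 0 := h₁₈ ▸ (show σ.reg 18 = σ.reg 8 from ht).trans h.reg'.1
    refine (output_runs hp hb (by decide) (by decide) (by decide) (by decide) hpm hbm).mono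
      (by omega) fun τ F hτ => ⟨_, hτ, .tunableOnly hc hpb fun hc' => ?_⟩
    exact (hT.vis_iff I.s₂.2).2 (hR.connected_iff.1 hc') hv
  · have hv : σ.arr 9 I.s₂ ≠ 0 := fun hv => ht ((h₁₈.trans hv).trans h.reg'.1.symm)
    obtain ⟨b₂, hb₂, hbs, hD⟩ := hR.exists_isShortestPath (w := I.weight') (fun a e ha he =>
      hW a (by have := ha.lt; omega) e he) hT hv
    have hb₂m := length_le_m hbs.1.nodup_links
    have hval := failureProb_overlapped hc hp₂.1 hbs.1
    refine Runs.seq (k := 3) (l := 55 * (n * m)) (Runs.of_run (Q := fun τ =>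
      τ.wreg 9 = I.failureProb p₂ b₂) rfl ?_ le_rfl) (fun τ F hτ => ?_) (by omega)
    · rw [hval, ← hD]
      simp [block, Program.run, h.reg, h₉]
    have M := h.frame F rfl
    have h₈' : τ.wreg 8 = I.failureProb p b := (F.wreg 8 rfl).trans h₈
    refine Runs.ite (k := 54 * (n * m)) (fun ht => ?_) (fun ht => ?_) (by omega)
    · have hlt : I.failureProb p₂ b₂ < I.failureProb p b := by
        rw [← hτ, ← h₈']; exact ht
      refine Runs.seq (l := m * 10 + 8) (extract_runs (M.searchInput (by rw [F.arr 8 rfl]; exact hA)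
        (fun a ha => by have := ha.lt; omega) fun a ha => rfl) M.arcs.2.2.1 M.reg.2.2.2.1 (T := T)
        ?_ I.s₂.2 (by rw [F.arr 9 rfl]; exact hv) (by decide) (by decide) (by decide) (by decide))
        (fun υ F' hυ => ?_) (by omega)
      · rw [F.arr 9 rfl, F.arr 10 rfl, F.warr 1 rfl, F.warr 2 rfl]
        exact hT
      · have hw : υ.HoldsWalk (I.arcs 0 0) (2 * m + 2) 26 28 18 (T I.s₂) := ⟨hυ.1, hυ.2.1, hυ.2.2⟩
        refine (output_runs (a := 27) (r := 25) (p := p₂) ⟨?_, ?_⟩ (hw.holdsList hb₂) (by decide)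
          (by decide) (by decide) (by decide) hp₂m hb₂m).mono (by omega)
          fun ω _ hω => ⟨_, hω, .overlapped hc hpb hp₂ hbs hlt⟩
        · rw [F'.reg 25 rfl, F.reg 25 rfl]; exact hp₂σ.1
        · rw [F'.arr 27 rfl, F.arr 27 rfl]; exact hp₂σ.2
    · have hlt : ¬ I.failureProb p₂ b₂ < I.failureProb p b := by
        rw [← hτ, ← h₈']; exact ht
      exact (output_runs (hp.frame F rfl rfl) (hb.frame F rfl rfl) (by decide) (by decide)
        (by decide) (by decide) hpm hbm).mono (by omega) fun ω _ hω => ⟨_, hω, .tunable hc hpb hp₂ hbs hlt⟩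

/-- The value of the tunable pair and the weight of `p₂` are kept in weight registers that the later
searches do not write. Arrays `29` and `30` must be zero at the start, because marking a list does
not clear its array. -/
theorem Memory.tunableCase_runs (h : I.Memory 0 0 σ)
    (hA : ∀ a < 2 * m + 2, σ.arr 8 a = 1 ↔ linkArcs {e | e ∈ I.p₁} a)
    (h₀ : ∀ r ∈ [21, 29, 30], σ.arr r = fun _ => 0)
    (hW : ∀ a, linkArcs {e | e ∈ I.p₁} a → σ.warr 1 a = W a)
    (hT : (I.arcs 0 0).SpanningTree (linkArcs {e | e ∈ I.p₁}) W n I.t₂ (σ.arr 9) (σ.warr 2)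
      (σ.arr 10) T) (hv : σ.arr 9 I.s₂ ≠ 0) (hc : ¬ Connected I.G₂ I.s₂ I.t₂) :
    Runs tunableCase (2200 * (n * m)) σ fun τ => ∃ o, τ.Outputs o ∧ I.SCA o := by
  obtain ⟨n₁, n₂, n₃⟩ := I.bounds
  have hR : Represents (I.arcs 0 0) (linkArcs {e | e ∈ I.p₁}) I.G₁ Fin.val :=
    I.represents {e | e ∈ I.p₁} 0 0
  have hR' : Represents (I.arcs 0 0) (linkArcs {e | e ∈ I.b₁}) I.G₁' Fin.val :=
    I.represents {e | e ∈ I.b₁} 0 0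
  have hlt : ∀ {F : Set (Fin m)} a, linkArcs F a → a < 2 * m + 2 := fun a ha => by
    have := ha.lt; omega
  refine Runs.seq (l := 2130 * (n * m)) (h.firstPath_runs hA hlt hW hT hv)
    (fun σ₁ F₁ ⟨P, hP, hPs, h₁₂, hW₁⟩ => ?_) (by omega)
  have M₁ := h.frame F₁ rfl
  refine Runs.seq (l := 830 * (n * m)) (M₁.pair_runs (g := []) hR.symm
    (by rw [F₁.arr 8 rfl]; exact hA) hlt (fun a ha => arcs_lt I.s₂.pos I.s₂.pos ha) hP hPs
    (fun a ha => (hP.mem ha).lt) h₁₂ hW₁ ?_ fun B hB => ⟨B, hB.mono fun a ha hA =>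
      ⟨hA.lt, Or.inl ha⟩⟩) (fun σ₂ F₂ ⟨P', B, b', hpair, hw₁, hw₂⟩ => ?_) (by omega)
  · rw [F₁.arr 21 rfl, h₀ 21 (by simp)]
    funext e
    simp [Survivable.marks]
  obtain ⟨p, b, hpl, hbl, hpb⟩ := hpair.tunablePair
  have hpb : TunablePair I.G₁ I.s₂ I.t₂ p b := hpb
  have M₂ := M₁.frame F₂ rfl
  have hp₂ := hw₁.holdsList hpl
  have hb₂ := hw₂.holdsList hbl
  refine Runs.seq (l := 790 * (n * m)) (M₂.tunableWeight_runs hpb.1.nodup_links hpb.2.1.nodup_links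
    hp₂ hb₂ ?_ ?_) (fun σ₃ F₃ h₃ => ?_) (by omega)
  · rw [F₂.arr 29 rfl, F₁.arr 29 rfl, h₀ 29 (by simp)]
  · rw [F₂.arr 30 rfl, F₁.arr 30 rfl, h₀ 30 (by simp)]
  rw [← failureProb_eq_sum hc hpb] at h₃
  have M₃ := M₂.frame F₃ rfl
  refine Runs.seq (l := 690 * (n * m)) (M₃.avoids_runs (F := {e | e ∈ I.p₁}) M₃.marks.1 M₃.marks.1
    (by decide) (by decide) (by simp)) (fun σ₄ F₄ h₄ => ?_) (by omega)
  have M₄ := M₃.frame F₄ rfl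
  refine Runs.seq (l := 650 * (n * m)) M₄.linkWeight_runs (fun σ₅ F₅ h₅ => ?_) (by omega)
  have M₅ := M₄.frame F₅ rfl
  rw [← F₅.arr 8 rfl] at h₄
  refine Runs.seq (l := 460 * (n * m)) (M₅.searchWalk_runs h₄ hlt hR.arc_lt (fun _ _ => rfl)
    (fun a ha => prob_nonneg' I.prob_nonneg h₅ ha) ⟨P, hP⟩ (by decide) (by decide) (by decide)
    (by decide)) (fun σ₆ F₆ ⟨T₆, hT₆, hv₆, hw₆⟩ => ?_) (by omega)
  have M₆ := M₅.frame F₆ rfl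
  obtain ⟨p₂, hp₂l, hp₂s, hD₆⟩ := hR.exists_isShortestPath (w := I.prob) (fun a e ha he =>
    h₅ a (hlt a ha) e he) hT₆ hv₆
  have hp₂σ := hw₆.holdsList hp₂l
  refine Runs.seq (k := 2) (l := 450 * (n * m)) (Runs.of_run (Q := fun τ =>
    τ.wreg 9 = (p₂.map I.prob).sum) rfl ?_ le_rfl) (fun σ₇ F₇ h₇ => ?_) (by omega)
  · rw [← hD₆]
    simp [block, Program.run, M₆.reg]
  have M₇ := M₆.frame F₇ rfl
  refine Runs.seq (l := 350 * (n * m)) (M₇.avoids_runs (F := {e | e ∈ I.b₁}) M₇.marks.2 M₇.marks.2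
    (by decide) (by decide) (by simp)) (fun σ₈ F₈ h₈ => ?_) (by omega)
  have M₈ := M₇.frame F₈ rfl
  refine Runs.seq (l := 290 * (n * m)) M₈.markedWeight_runs (fun σ₉ F₉ h₉ => ?_) (by omega)
  have M₉ := M₈.frame F₉ rfl
  rw [← F₉.arr 8 rfl] at h₈
  refine Runs.seq (l := 120 * (n * m)) (M₉.search_runs h₈ hlt hR'.arc_lt (fun _ _ => rfl)
    (fun a ha => prob_nonneg' weight'_nonneg h₉ ha)) (fun τ F₁₀ ⟨T₁₀, hT₁₀⟩ => ?_) (by omega)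
  have M₁₀ := M₉.frame F₁₀ rfl
  rw [← F₁₀.arr 8 rfl] at h₈
  rw [← F₁₀.warr 1 rfl] at h₉ hT₁₀
  refine Runs.seq (k := 2) (l := 60 * (n * m)) (Runs.of_run (Q := fun υ =>
    υ.reg 18 = τ.arr 9 I.s₂) rfl (by simp [block, Program.run, M₁₀.reg]) le_rfl)
    (fun υ F₁₁ h₁₈ => ?_) (by omega)
  have M₁₁ := M₁₀.frame F₁₁ rfl
  rw [← F₁₁.arr 9 rfl] at h₁₈
  rw [← F₁₁.arr 9 rfl, ← F₁₁.arr 10 rfl, ← F₁₁.warr 1 rfl, ← F₁₁.warr 2 rfl] at hT₁₀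
  rw [← F₁₁.warr 1 rfl] at h₉
  rw [← F₁₁.arr 8 rfl] at h₈
  refine M₁₁.choosePair_runs hc hpb ?_ ?_ ?_ hp₂s ?_ ?_ h₈ h₉ hT₁₀ h₁₈
  · exact ((((((((hp₂.frame F₃ rfl rfl).frame F₄ rfl rfl).frame F₅ rfl rfl).frame F₆ rfl rfl).frame
      F₇ rfl rfl).frame F₈ rfl rfl).frame F₉ rfl rfl).frame F₁₀ rfl rfl).frame F₁₁ rfl rfl
  · exact ((((((((hb₂.frame F₃ rfl rfl).frame F₄ rfl rfl).frame F₅ rfl rfl).frame F₆ rfl rfl).frame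
      F₇ rfl rfl).frame F₈ rfl rfl).frame F₉ rfl rfl).frame F₁₀ rfl rfl).frame F₁₁ rfl rfl
  · rw [F₁₁.wreg 8 rfl, F₁₀.wreg 8 rfl, F₉.wreg 8 rfl, F₈.wreg 8 rfl, F₇.wreg 8 rfl, F₆.wreg 8 rfl,
      F₅.wreg 8 rfl, F₄.wreg 8 rfl, h₃]
  · exact ((((hp₂σ.frame F₇ rfl rfl).frame F₈ rfl rfl).frame F₉ rfl rfl).frame F₁₀ rfl rfl).frame F₁₁
      rfl rfl
  · rw [F₁₁.wreg 9 rfl, F₁₀.wreg 9 rfl, F₉.wreg 9 rfl, F₈.wreg 9 rfl, h₇]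

end Instance


/-! ### The program -/

/-- A program for Algorithm SCA. -/
def scaProgram : Program :=
  .seq setup <| .seq (fill 8 (avoids 19 20)) <| .seq search <| .seq (block [.load 18 9 4]) <|
    .ite (.eq 18 8)
      (.seq (fill 8 (avoids 19 19)) <| .seq search <| .seq (block [.load 18 9 4]) <|
        .ite (.eq 18 8) (block [.const 0 0]) tunableCase)
      (.seq detourCase (output 22 24 24 26))

namespace Instance

variable {n m : ℕ} {I : Instance n m}

/-- Links of a path are distinct, so this bounds the lengths of the lists to be copied to the output
by `m`. -/
theorem SCA.isPath {p q : List (Fin m)} (h : I.SCA (some (p, q))) :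
    IsPath I.G I.s₂ p I.t₂ ∧ IsPath I.G I.s₂ q I.t₂ :=
  ⟨h.solves.1.1, h.solves.1.2.1⟩

/-- Connectivity in `G₂`, and then in `G₁`, is decided by a search with all weights zero: the
terminals are connected exactly if `s₂` is marked. The same search tree supplies the path `P` from
which the chosen case starts. -/
theorem scaProgram_runs (I : Instance n m) : Runs scaProgram (3000 * (n * m)) I.encode fun τ =>
    ∃ o, τ.Outputs o ∧ I.SCA o := by
  obtain ⟨n₁, n₂, n₃⟩ := I.bounds
  have hR₂ : Represents (I.arcs 0 0) (linkArcs I.firstLinks) I.G₂ Fin.val :=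
    I.represents I.firstLinks 0 0
  have hR₁ : Represents (I.arcs 0 0) (linkArcs {e | e ∈ I.p₁}) I.G₁ Fin.val :=
    I.represents {e | e ∈ I.p₁} 0 0
  have hlt : ∀ {F : Set (Fin m)} a, linkArcs F a → a < 2 * m + 2 := fun a ha => by
    have := ha.lt; omega
  refine Runs.seq (l := 2900 * (n * m)) setup_runs (fun σ₁ F₁ ⟨M₁, hW, h₀⟩ => ?_) (by omega)
  refine Runs.seq (l := 2800 * (n * m)) (M₁.avoids_runs (F := I.firstLinks) M₁.marks.1 M₁.marks.2
    (by decide) (by decide) fun _ => Iff.rfl) (fun σ₂ F₂ hA => ?_) (by omega)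
  have M₂ := M₁.frame F₂ rfl
  rw [← F₂.warr 1 rfl] at hW
  refine Runs.seq (l := 2639 * (n * m)) (M₂.search_runs (W := fun _ => 0) hA hlt hR₂.arc_lt
    (fun _ _ => by rw [hW]) fun _ _ => le_rfl) (fun σ₃ F₃ ⟨T, hT⟩ => ?_) (by omega)
  have M₃ := M₂.frame F₃ rfl
  rw [← F₃.warr 1 rfl] at hW
  rw [← F₃.arr 8 rfl] at hA
  refine Runs.seq (k := 2) (l := 2637 * (n * m)) (Runs.of_run (Q := fun υ =>
    υ.reg 18 = σ₃.arr 9 I.s₂) rfl (by simp [block, Program.run, M₃.reg]) le_rfl)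
    (fun σ₄ F₄ h₁₈ => ?_) (by omega)
  have M₄ := M₃.frame F₄ rfl
  rw [← F₄.warr 1 rfl] at hW
  rw [← F₄.arr 8 rfl] at hA
  rw [← F₄.arr 9 rfl] at h₁₈
  rw [← F₄.arr 9 rfl, ← F₄.arr 10 rfl, ← F₄.warr 2 rfl] at hT
  have h₀' : ∀ r ∈ [21, 29, 30], σ₄.arr r = fun _ => 0 := by
    intro r hr
    rw [← h₀ r hr]
    fin_cases hr <;> exact (F₄.arr _ rfl).trans ((F₃.arr _ rfl).trans (F₂.arr _ rfl))
  refine Runs.ite (k := 2600 * (n * m)) (fun ht => ?_) (fun ht => ?_) (by omega)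
  · have hv : σ₄.arr 9 I.s₂ = 0 := h₁₈ ▸ (show σ₄.reg 18 = σ₄.reg 8 from ht).trans M₄.reg'.1
    have hc : ¬ Connected I.G₂ I.s₂ I.t₂ := fun hc =>
      (hT.vis_iff I.s₂.2).2 (hR₂.connected_iff.1 hc) hv
    clear hA hT h₁₈
    refine Runs.seq (l := 2500 * (n * m)) (M₄.avoids_runs (F := {e | e ∈ I.p₁}) M₄.marks.1
      M₄.marks.1 (by decide) (by decide) (by simp)) (fun σ₅ F₅ hA => ?_) (by omega)
    have M₅ := M₄.frame F₅ rfl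
    rw [← F₅.warr 1 rfl] at hW
    refine Runs.seq (l := 2300 * (n * m)) (M₅.search_runs (W := fun _ => 0) hA hlt hR₁.arc_lt
      (fun _ _ => by rw [hW]) fun _ _ => le_rfl) (fun σ₆ F₆ ⟨T, hT⟩ => ?_) (by omega)
    have M₆ := M₅.frame F₆ rfl
    rw [← F₆.warr 1 rfl] at hW
    rw [← F₆.arr 8 rfl] at hA
    refine Runs.seq (k := 2) (l := 2298 * (n * m)) (Runs.of_run (Q := fun υ =>
      υ.reg 18 = σ₆.arr 9 I.s₂) rfl (by simp [block, Program.run, M₆.reg]) le_rfl)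
      (fun σ₇ F₇ h₁₈ => ?_) (by omega)
    have M₇ := M₆.frame F₇ rfl
    rw [← F₇.warr 1 rfl] at hW
    rw [← F₇.arr 8 rfl] at hA
    rw [← F₇.arr 9 rfl] at h₁₈
    rw [← F₇.arr 9 rfl, ← F₇.arr 10 rfl, ← F₇.warr 2 rfl] at hT
    refine Runs.ite (k := 2200 * (n * m)) (fun ht => ?_) (fun ht => ?_) (by omega)
    · have hv : σ₇.arr 9 I.s₂ = 0 := h₁₈ ▸ (show σ₇.reg 18 = σ₇.reg 8 from ht).trans M₇.reg'.1
      refine Runs.of_run rfl ⟨none, ?_, .infeasible hc fun hc =>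
        (hT.vis_iff I.s₂.2).2 (hR₁.connected_iff.1 hc) hv⟩ ?_
      · simp [State.Outputs, block, Program.run]
      · simp [block, Program.size]; omega
    · refine M₇.tunableCase_runs hA (fun r hr => ?_) (fun _ _ => by rw [hW]) hT
        (fun hv => ht ((h₁₈.trans hv).trans M₇.reg'.1.symm)) hc
      rw [← h₀' r hr]
      fin_cases hr <;> exact (F₇.arr _ rfl).trans ((F₆.arr _ rfl).trans (F₅.arr _ rfl))
  · refine Runs.seq (l := m * 10 + 8) (M₄.detourCase_runs hA (h₀' 21 (by simp))
      (fun _ _ => by rw [hW]) hT fun hv => ht ((h₁₈.trans hv).trans M₄.reg'.1.symm))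
      (fun σ₅ F₅ ⟨p, q, hS, hp, hq⟩ => ?_) (by omega)
    exact (output_runs hp hq (by decide) (by decide) (by decide) (by decide)
      (length_le_m hS.isPath.1.nodup_links) (length_le_m hS.isPath.2.nodup_links)).mono le_rfl
      fun τ _ hτ => ⟨_, hτ, hS⟩

end Instance

end Survivable

/-- Every run of Algorithm SCA returns an optimal solution of Problem 2CP-1, and Algorithm SCA can
be carried out in `O(n · m)` steps: one program executes, on every instance, a run of the algorithm
within `C * (n * m)` steps. -/
theorem mainTheorem1 :
    (∀ (n m : ℕ) (I : Survivable.Instance n m) (o : Option (List (Fin m) × List (Fin m))),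
      I.SCA o → I.Solves o) ∧
    ∃ (P : Survivable.Program) (C : ℕ), ∀ (n m : ℕ) (I : Survivable.Instance n m),
      ∃ (k : ℕ) (σ : Survivable.State) (o : Option (List (Fin m) × List (Fin m))),
        Survivable.Exec P I.encode k σ ∧ k ≤ C * (n * m) ∧ σ.Outputs o ∧ I.SCA o := by
  refine ⟨fun n m I o h => h.solves, Survivable.scaProgram, 3000, fun n m I => ?_⟩
  obtain ⟨k, σ, hE, hk, o, ho, hS⟩ := I.scaProgram_runs
  exact ⟨k, σ, o, hE, hk, ho, hS⟩
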